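/- Let $(N,g)$ be a compact smooth Riemannian manifold without boundary, of dimension $n\ge 3$, let $M\subset N$ be a compact embedded submanifold of dimension $n$ with smooth boundary, with interior $M^{\mathrm{int}}=M\setminus\partial M$, and let $U\subset N$ be an open set containing $M$. Let $\Delta$ be the Laplace–Beltrami operator of $g$ and let $L^2(M)$ be the complex space $L^2(M,dV_g)$. For $\varphi\in C^\infty(U;\mathbb{R})$ and $h>0$ put $$P_\varphi=e^{\varphi/h}(-h^2\Delta)e^{-\varphi/h},\qquad p_\varphi=|\xi|^2-|d\varphi|^2+2i\langle\xi,d\varphi\rangle\in C^\infty(T^*U).$$ The function $\varphi$ is called a limiting Carleman weight for $-h^2\Delta$ on $(U,g)$ if $d\varphi\neq0$ on $U$ and the Poisson bracket $\{\mathrm{Re}\,p_\varphi,\mathrm{Im}\,p_\varphi\}$ vanishes wherever $p_\varphi=0$; then $-\varphi$ is one as well. Let $H_\Delta(M)=\{u\in L^2(M):\Delta u\in L^2(M)\}$, with $\Delta u$ taken in the sense of distributions in $M^{\mathrm{int}}$, equipped with the norm $(\|u\|_{L^2(M)}^2+\|\Delta u\|_{L^2(M)}^2)^{1/2}$. Then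 there are bounded linear operators $G_\varphi=G_{\varphi,h}:L^2(M)\to L^2(M)$ such that for every limiting Carleman weight $\varphi$ on $(U,g)$ there are $C>0$ and $h_0>0$ for which the following holds for all $0<h<h_0$: (i) $P_\varphi G_\varphi v=v$ in the sense of distributions in $M^{\mathrm{int}}$, for all $v\in L^2(M)$; (ii) $\|G_\varphi\|_{L^2(M)\to L^2(M)}\le C/h$; (iii) $G_\varphi$ maps $L^2(M)$ continuously into $e^{\varphi/h}H_\Delta(M)$; (iv) $G_\varphi^*=G_{-\varphi}$; (v) $G_\varphi P_\varphi w=w$ for all $w\in C_0^\infty(M^{\mathrm{int}})$. -/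

import Mathlib

open MeasureTheory Set
open scoped Manifold ContDiff

noncomputable section

namespace GreenOperators

/-- Euclidean coordinate space, the model of all the manifolds below. -/
abbrev Coord (n : ℕ) : Type := EuclideanSpace ℝ (Fin n)

/-- The `i`-th coordinate vector of `ℝⁿ`. -/
abbrev stdVec {n : ℕ} (i : Fin n) : Coord n := EuclideanSpace.single i (1 : ℝ)

/-- The partial derivative `∂f/∂y_i` at `y`. -/
def pderiv {n : ℕ} {F : Type*} [NormedAddCommGroup F] [NormedSpace ℝ F]
    (i : Fin n) (f : Coord n → F) (y : Coord n) : F :=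
  fderiv ℝ f y (stdVec i)

/-- The Poisson bracket `{a, b} = ∑ₖ (∂a/∂ξₖ ∂b/∂yₖ - ∂a/∂yₖ ∂b/∂ξₖ)` of two functions of the
canonical coordinates `(y, ξ)` of the cotangent bundle. -/
def poissonBracket {n : ℕ} (a b : Coord n → Coord n → ℝ) (y ξ : Coord n) : ℝ :=
  ∑ k, (pderiv k (fun η => a y η) ξ * pderiv k (fun z => b z ξ) y
    - pderiv k (fun z => a z ξ) y * pderiv k (fun η => b y η) ξ)

/-- Smooth Riemannian metrics on the smooth manifold `N` (without boundary). -/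
abbrev RiemMetric (n : ℕ) (N : Type*) [TopologicalSpace N] [ChartedSpace (Coord n) N]
    [IsManifold (𝓡 n) ∞ N] : Type _ :=
  Bundle.ContMDiffRiemannianMetric (𝓡 n) ∞ (Coord n) (fun x : N => TangentSpace (𝓡 n) x)

section Geometry

variable {n : ℕ} {N : Type*} [TopologicalSpace N] [ChartedSpace (Coord n) N]
  [IsManifold (𝓡 n) ∞ N]

/-- The matrix `(g_{ij})` of the metric in the chart `e`, as a function on the target of `e`:
`g_{ij} = ⟨∂_i, ∂_j⟩`, where `∂_i` is the push-forward of the `i`-th coordinate vector. -/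
def metricMatrix (g : RiemMetric n N) (e : OpenPartialHomeomorph N (Coord n)) (y : Coord n) :
    Matrix (Fin n) (Fin n) ℝ :=
  Matrix.of fun i j => g.inner (e.symm y)
    (mfderiv (𝓡 n) (𝓡 n) e.symm y (stdVec i))
    (mfderiv (𝓡 n) (𝓡 n) e.symm y (stdVec j))

/-- The inverse matrix `(g^{ij})`. -/
def metricInv (g : RiemMetric n N) (e : OpenPartialHomeomorph N (Coord n)) (y : Coord n) :
    Matrix (Fin n) (Fin n) ℝ :=
  (metricMatrix g e y)⁻¹

/-- The density `√det (g_{ij})`. -/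
def volDensity (g : RiemMetric n N) (e : OpenPartialHomeomorph N (Coord n)) (y : Coord n) : ℝ :=
  Real.sqrt (metricMatrix g e y).det

/-- The Laplace–Beltrami operator on complex functions,
`Δu = |g|^{-1/2} ∑_{i,j} ∂_i (|g|^{1/2} g^{ij} ∂_j u)`, evaluated at `x` in the chart at `x`. -/
def laplacian (g : RiemMetric n N) (u : N → ℂ) (x : N) : ℂ :=
  let e := chartAt (Coord n) x
  ((volDensity g e (e x))⁻¹ : ℝ) *
    ∑ i, pderiv i (fun y => ((volDensity g e y : ℝ) : ℂ) *
      ∑ j, ((metricInv g e y i j : ℝ) : ℂ) * pderiv j (fun z => u (e.symm z)) y) (e x)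

/-- The conjugated operator `P_φ = e^{φ/h} (-h² Δ) e^{-φ/h}` on smooth functions. -/
def conjOp (g : RiemMetric n N) (φ : N → ℝ) (h : ℝ) (u : N → ℂ) (x : N) : ℂ :=
  (Real.exp (φ x / h) : ℂ) *
    (-((h : ℂ) ^ 2) * laplacian g (fun z => (Real.exp (-(φ z) / h) : ℂ) * u z) x)

/-- The real part `|ξ|² - |dφ|²` of the symbol `p_φ = |ξ|² - |dφ|² + 2i⟨ξ, dφ⟩`, in the canonical
coordinates of the cotangent bundle that belong to the chart `e`. -/
def symbolRe (g : RiemMetric n N) (φ : N → ℝ) (e : OpenPartialHomeomorph N (Coord n))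
    (y ξ : Coord n) : ℝ :=
  (∑ i, ∑ j, metricInv g e y i j * ξ i * ξ j)
    - ∑ i, ∑ j, metricInv g e y i j *
        pderiv i (fun z => φ (e.symm z)) y * pderiv j (fun z => φ (e.symm z)) y

/-- The imaginary part `2⟨ξ, dφ⟩` of the symbol `p_φ`. -/
def symbolIm (g : RiemMetric n N) (φ : N → ℝ) (e : OpenPartialHomeomorph N (Coord n))
    (y ξ : Coord n) : ℝ :=
  2 * ∑ i, ∑ j, metricInv g e y i j * ξ i * pderiv j (fun z => φ (e.symm z)) y

/-- `φ` is a limiting Carleman weight for `-h²Δ` on the open set `U`: it is smooth on `U`,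
`dφ ≠ 0` on `U`, and the Poisson bracket `{Re p_φ, Im p_φ}` vanishes at all points of `T*U` where
`p_φ` vanishes. The bracket does not depend on coordinates; it is computed in smooth charts. -/
structure IsLimitingCarlemanWeight (g : RiemMetric n N) (U : Set N) (φ : N → ℝ) : Prop where
  smooth : ContMDiffOn (𝓡 n) 𝓘(ℝ, ℝ) ∞ φ U
  mfderiv_ne_zero : ∀ x ∈ U, mfderiv (𝓡 n) 𝓘(ℝ, ℝ) φ x ≠ 0
  bracket_eq_zero : ∀ e ∈ IsManifold.maximalAtlas (𝓡 n) ∞ N, ∀ x ∈ e.source ∩ U, ∀ ξ : Coord n,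
    symbolRe g φ e (e x) ξ = 0 → symbolIm g φ e (e x) ξ = 0 →
      poissonBracket (symbolRe g φ e) (symbolIm g φ e) (e x) ξ = 0

/-- `M` is a compact smooth domain in `N`, that is, a compact embedded submanifold with smooth
boundary of the same dimension as `N`: near each point of its boundary it is the sublevel set
`{f ≤ 0}` of a smooth function with nonzero differential. Then `M^int = M \ ∂M` is the topological
interior of `M` in `N`. -/
structure IsCompactSmoothDomain (n : ℕ) {N : Type*} [TopologicalSpace N]
    [ChartedSpace (Coord n) N] (M : Set N) : Prop where
  isCompact : IsCompact M
  boundary : ∀ p ∈ frontier M, ∃ V : Set N, IsOpen V ∧ p ∈ V ∧ ∃ f : N → ℝ,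
    ContMDiffOn (𝓡 n) 𝓘(ℝ, ℝ) ∞ f V ∧ mfderiv (𝓡 n) 𝓘(ℝ, ℝ) f p ≠ 0 ∧
      M ∩ V = {x ∈ V | f x ≤ 0}

/-- The space `C₀^∞(M^int)` of complex test functions, extended by zero to `N`. -/
def testFunctions (n : ℕ) {N : Type*} [TopologicalSpace N] [ChartedSpace (Coord n) N]
    (M : Set N) : Set (N → ℂ) :=
  {w | ContMDiff (𝓡 n) 𝓘(ℝ, ℂ) ∞ w ∧ HasCompactSupport w ∧ tsupport w ⊆ interior M}

end Geometry

section Volume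

variable {n : ℕ} {N : Type*} [TopologicalSpace N] [ChartedSpace (Coord n) N]
  [IsManifold (𝓡 n) ∞ N] [T2Space N] [CompactSpace N] [MeasurableSpace N] [BorelSpace N]

/-- The measure `√det (g_{ij}) dy` of the domain of the chart `e`, as a measure on `N`. -/
def chartVolume (g : RiemMetric n N) (e : OpenPartialHomeomorph N (Coord n)) : Measure N :=
  (((volume : Measure (Coord n)).restrict e.target).withDensity
    (fun y => ENNReal.ofReal (volDensity g e y))).map e.symm

/-- A smooth partition of unity `(ρ_p)` subordinate to the covering of `N` by the domains of the
charts at its points. -/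
def chartPartition (n : ℕ) (N : Type*) [TopologicalSpace N] [ChartedSpace (Coord n) N]
    [IsManifold (𝓡 n) ∞ N] [T2Space N] [CompactSpace N] :
    SmoothPartitionOfUnity N (𝓡 n) N univ :=
  (SmoothPartitionOfUnity.exists_isSubordinate_chartAt_source (𝓡 n) N).choose

/-- The Riemannian volume measure `dV_g = ∑_p ρ_p √det (g_{ij}) dy` (it does not depend on the
partition of unity). -/
def riemVolume (g : RiemMetric n N) : Measure N :=
  Measure.sum fun p : N => (chartVolume g (chartAt (Coord n) p)).withDensity
    (fun x => ENNReal.ofReal (chartPartition n N p x))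

/-- The complex Hilbert space `L²(M) = L²(M, dV_g)`. -/
abbrev L2 (g : RiemMetric n N) (M : Set N) : Type _ := Lp ℂ 2 ((riemVolume g).restrict M)

/-- `Δu = f` in the sense of distributions in `M^int`. -/
def IsWeakLaplacian (g : RiemMetric n N) (M : Set N) (u f : L2 g M) : Prop :=
  ∀ w ∈ testFunctions n M,
    ∫ x in M, u x * laplacian g w x ∂(riemVolume g) = ∫ x in M, f x * w x ∂(riemVolume g)

/-- `P_φ u = v` in the sense of distributions in `M^int`; the formal transpose of `P_φ`
is `P_{-φ}`. -/
def IsWeakConj (g : RiemMetric n N) (M : Set N) (φ : N → ℝ) (h : ℝ) (u v : L2 g M) : Prop :=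
  ∀ w ∈ testFunctions n M,
    ∫ x in M, u x * conjOp g (-φ) h w x ∂(riemVolume g) = ∫ x in M, v x * w x ∂(riemVolume g)

end Volume

end GreenOperators

end

open GreenOperators

/-! The theorem follows from the Carleman estimate h‖w‖ ≤ C‖P_φ w‖ for smooth w supported in M
(`SmoothFn.carleman_estimate`), used for φ and for -φ, and from a Hilbert space argument that needs
nothing else.

For the estimate, φ is cut off to a global smooth function and convexified to φ + δφ²/2. The
conjugated operator splits as A + B with A symmetric and B antisymmetric, so ‖(A+B)u‖² = ‖Au‖² +
‖Bu‖² + 2(Au, Bu). Integration by parts turns the cross term into the Hessian of the weight applied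
to du, plus terms of order zero in u. The Poisson bracket condition concerns only covectors
orthogonal to dφ of length |dφ|; homogeneity and subtraction of the dφ-component extend it to a
formula for the Hessian on all covectors (`SmoothFn.hessForm_of_isLimitingCarlemanWeight`). By that
formula the commutator is a combination of A and B (`SmoothFn.integ_conj_sq`), up to O(h²) errors
and a gain of size hδ|dφ|⁴u² from the convexification. With δ = Th and T large the gain beats the
errors (`SmoothFn.sq_mul_integ_le_integ_conj_sq`), while the factor e^{δφ²/2h} = e^{Tφ²/2} that
leads back to φ does not depend on h.

For the operators, let R_φ send P_φ w to w on the closure of the range of P_φ and vanish on its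
orthogonal complement, let π_φ be the projection to that closure, and put G_φ = R_φ + R_{-φ}^*(1 -
π_φ). Then G_φ P_φ = 1 because 1 - π_φ kills the range. Formal adjointness of P_φ and P_{-φ} gives
π_φ R_{-φ} = R_φ^* π_{-φ} (`rangeProj_rangeInverse`), which is exactly G_φ^* = G_{-φ}. Finally P_φ
G_φ = 1 is the adjoint of G_{-φ} P_{-φ} = 1. Membership in e^{φ/h} H_Δ is read off the equation
satisfied by e^{-φ/h} G_φ v. -/

set_option linter.unusedSectionVars false

/-! ### Linear algebra in coordinate space -/

section
variable {n : ℕ}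

theorem sum_smul_stdVec (v : Coord n) : ∑ i, v i • stdVec i = v := by
  ext j
  simp [Finset.sum_apply, Pi.single_apply]

theorem contDiffOn_det {ι E : Type*} [Fintype ι] [DecidableEq ι] [NormedAddCommGroup E]
    [NormedSpace ℝ E] {s : Set E} {A : E → Matrix ι ι ℝ}
    (hA : ∀ i j, ContDiffOn ℝ ∞ (fun y => A y i j) s) : ContDiffOn ℝ ∞ (fun y => (A y).det) s := by
  simp only [Matrix.det_apply']
  exact ContDiffOn.sum fun σ _ => contDiffOn_const.mul (contDiffOn_prod fun i _ => hA _ _)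

/-- The Jacobian matrix of a map between coordinate spaces. -/
noncomputable def jacobian (τ : Coord n → Coord n) (y : Coord n) : Matrix (Fin n) (Fin n) ℝ :=
  Matrix.of fun k i => fderiv ℝ τ y (stdVec i) k

theorem det_jacobian (τ : Coord n → Coord n) (y : Coord n) :
    (jacobian τ y).det = (fderiv ℝ τ y).det := by
  rw [ContinuousLinearMap.det, ← LinearMap.det_toMatrix (EuclideanSpace.basisFun (Fin n) ℝ).toBasis]
  congr 1
end

/-! ### Charts and their transition maps -/

section
variable {n : ℕ} {N : Type*} [TopologicalSpace N] [ChartedSpace (Coord n) N]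

theorem mdifferentiableAt_symm {e : OpenPartialHomeomorph N (Coord n)}
    (he : e ∈ IsManifold.maximalAtlas (𝓡 n) ∞ N) {y : Coord n} (hy : y ∈ e.target) :
    MDifferentiableAt (𝓡 n) (𝓡 n) e.symm y :=
  ((contMDiffOn_symm_of_mem_maximalAtlas he).contMDiffAt
    (e.open_target.mem_nhds hy)).mdifferentiableAt (by simp)

theorem mdifferentiableAt_chart {e : OpenPartialHomeomorph N (Coord n)}
    (he : e ∈ IsManifold.maximalAtlas (𝓡 n) ∞ N) {x : N} (hx : x ∈ e.source) :
    MDifferentiableAt (𝓡 n) (𝓡 n) e x :=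
  ((contMDiffOn_of_mem_maximalAtlas he).contMDiffAt
    (e.open_source.mem_nhds hx)).mdifferentiableAt (by simp)

variable {e e' : OpenPartialHomeomorph N (Coord n)}

theorem contDiffAt_transition (he : e ∈ IsManifold.maximalAtlas (𝓡 n) ∞ N)
    (he' : e' ∈ IsManifold.maximalAtlas (𝓡 n) ∞ N) {y : Coord n} (hy : y ∈ e.target)
    (hy' : e.symm y ∈ e'.source) : ContDiffAt ℝ ∞ (e' ∘ e.symm) y := by
  rw [← contMDiffAt_iff_contDiffAt]
  exact ((contMDiffOn_of_mem_maximalAtlas he').contMDiffAt (e'.open_source.mem_nhds hy')).comp y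
    ((contMDiffOn_symm_of_mem_maximalAtlas he).contMDiffAt (e.open_target.mem_nhds hy))

theorem eventually_mem_overlap {y : Coord n} (hy : y ∈ e.target) (hy' : e.symm y ∈ e'.source) :
    ∀ᶠ z in nhds y, z ∈ e.target ∧ e.symm z ∈ e'.source :=
  (e.open_target.eventually_mem hy).and
    ((e.continuousAt_symm hy).eventually_mem (e'.open_source.mem_nhds hy'))

end

/-! ### The metric in charts: smoothness, positivity, transformation laws -/

section
variable {n : ℕ} {N : Type*} [TopologicalSpace N] [ChartedSpace (Coord n) N]
  [IsManifold (𝓡 n) ∞ N]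

/-- The field is the tangent map of `e.symm` applied to a constant section. Smoothness into the
total space is the form in which the bundle metric can be evaluated on it. -/
theorem contMDiffOn_coordField {e : OpenPartialHomeomorph N (Coord n)}
    (he : e ∈ IsManifold.maximalAtlas (𝓡 n) ∞ N) (v : Coord n) :
    ContMDiffOn (𝓡 n) (𝓡 n).tangent ∞
      (fun y => (⟨e.symm y, mfderiv (𝓡 n) (𝓡 n) e.symm y v⟩ : TangentBundle (𝓡 n) N)) e.target := by
  have h1 := (contMDiffOn_symm_of_mem_maximalAtlas he).contMDiffOn_tangentMapWithin (m := ∞)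
    (by simp) e.open_target.uniqueMDiffOn
  have h2 : ContMDiff (𝓡 n) (𝓡 n).tangent ∞
      (fun y : Coord n => (⟨y, v⟩ : TangentBundle (𝓡 n) (Coord n))) := by
    intro y
    rw [Bundle.contMDiffAt_totalSpace]
    refine ⟨contMDiffAt_id, ?_⟩
    simp
    exact contMDiffAt_const
  have h3 := h1.comp (h2.contMDiffOn (s := e.target)) (fun y hy => hy)
  refine h3.congr fun y hy => ?_
  simp only [Function.comp, tangentMapWithin]
  rw [mfderivWithin_of_isOpen e.open_target hy]

theorem contDiffOn_metricMatrix (g : RiemMetric n N) {e : OpenPartialHomeomorph N (Coord n)}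
    (he : e ∈ IsManifold.maximalAtlas (𝓡 n) ∞ N) (i j : Fin n) :
    ContDiffOn ℝ ∞ (fun y => metricMatrix g e y i j) e.target := by
  rw [← contMDiffOn_iff_contDiffOn]
  intro y hy
  have : ContMDiffWithinAt (𝓡 n) ((𝓡 n).prod 𝓘(ℝ)) ∞
      (fun m ↦ Bundle.TotalSpace.mk' ℝ (E := Bundle.Trivial N ℝ) (e.symm m)
        (g.inner (e.symm m) (mfderiv (𝓡 n) (𝓡 n) e.symm m (stdVec i))
          (mfderiv (𝓡 n) (𝓡 n) e.symm m (stdVec j)))) e.target y := by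
    apply ContMDiffWithinAt.clm_bundle_apply₂ (F₁ := Coord n) (F₂ := Coord n)
      (E₁ := fun x : N => TangentSpace (𝓡 n) x) (E₂ := fun x : N => TangentSpace (𝓡 n) x)
    · exact ContMDiffAt.comp_contMDiffWithinAt y g.contMDiff.contMDiffAt
        (contMDiffOn_symm_of_mem_maximalAtlas he y hy)
    · exact contMDiffOn_coordField he (stdVec i) y hy
    · exact contMDiffOn_coordField he (stdVec j) y hy
  simp only [Bundle.contMDiffWithinAt_totalSpace] at this
  exact this.2

theorem mfderiv_symm_injective {e : OpenPartialHomeomorph N (Coord n)}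
    (he : e ∈ IsManifold.maximalAtlas (𝓡 n) ∞ N) {y : Coord n} (hy : y ∈ e.target) :
    Function.Injective (mfderiv (𝓡 n) (𝓡 n) e.symm y) := by
  have h : mfderiv (𝓡 n) (𝓡 n) (e ∘ e.symm) y =
      (mfderiv (𝓡 n) (𝓡 n) e (e.symm y)).comp (mfderiv (𝓡 n) (𝓡 n) e.symm y) :=
    mfderiv_comp y (mdifferentiableAt_chart he (e.map_target hy)) (mdifferentiableAt_symm he hy)
  have h2 : e ∘ e.symm =ᶠ[nhds y] id := by
    filter_upwards [e.open_target.mem_nhds hy] with z hz using e.right_inv hz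
  rw [h2.mfderiv_eq, mfderiv_id] at h
  intro a b hab
  have ha := DFunLike.congr_fun h a
  have hb := DFunLike.congr_fun h b
  have hc : (mfderiv (𝓡 n) (𝓡 n) e (e.symm y)) ((mfderiv (𝓡 n) (𝓡 n) e.symm y) a) =
    (mfderiv (𝓡 n) (𝓡 n) e (e.symm y)) ((mfderiv (𝓡 n) (𝓡 n) e.symm y) b) := by rw [hab]
  exact ha.trans (hc.trans hb.symm)

/-- The pull-back of the metric to the target of the chart `e`, as a bilinear form. -/
noncomputable def pullMetric (g : RiemMetric n N) (e : OpenPartialHomeomorph N (Coord n)) (y : Coord n) :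
    Coord n →ₗ[ℝ] Coord n →ₗ[ℝ] ℝ :=
  LinearMap.mk₂ ℝ (fun a b => g.inner (e.symm y) (mfderiv (𝓡 n) (𝓡 n) e.symm y a)
      (mfderiv (𝓡 n) (𝓡 n) e.symm y b))
    (fun a b c => by
      have := (mfderiv (𝓡 n) (𝓡 n) e.symm y).map_add a b
      erw [this, map_add]; rfl)
    (fun c a b => by
      have := (mfderiv (𝓡 n) (𝓡 n) e.symm y).map_smul c a
      erw [this, map_smul]; rfl)
    (fun a b c => by
      have := (mfderiv (𝓡 n) (𝓡 n) e.symm y).map_add b c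
      erw [this, map_add])
    (fun c a b => by
      have := (mfderiv (𝓡 n) (𝓡 n) e.symm y).map_smul c b
      erw [this, map_smul])

theorem pullMetric_apply (g : RiemMetric n N) (e : OpenPartialHomeomorph N (Coord n))
    (y a b : Coord n) : pullMetric g e y a b = g.inner (e.symm y)
      (mfderiv (𝓡 n) (𝓡 n) e.symm y a) (mfderiv (𝓡 n) (𝓡 n) e.symm y b) := rfl

theorem metricMatrix_apply (g : RiemMetric n N) (e : OpenPartialHomeomorph N (Coord n))
    (y : Coord n) (i j : Fin n) :
    metricMatrix g e y i j = pullMetric g e y (stdVec i) (stdVec j) := rfl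

theorem pullMetric_eq_sum (g : RiemMetric n N) (e : OpenPartialHomeomorph N (Coord n))
    (y a b : Coord n) :
    pullMetric g e y a b = ∑ i, ∑ j, a i * metricMatrix g e y i j * b j := by
  conv_lhs => rw [← sum_smul_stdVec a, ← sum_smul_stdVec b]
  simp only [map_sum, map_smul, LinearMap.sum_apply, LinearMap.smul_apply, smul_eq_mul,
    metricMatrix_apply, Finset.mul_sum]
  rw [Finset.sum_comm]
  refine Finset.sum_congr rfl fun i _ => Finset.sum_congr rfl fun j _ => ?_
  ring

theorem posDef_metricMatrix (g : RiemMetric n N) {e : OpenPartialHomeomorph N (Coord n)}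
    (he : e ∈ IsManifold.maximalAtlas (𝓡 n) ∞ N) {y : Coord n} (hy : y ∈ e.target) :
    (metricMatrix g e y).PosDef := by
  rw [Matrix.posDef_iff_dotProduct_mulVec]
  refine ⟨?_, ?_⟩
  · ext i j
    simp [metricMatrix, g.symm]
  · intro v hv
    have hw : (WithLp.toLp 2 v : Coord n) ≠ 0 := fun h => hv (by simpa using h)
    have key : star v ⬝ᵥ (metricMatrix g e y).mulVec v =
        pullMetric g e y (WithLp.toLp 2 v) (WithLp.toLp 2 v) := by
      rw [pullMetric_eq_sum]
      simp [dotProduct, Matrix.mulVec, Finset.mul_sum, mul_assoc]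
    rw [key, pullMetric_apply]
    apply g.pos
    intro h
    exact hw (mfderiv_symm_injective he hy (h.trans (map_zero _).symm))

theorem det_metricMatrix_pos (g : RiemMetric n N) {e : OpenPartialHomeomorph N (Coord n)}
    (he : e ∈ IsManifold.maximalAtlas (𝓡 n) ∞ N) {y : Coord n} (hy : y ∈ e.target) :
    0 < (metricMatrix g e y).det :=
  (posDef_metricMatrix g he hy).det_pos

theorem volDensity_pos (g : RiemMetric n N) {e : OpenPartialHomeomorph N (Coord n)}
    (he : e ∈ IsManifold.maximalAtlas (𝓡 n) ∞ N) {y : Coord n} (hy : y ∈ e.target) :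
    0 < volDensity g e y :=
  Real.sqrt_pos.2 (det_metricMatrix_pos g he hy)

theorem contDiffOn_volDensity (g : RiemMetric n N) {e : OpenPartialHomeomorph N (Coord n)}
    (he : e ∈ IsManifold.maximalAtlas (𝓡 n) ∞ N) : ContDiffOn ℝ ∞ (volDensity g e) e.target :=
  (contDiffOn_det (contDiffOn_metricMatrix g he)).sqrt
    fun _ hy => (det_metricMatrix_pos g he hy).ne'

theorem contDiffOn_metricInv (g : RiemMetric n N) {e : OpenPartialHomeomorph N (Coord n)}
    (he : e ∈ IsManifold.maximalAtlas (𝓡 n) ∞ N) (i j : Fin n) :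
    ContDiffOn ℝ ∞ (fun y => metricInv g e y i j) e.target := by
  -- Cramer's rule: the entries of the inverse are quotients of determinants with smooth entries.
  have h : ∀ y, metricInv g e y i j = ((metricMatrix g e y).det)⁻¹ *
      ((metricMatrix g e y).updateRow j (Pi.single i 1)).det := fun y => by
    simp [metricInv, Matrix.inv_def, Matrix.adjugate_apply]
  simp only [h]
  refine ((contDiffOn_det (contDiffOn_metricMatrix g he)).inv
    fun _ hy => (det_metricMatrix_pos g he hy).ne').mul (contDiffOn_det fun k l => ?_)
  by_cases hk : k = j
  · subst hk
    simpa using contDiffOn_const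
  · simpa [Matrix.updateRow_ne hk] using contDiffOn_metricMatrix g he k l

theorem metricInv_symm (g : RiemMetric n N) (e : OpenPartialHomeomorph N (Coord n))
    (y : Coord n) (i j : Fin n) : metricInv g e y i j = metricInv g e y j i := by
  have h : (metricMatrix g e y).transpose = metricMatrix g e y := by
    ext i j
    simp [metricMatrix, g.symm]
  have := congrFun (congrFun (Matrix.transpose_nonsing_inv (metricMatrix g e y)) j) i
  rw [h] at this
  exact this

section transition
variable {e e' : OpenPartialHomeomorph N (Coord n)}

theorem pullMetric_transition (g : RiemMetric n N) (he : e ∈ IsManifold.maximalAtlas (𝓡 n) ∞ N)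
    (he' : e' ∈ IsManifold.maximalAtlas (𝓡 n) ∞ N) {y : Coord n} (hy : y ∈ e.target)
    (hy' : e.symm y ∈ e'.source) (a b : Coord n) :
    pullMetric g e y a b = pullMetric g e' (e' (e.symm y))
      (fderiv ℝ (e' ∘ e.symm) y a) (fderiv ℝ (e' ∘ e.symm) y b) := by
  have h1 : e.symm =ᶠ[nhds y] e'.symm ∘ (e' ∘ e.symm) := by
    filter_upwards [eventually_mem_overlap hy hy'] with z hz
    exact (e'.left_inv hz.2).symm
  have hτ := contDiffAt_transition he he' hy hy'
  have h2 : mfderiv (𝓡 n) (𝓡 n) (e'.symm ∘ (e' ∘ e.symm)) y =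
      (mfderiv (𝓡 n) (𝓡 n) e'.symm (e' (e.symm y))).comp
        (mfderiv (𝓡 n) (𝓡 n) (e' ∘ e.symm) y) :=
    mfderiv_comp y (mdifferentiableAt_symm he' (e'.map_source hy'))
      (hτ.contMDiffAt.mdifferentiableAt (by simp))
  rw [pullMetric_apply, h1.mfderiv_eq, h2, mfderiv_eq_fderiv, pullMetric_apply, e'.left_inv hy']
  rfl

theorem metricMatrix_transition (g : RiemMetric n N) (he : e ∈ IsManifold.maximalAtlas (𝓡 n) ∞ N)
    (he' : e' ∈ IsManifold.maximalAtlas (𝓡 n) ∞ N) {y : Coord n} (hy : y ∈ e.target)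
    (hy' : e.symm y ∈ e'.source) :
    metricMatrix g e y = (jacobian (e' ∘ e.symm) y).transpose *
      metricMatrix g e' (e' (e.symm y)) * jacobian (e' ∘ e.symm) y := by
  ext i j
  rw [metricMatrix_apply, pullMetric_transition g he he' hy hy', pullMetric_eq_sum, Matrix.mul_apply,
    Finset.sum_comm]
  refine Finset.sum_congr rfl fun k _ => ?_
  rw [Matrix.mul_apply, Finset.sum_mul]
  rfl

theorem volDensity_transition (g : RiemMetric n N) (he : e ∈ IsManifold.maximalAtlas (𝓡 n) ∞ N)
    (he' : e' ∈ IsManifold.maximalAtlas (𝓡 n) ∞ N) {y : Coord n} (hy : y ∈ e.target)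
    (hy' : e.symm y ∈ e'.source) :
    volDensity g e y = |(fderiv ℝ (e' ∘ e.symm) y).det| * volDensity g e' (e' (e.symm y)) := by
  rw [volDensity, metricMatrix_transition g he he' hy hy', Matrix.det_mul, Matrix.det_mul,
    Matrix.det_transpose, det_jacobian, mul_right_comm, ← sq, Real.sqrt_mul (sq_nonneg _),
    Real.sqrt_sq_eq_abs, volDensity]

theorem metricInv_transition (g : RiemMetric n N) (he : e ∈ IsManifold.maximalAtlas (𝓡 n) ∞ N)
    (he' : e' ∈ IsManifold.maximalAtlas (𝓡 n) ∞ N) {y : Coord n} (hy : y ∈ e.target)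
    (hy' : e.symm y ∈ e'.source) :
    metricInv g e' (e' (e.symm y)) = jacobian (e' ∘ e.symm) y * metricInv g e y *
      (jacobian (e' ∘ e.symm) y).transpose := by
  have h := metricMatrix_transition g he he' hy hy'
  have hd := (det_metricMatrix_pos g he hy).ne'
  have hJ : IsUnit (jacobian (e' ∘ e.symm) y).det := by
    rw [h, Matrix.det_mul] at hd
    exact (right_ne_zero_of_mul hd).isUnit
  have hJt : IsUnit (jacobian (e' ∘ e.symm) y).transpose.det := by rwa [Matrix.det_transpose]
  rw [metricInv, metricInv, h, Matrix.mul_inv_rev, Matrix.mul_inv_rev, ← mul_assoc,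
    Matrix.mul_nonsing_inv _ hJ, one_mul, mul_assoc, Matrix.nonsing_inv_mul _ hJt, mul_one]

end transition
end

/-! ### The Riemannian volume measure -/

section
variable {n : ℕ} {N : Type*} [TopologicalSpace N] [ChartedSpace (Coord n) N]
  [IsManifold (𝓡 n) ∞ N] [MeasurableSpace N] [BorelSpace N]
  {e e' : OpenPartialHomeomorph N (Coord n)}

theorem aemeasurable_chart_symm (e : OpenPartialHomeomorph N (Coord n)) :
    AEMeasurable e.symm ((volume : Measure (Coord n)).restrict e.target) :=
  e.continuousOn_symm.aemeasurable e.open_target.measurableSet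

theorem measurableSet_target_inter_preimage (e : OpenPartialHomeomorph N (Coord n)) {S : Set N}
    (hS : MeasurableSet S) : MeasurableSet (e.symm ⁻¹' S ∩ e.target) := by
  have h : Measurable (fun y : e.target => e.symm y) :=
    (continuousOn_iff_continuous_domRestrict.1 e.continuousOn_symm).measurable
  have h2 := e.open_target.measurableSet.subtype_image (h hS)
  convert h2 using 1
  ext y
  simp [and_comm]

theorem chartVolume_apply (g : RiemMetric n N) (e : OpenPartialHomeomorph N (Coord n)) {S : Set N}
    (hS : MeasurableSet S) :
    chartVolume g e S = ∫⁻ y in e.symm ⁻¹' S ∩ e.target, ENNReal.ofReal (volDensity g e y) := by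
  rw [chartVolume, Measure.map_apply_of_aemeasurable
    ((aemeasurable_chart_symm e).mono_ac (withDensity_absolutelyContinuous _ _)) hS,
    withDensity_apply', Measure.restrict_restrict' e.open_target.measurableSet]

theorem chartVolume_apply_inter_source (g : RiemMetric n N)
    (e : OpenPartialHomeomorph N (Coord n)) {S : Set N} (hS : MeasurableSet S) :
    chartVolume g e (S ∩ e.source) = chartVolume g e S := by
  rw [chartVolume_apply g e hS, chartVolume_apply g e (hS.inter e.open_source.measurableSet)]
  congr 2
  ext y
  simp only [mem_inter_iff, mem_preimage]
  exact ⟨fun h => ⟨h.1.1, h.2⟩, fun h => ⟨⟨h.1, e.map_target h.2⟩, h.2⟩⟩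

/-- Change of variables along the transition map: its Jacobian is the factor by which the two
densities differ. -/
theorem chartVolume_eq_of_subset (g : RiemMetric n N)
    (he : e ∈ IsManifold.maximalAtlas (𝓡 n) ∞ N) (he' : e' ∈ IsManifold.maximalAtlas (𝓡 n) ∞ N)
    {S : Set N} (hS : MeasurableSet S) (h : S ⊆ e.source) (h' : S ⊆ e'.source) :
    chartVolume g e S = chartVolume g e' S := by
  rw [chartVolume_apply g e hS, chartVolume_apply g e' hS]
  have him : e'.symm ⁻¹' S ∩ e'.target = (e' ∘ e.symm) '' (e.symm ⁻¹' S ∩ e.target) := by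
    ext z
    constructor
    · rintro ⟨hz, hzt⟩
      refine ⟨e (e'.symm z), ⟨?_, e.map_source (h hz)⟩, ?_⟩
      · simpa [e.left_inv (h hz)] using hz
      · simp [e.left_inv (h hz), e'.right_inv hzt]
    · rintro ⟨y, ⟨hy, hyt⟩, rfl⟩
      refine ⟨?_, e'.map_source (h' hy)⟩
      simpa [e'.left_inv (h' hy)] using hy
  rw [him, lintegral_image_eq_lintegral_abs_det_fderiv_mul volume
    (measurableSet_target_inter_preimage e hS)
    (f' := fun y => fderiv ℝ (e' ∘ e.symm) y)]
  · refine setLIntegral_congr_fun (measurableSet_target_inter_preimage e hS) fun y hy => ?_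
    rw [volDensity_transition g he he' hy.2 (h' hy.1), ENNReal.ofReal_mul (abs_nonneg _)]
    rfl
  · intro y hy
    exact ((contDiffAt_transition he he' hy.2 (h' hy.1)).differentiableAt
      (by simp)).hasFDerivAt.hasFDerivWithinAt
  · intro y hy z hz hyz
    have := e'.injOn (h' hy.1) (h' hz.1) hyz
    exact e.symm.injOn hy.2 hz.2 this

variable [T2Space N] [CompactSpace N]

theorem chartPartition_isSubordinate (p : N) :
    tsupport (chartPartition n N p) ⊆ (chartAt (Coord n) p).source :=
  (SmoothPartitionOfUnity.exists_isSubordinate_chartAt_source (𝓡 n) N).choose_spec p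

theorem finite_support_chartPartition :
    {p : N | (Function.support (chartPartition n N p)).Nonempty}.Finite :=
  (chartPartition n N).locallyFinite.finite_nonempty_of_compact

theorem sum_chartPartition (x : N) :
    ∑ p ∈ (finite_support_chartPartition (n := n) (N := N)).toFinset, chartPartition n N p x = 1 := by
  rw [← (chartPartition n N).sum_eq_one (mem_univ x)]
  refine (finsum_eq_sum_of_support_subset _ fun p hp => ?_).symm
  simp only [Finite.coe_toFinset, mem_ofPred_eq]
  exact ⟨x, hp⟩

/-- Each ρ_p lives in the chart at p, where the volume of that chart and that of e agree on S; the
ρ_p then sum to 1. -/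
theorem riemVolume_eq_chartVolume_of_subset (g : RiemMetric n N)
    (he : e ∈ IsManifold.maximalAtlas (𝓡 n) ∞ N) {S : Set N} (hS : MeasurableSet S)
    (h : S ⊆ e.source) : riemVolume g S = chartVolume g e S := by
  have hρm : ∀ p, Measurable fun x => ENNReal.ofReal (chartPartition n N p x) := fun p =>
    ENNReal.measurable_ofReal.comp (chartPartition n N p).contMDiff.continuous.measurable
  have key : ∀ p, ((chartVolume g (chartAt (Coord n) p)).withDensity
      (fun x => ENNReal.ofReal (chartPartition n N p x))) S =
      ∫⁻ x in S, ENNReal.ofReal (chartPartition n N p x) ∂(chartVolume g e) := by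
    intro p
    have hsrc := (chartAt (Coord n) p).open_source.measurableSet
    -- Subordination allows restricting to the overlap of the two chart domains, the only place
    -- where the measures can be compared.
    have hind : (fun x => ENNReal.ofReal (chartPartition n N p x)) =
        (chartAt (Coord n) p).source.indicator
          (fun x => ENNReal.ofReal (chartPartition n N p x)) := by
      ext x
      by_cases hx : x ∈ (chartAt (Coord n) p).source
      · simp [hx]
      · have : chartPartition n N p x = 0 := by
          by_contra h0
          exact hx (chartPartition_isSubordinate p (subset_tsupport _ h0))
        rw [indicator_of_notMem hx, this, ENNReal.ofReal_zero]
    have hm : (chartVolume g (chartAt (Coord n) p)).restrict ((chartAt (Coord n) p).source ∩ S) =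
        (chartVolume g e).restrict ((chartAt (Coord n) p).source ∩ S) := by
      ext T hT
      rw [Measure.restrict_apply hT, Measure.restrict_apply hT]
      exact chartVolume_eq_of_subset g (IsManifold.chart_mem_maximalAtlas p) he
        (hT.inter (hsrc.inter hS)) (fun x hx => hx.2.1) (fun x hx => h hx.2.2)
    rw [withDensity_apply _ hS, hind, lintegral_indicator hsrc, lintegral_indicator hsrc,
      Measure.restrict_restrict hsrc, Measure.restrict_restrict hsrc, hm]
  rw [riemVolume, Measure.sum_apply _ hS]
  simp only [key]
  rw [tsum_eq_sum (s := (finite_support_chartPartition (n := n) (N := N)).toFinset),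
    ← lintegral_finsetSum _ fun p _ => hρm p]
  · have : ∀ x, ∑ p ∈ (finite_support_chartPartition (n := n) (N := N)).toFinset,
        ENNReal.ofReal (chartPartition n N p x) = 1 := fun x => by
      rw [← ENNReal.ofReal_sum_of_nonneg fun p _ => (chartPartition n N).nonneg p x,
        sum_chartPartition, ENNReal.ofReal_one]
    rw [lintegral_congr this, lintegral_one, Measure.restrict_apply_univ]
  · intro p hp
    have h0 : ∀ x, chartPartition n N p x = 0 := fun x => by
      by_contra hx
      exact hp ((Finite.mem_toFinset _).2 ⟨x, hx⟩)
    simp [h0]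

theorem riemVolume_restrict_source (g : RiemMetric n N)
    (he : e ∈ IsManifold.maximalAtlas (𝓡 n) ∞ N) :
    (riemVolume g).restrict e.source = chartVolume g e := by
  ext S hS
  rw [Measure.restrict_apply hS, riemVolume_eq_chartVolume_of_subset g he
    (hS.inter e.open_source.measurableSet) inter_subset_right, chartVolume_apply_inter_source g e hS]

theorem setIntegral_source (g : RiemMetric n N)
    (he : e ∈ IsManifold.maximalAtlas (𝓡 n) ∞ N) {f : N → ℝ} (hf : ContinuousOn f e.source) :
    ∫ x in e.source, f x ∂(riemVolume g) = ∫ y in e.target, volDensity g e y * f (e.symm y) := by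
  have hfm : AEStronglyMeasurable f (chartVolume g e) := by
    rw [← riemVolume_restrict_source g he]
    have := ChartedSpace.secondCountable_of_sigmaCompact (Coord n) N
    exact hf.aestronglyMeasurable e.open_source.measurableSet
  rw [riemVolume_restrict_source g he]
  rw [chartVolume] at hfm ⊢
  rw [integral_map ((aemeasurable_chart_symm e).mono_ac (withDensity_absolutelyContinuous _ _)) hfm,
    integral_withDensity_eq_integral_toReal_smul₀]
  · refine setIntegral_congr_fun e.open_target.measurableSet fun y hy => ?_
    rw [ENNReal.toReal_ofReal (volDensity_pos g he hy).le, smul_eq_mul]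
  · exact ENNReal.measurable_ofReal.comp_aemeasurable
      ((contDiffOn_volDensity g he).continuousOn.aemeasurable e.open_target.measurableSet)
  · simp

/-- By compactness, local finiteness is enough; the density is bounded on a closed coordinate ball.
-/
instance riemVolume_isFiniteMeasure (g : RiemMetric n N) : IsFiniteMeasure (riemVolume g) := by
  refine ⟨isCompact_univ.measure_lt_top_of_nhdsWithin fun x _ => ?_⟩
  have he := IsManifold.chart_mem_maximalAtlas (I := 𝓡 n) (n := ∞) x
  set e := chartAt (Coord n) x
  have hx : x ∈ e.source := mem_chart_source (Coord n) x
  obtain ⟨r, hr, hball⟩ := Metric.nhds_basis_closedBall.mem_iff.1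
    (e.open_target.mem_nhds (e.map_source hx))
  obtain ⟨C, hC⟩ := (isCompact_closedBall (e x) r).exists_bound_of_continuousOn
    ((contDiffOn_volDensity g he).continuousOn.mono hball)
  have hopen : IsOpen (e.source ∩ e ⁻¹' Metric.ball (e x) r) :=
    e.isOpen_inter_preimage Metric.isOpen_ball
  refine ⟨e.source ∩ e ⁻¹' Metric.ball (e x) r,
    mem_nhdsWithin_of_mem_nhds (hopen.mem_nhds ⟨hx, by simpa using hr⟩), ?_⟩
  rw [riemVolume_eq_chartVolume_of_subset g he hopen.measurableSet inter_subset_left,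
    chartVolume_apply g e hopen.measurableSet]
  calc _ ≤ ∫⁻ y in Metric.closedBall (e x) r, ENNReal.ofReal (volDensity g e y) := by
        refine lintegral_mono_set fun y hy => ?_
        have := hy.1.2
        simp only [mem_preimage, e.right_inv hy.2] at this
        exact Metric.ball_subset_closedBall this
    _ ≤ ∫⁻ y in Metric.closedBall (e x) r, ENNReal.ofReal C := by
        refine setLIntegral_mono' measurableSet_closedBall fun y hy => ?_
        exact ENNReal.ofReal_le_ofReal ((le_abs_self _).trans (hC y hy))
    _ < ⊤ := by
        rw [setLIntegral_const]
        exact ENNReal.mul_lt_top ENNReal.ofReal_lt_top measure_closedBall_lt_top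

/-- Positivity of the density. This is what upgrades almost everywhere equality of continuous
functions to equality. -/
instance riemVolume_isOpenPosMeasure (g : RiemMetric n N) :
    (riemVolume g).IsOpenPosMeasure := by
  refine ⟨fun O hO ⟨x, hxO⟩ h0 => ?_⟩
  have he := IsManifold.chart_mem_maximalAtlas (I := 𝓡 n) (n := ∞) x
  set e := chartAt (Coord n) x
  have hx : x ∈ e.source := mem_chart_source (Coord n) x
  have h1 : riemVolume g (O ∩ e.source) = 0 := measure_mono_null inter_subset_left h0
  have hm := (hO.inter e.open_source).measurableSet
  rw [riemVolume_eq_chartVolume_of_subset g he hm inter_subset_right, chartVolume_apply g e hm] at h1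
  have hT : IsOpen (e.symm ⁻¹' (O ∩ e.source) ∩ e.target) := by
    rw [inter_comm]
    exact e.symm.isOpen_inter_preimage (hO.inter e.open_source)
  have hne : (e.symm ⁻¹' (O ∩ e.source) ∩ e.target).Nonempty :=
    ⟨e x, by simp [e.left_inv hx, hxO, hx], e.map_source hx⟩
  have hpos := hT.measure_pos volume hne
  rw [setLIntegral_eq_zero_iff' hT.measurableSet] at h1
  · refine hpos.ne' (measure_mono_null (fun y hy => ?_) h1)
    have := volDensity_pos g he hy.2
    simpa [hy.2, hy.1.1, hy.1.2] using this
  · exact ENNReal.measurable_ofReal.comp_aemeasurable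
      (((contDiffOn_volDensity g he).continuousOn.mono inter_subset_right).aemeasurable
        hT.measurableSet)
end

/-! ### Coordinate gradients -/

section
variable {n : ℕ} {N : Type*} [TopologicalSpace N] [ChartedSpace (Coord n) N]

theorem ContDiffOn.pderiv {f : Coord n → ℝ} {s : Set (Coord n)} (hf : ContDiffOn ℝ ∞ f s)
    (hs : IsOpen s) (i : Fin n) : ContDiffOn ℝ ∞ (pderiv i f) s :=
  (hf.fderiv_of_isOpen hs (m := ∞) (by simp)).clm_apply contDiffOn_const

/-- The derivative of `u` in the direction of the `i`-th coordinate of the chart `e`. -/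
noncomputable def chartGrad (e : OpenPartialHomeomorph N (Coord n)) (u : N → ℝ) (i : Fin n)
    (y : Coord n) : ℝ :=
  pderiv i (fun z => u (e.symm z)) y

variable {e e' : OpenPartialHomeomorph N (Coord n)} {u v w : N → ℝ}

theorem contDiffOn_comp_symm (he : e ∈ IsManifold.maximalAtlas (𝓡 n) ∞ N)
    (hu : ContMDiff (𝓡 n) 𝓘(ℝ, ℝ) ∞ u) : ContDiffOn ℝ ∞ (fun z => u (e.symm z)) e.target := by
  rw [← contMDiffOn_iff_contDiffOn]
  exact hu.comp_contMDiffOn (contMDiffOn_symm_of_mem_maximalAtlas he)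

theorem contDiffOn_chartGrad (he : e ∈ IsManifold.maximalAtlas (𝓡 n) ∞ N)
    (hu : ContMDiff (𝓡 n) 𝓘(ℝ, ℝ) ∞ u) (i : Fin n) :
    ContDiffOn ℝ ∞ (chartGrad e u i) e.target :=
  (contDiffOn_comp_symm he hu).pderiv e.open_target i

theorem differentiableAt_comp_symm (he : e ∈ IsManifold.maximalAtlas (𝓡 n) ∞ N)
    (hu : ContMDiff (𝓡 n) 𝓘(ℝ, ℝ) ∞ u) {y : Coord n} (hy : y ∈ e.target) :
    DifferentiableAt ℝ (fun z => u (e.symm z)) y :=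
  ((contDiffOn_comp_symm he hu).contDiffAt (e.open_target.mem_nhds hy)).differentiableAt (by simp)

theorem chartGrad_add (he : e ∈ IsManifold.maximalAtlas (𝓡 n) ∞ N)
    (hu : ContMDiff (𝓡 n) 𝓘(ℝ, ℝ) ∞ u) (hv : ContMDiff (𝓡 n) 𝓘(ℝ, ℝ) ∞ v) (i : Fin n)
    {y : Coord n} (hy : y ∈ e.target) :
    chartGrad e (u + v) i y = chartGrad e u i y + chartGrad e v i y := by
  have := fderiv_fun_add (differentiableAt_comp_symm he hu hy) (differentiableAt_comp_symm he hv hy)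
  simp only [chartGrad, pderiv, Pi.add_apply]
  rw [this]; rfl

theorem chartGrad_mul (he : e ∈ IsManifold.maximalAtlas (𝓡 n) ∞ N)
    (hu : ContMDiff (𝓡 n) 𝓘(ℝ, ℝ) ∞ u) (hv : ContMDiff (𝓡 n) 𝓘(ℝ, ℝ) ∞ v) (i : Fin n)
    {y : Coord n} (hy : y ∈ e.target) :
    chartGrad e (u * v) i y =
      u (e.symm y) * chartGrad e v i y + v (e.symm y) * chartGrad e u i y := by
  have := fderiv_fun_mul (differentiableAt_comp_symm he hu hy) (differentiableAt_comp_symm he hv hy)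
  simp only [chartGrad, pderiv, Pi.mul_apply]
  rw [this]; rfl

theorem chartGrad_comp (he : e ∈ IsManifold.maximalAtlas (𝓡 n) ∞ N)
    (hu : ContMDiff (𝓡 n) 𝓘(ℝ, ℝ) ∞ u) {F : ℝ → ℝ} (hF : Differentiable ℝ F) (i : Fin n)
    {y : Coord n} (hy : y ∈ e.target) :
    chartGrad e (F ∘ u) i y = deriv F (u (e.symm y)) * chartGrad e u i y := by
  have := ((hF _).hasDerivAt.comp_hasFDerivAt y
    (differentiableAt_comp_symm he hu hy).hasFDerivAt).fderiv
  simp only [chartGrad, pderiv]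
  change fderiv ℝ (F ∘ fun z => u (e.symm z)) y _ = _
  rw [this]; rfl

theorem chartGrad_congr {x : N} (hx : x ∈ e.source)
    (h : u =ᶠ[nhds x] v) (i : Fin n) : chartGrad e u i (e x) = chartGrad e v i (e x) := by
  have h' : (fun z => u (e.symm z)) =ᶠ[nhds (e x)] fun z => v (e.symm z) := by
    have := e.continuousAt_symm (e.map_source hx)
    rw [ContinuousAt, e.left_inv hx] at this
    exact this.eventually h
  simp only [chartGrad, pderiv]
  rw [h'.fderiv_eq]

theorem chartGrad_transition (he : e ∈ IsManifold.maximalAtlas (𝓡 n) ∞ N)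
    (he' : e' ∈ IsManifold.maximalAtlas (𝓡 n) ∞ N)
    (hu : ContMDiff (𝓡 n) 𝓘(ℝ, ℝ) ∞ u) (i : Fin n) {y : Coord n} (hy : y ∈ e.target)
    (hy' : e.symm y ∈ e'.source) :
    chartGrad e u i y =
      ∑ k, jacobian (e' ∘ e.symm) y k i * chartGrad e' u k (e' (e.symm y)) := by
  have h1 : (fun z => u (e.symm z)) =ᶠ[nhds y] (fun z => u (e'.symm z)) ∘ (e' ∘ e.symm) := by
    filter_upwards [eventually_mem_overlap hy hy'] with z hz
    simp [e'.left_inv hz.2]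
  simp only [chartGrad, pderiv]
  have h2 := fderiv_comp (g := fun z => u (e'.symm z)) (f := e' ∘ e.symm) y
    (differentiableAt_comp_symm he' hu (e'.map_source hy'))
    ((contDiffAt_transition he he' hy hy').differentiableAt (by simp))
  rw [h1.fderiv_eq, h2, ContinuousLinearMap.comp_apply]
  conv_lhs => rw [← sum_smul_stdVec (fderiv ℝ (e' ∘ e.symm) y (stdVec i))]
  simp [jacobian]

end

/-! ### The inner product of differentials -/

section
variable {n : ℕ} {N : Type*} [TopologicalSpace N] [ChartedSpace (Coord n) N]
  [IsManifold (𝓡 n) ∞ N]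

/-- The inner product of the differentials of `u` and `v` in the chart `e`. -/
noncomputable def chartGamma (g : RiemMetric n N) (e : OpenPartialHomeomorph N (Coord n))
    (u v : N → ℝ) (y : Coord n) : ℝ :=
  ∑ i, ∑ j, metricInv g e y i j * chartGrad e u i y * chartGrad e v j y

/-- The inner product `⟨du, dv⟩` of differentials. -/
noncomputable def gamma (g : RiemMetric n N) (u v : N → ℝ) (x : N) : ℝ :=
  chartGamma g (chartAt (Coord n) x) u v (chartAt (Coord n) x x)

/-- The `i`-th component of the vector density `√det g · grad u` in the chart `e`. -/
noncomputable def chartFlux (g : RiemMetric n N) (e : OpenPartialHomeomorph N (Coord n))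
    (u : N → ℝ) (i : Fin n) (y : Coord n) : ℝ :=
  volDensity g e y * ∑ j, metricInv g e y i j * chartGrad e u j y

/-- The Laplace–Beltrami operator on real functions in the chart `e`. -/
noncomputable def chartLaplacian (g : RiemMetric n N) (e : OpenPartialHomeomorph N (Coord n))
    (u : N → ℝ) (y : Coord n) : ℝ :=
  (volDensity g e y)⁻¹ * ∑ i, pderiv i (chartFlux g e u i) y

/-- The Laplace–Beltrami operator on real functions. -/
noncomputable def realLaplacian (g : RiemMetric n N) (u : N → ℝ) (x : N) : ℝ :=
  chartLaplacian g (chartAt (Coord n) x) u (chartAt (Coord n) x x)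

variable (g : RiemMetric n N) {e e' : OpenPartialHomeomorph N (Coord n)} {u v w : N → ℝ}

theorem contDiffOn_chartGamma (he : e ∈ IsManifold.maximalAtlas (𝓡 n) ∞ N)
    (hu : ContMDiff (𝓡 n) 𝓘(ℝ, ℝ) ∞ u) (hv : ContMDiff (𝓡 n) 𝓘(ℝ, ℝ) ∞ v) :
    ContDiffOn ℝ ∞ (chartGamma g e u v) e.target :=
  ContDiffOn.sum fun i _ => ContDiffOn.sum fun j _ => ((contDiffOn_metricInv g he i j).mul
    (contDiffOn_chartGrad he hu i)).mul (contDiffOn_chartGrad he hv j)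

theorem contDiffOn_chartFlux (he : e ∈ IsManifold.maximalAtlas (𝓡 n) ∞ N)
    (hu : ContMDiff (𝓡 n) 𝓘(ℝ, ℝ) ∞ u) (i : Fin n) :
    ContDiffOn ℝ ∞ (chartFlux g e u i) e.target :=
  (contDiffOn_volDensity g he).mul (ContDiffOn.sum fun j _ => (contDiffOn_metricInv g he i j).mul
    (contDiffOn_chartGrad he hu j))

theorem contDiffOn_chartLaplacian (he : e ∈ IsManifold.maximalAtlas (𝓡 n) ∞ N)
    (hu : ContMDiff (𝓡 n) 𝓘(ℝ, ℝ) ∞ u) :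
    ContDiffOn ℝ ∞ (chartLaplacian g e u) e.target :=
  ((contDiffOn_volDensity g he).inv fun _ hy => (volDensity_pos g he hy).ne').mul
    (ContDiffOn.sum fun i _ => (contDiffOn_chartFlux g he hu i).pderiv e.open_target i)

theorem chartGamma_eq_dotProduct (e : OpenPartialHomeomorph N (Coord n)) (u v : N → ℝ)
    (y : Coord n) : chartGamma g e u v y =
      (fun i => chartGrad e u i y) ⬝ᵥ (metricInv g e y).mulVec (fun j => chartGrad e v j y) := by
  simp only [chartGamma, dotProduct, Matrix.mulVec, Finset.mul_sum]
  refine Finset.sum_congr rfl fun i _ => Finset.sum_congr rfl fun j _ => ?_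
  ring

/-- Gradients transform by the transposed Jacobian Jᵀ and the inverse metric by H ↦ J H Jᵀ, so the
Jacobians regroup into the inverse metric of the other chart. -/
theorem chartGamma_transition (he : e ∈ IsManifold.maximalAtlas (𝓡 n) ∞ N)
    (he' : e' ∈ IsManifold.maximalAtlas (𝓡 n) ∞ N) (hu : ContMDiff (𝓡 n) 𝓘(ℝ, ℝ) ∞ u)
    (hv : ContMDiff (𝓡 n) 𝓘(ℝ, ℝ) ∞ v) {y : Coord n} (hy : y ∈ e.target)
    (hy' : e.symm y ∈ e'.source) :
    chartGamma g e u v y = chartGamma g e' u v (e' (e.symm y)) := by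
  have hgrad : ∀ {f : N → ℝ}, ContMDiff (𝓡 n) 𝓘(ℝ, ℝ) ∞ f → (fun i => chartGrad e f i y) =
      (jacobian (e' ∘ e.symm) y).transpose.mulVec fun k => chartGrad e' f k (e' (e.symm y)) := by
    intro f hf
    ext i
    rw [chartGrad_transition he he' hf i hy hy']
    rfl
  rw [chartGamma_eq_dotProduct, chartGamma_eq_dotProduct, hgrad hu, hgrad hv,
    metricInv_transition g he he' hy hy', Matrix.mulVec_transpose, ← Matrix.dotProduct_mulVec,
    Matrix.mulVec_mulVec, Matrix.mulVec_mulVec]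

theorem chartGamma_eq_gamma (he : e ∈ IsManifold.maximalAtlas (𝓡 n) ∞ N)
    (hu : ContMDiff (𝓡 n) 𝓘(ℝ, ℝ) ∞ u) (hv : ContMDiff (𝓡 n) 𝓘(ℝ, ℝ) ∞ v) {x : N}
    (hx : x ∈ e.source) : chartGamma g e u v (e x) = gamma g u v x := by
  rw [chartGamma_transition g he (IsManifold.chart_mem_maximalAtlas x) hu hv (e.map_source hx)
    (by rw [e.left_inv hx]; exact mem_chart_source _ x), e.left_inv hx]
  rfl

/-- A quantity computed at x in the chart at x changes charts from point to point. Smoothness is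
visible only after chart invariance has produced one formula on a whole chart domain. -/
theorem contMDiff_of_forall_chart {f : N → ℝ}
    (h : ∀ x : N, ∃ F : Coord n → ℝ, ContDiffOn ℝ ∞ F (chartAt (Coord n) x).target ∧
      ∀ z ∈ (chartAt (Coord n) x).source, f z = F (chartAt (Coord n) x z)) :
    ContMDiff (𝓡 n) 𝓘(ℝ, ℝ) ∞ f := by
  intro x
  obtain ⟨F, hF, hf⟩ := h x
  have hx := mem_chart_source (Coord n) x
  have h1 : ContMDiffAt (𝓡 n) 𝓘(ℝ, ℝ) ∞ (F ∘ chartAt (Coord n) x) x := by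
    refine ContMDiffAt.comp x (I' := 𝓡 n) ?_ ?_
    · rw [contMDiffAt_iff_contDiffAt]
      exact hF.contDiffAt ((chartAt (Coord n) x).open_target.mem_nhds
        ((chartAt (Coord n) x).map_source hx))
    · exact (contMDiffOn_of_mem_maximalAtlas (IsManifold.chart_mem_maximalAtlas x)).contMDiffAt
        ((chartAt (Coord n) x).open_source.mem_nhds hx)
  refine h1.congr_of_eventuallyEq ?_
  filter_upwards [(chartAt (Coord n) x).open_source.mem_nhds hx] with z hz using hf z hz

theorem contMDiff_gamma (hu : ContMDiff (𝓡 n) 𝓘(ℝ, ℝ) ∞ u) (hv : ContMDiff (𝓡 n) 𝓘(ℝ, ℝ) ∞ v) :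
    ContMDiff (𝓡 n) 𝓘(ℝ, ℝ) ∞ (gamma g u v) :=
  contMDiff_of_forall_chart fun x => ⟨chartGamma g (chartAt (Coord n) x) u v,
    contDiffOn_chartGamma g (IsManifold.chart_mem_maximalAtlas x) hu hv, fun _ hz =>
      (chartGamma_eq_gamma g (IsManifold.chart_mem_maximalAtlas x) hu hv hz).symm⟩

theorem gamma_comm (u v : N → ℝ) : gamma g u v = gamma g v u := by
  ext x
  simp only [gamma, chartGamma]
  rw [Finset.sum_comm]
  refine Finset.sum_congr rfl fun i _ => Finset.sum_congr rfl fun j _ => ?_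
  rw [metricInv_symm]
  ring

theorem mem_chartAt_target (x : N) :
    chartAt (Coord n) x x ∈ (chartAt (Coord n) x).target :=
  (chartAt (Coord n) x).map_source (mem_chart_source _ x)

theorem chartAt_symm_self (x : N) :
    (chartAt (Coord n) x).symm (chartAt (Coord n) x x) = x :=
  (chartAt (Coord n) x).left_inv (mem_chart_source _ x)

theorem gamma_add_right (hv : ContMDiff (𝓡 n) 𝓘(ℝ, ℝ) ∞ v) (hw : ContMDiff (𝓡 n) 𝓘(ℝ, ℝ) ∞ w) :
    gamma g u (v + w) = gamma g u v + gamma g u w := by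
  ext x
  simp only [gamma, chartGamma, Pi.add_apply, ← Finset.sum_add_distrib]
  refine Finset.sum_congr rfl fun i _ => Finset.sum_congr rfl fun j _ => ?_
  rw [chartGrad_add (IsManifold.chart_mem_maximalAtlas x) hv hw j (mem_chartAt_target x)]
  ring

theorem gamma_mul_right (hv : ContMDiff (𝓡 n) 𝓘(ℝ, ℝ) ∞ v) (hw : ContMDiff (𝓡 n) 𝓘(ℝ, ℝ) ∞ w) :
    gamma g u (v * w) = v * gamma g u w + w * gamma g u v := by
  ext x
  simp only [gamma, chartGamma, Pi.add_apply, Pi.mul_apply, Finset.mul_sum,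
    ← Finset.sum_add_distrib]
  refine Finset.sum_congr rfl fun i _ => Finset.sum_congr rfl fun j _ => ?_
  rw [chartGrad_mul (IsManifold.chart_mem_maximalAtlas x) hv hw j (mem_chartAt_target x),
    chartAt_symm_self]
  ring

theorem gamma_comp_right (hv : ContMDiff (𝓡 n) 𝓘(ℝ, ℝ) ∞ v) {F : ℝ → ℝ}
    (hF : Differentiable ℝ F) (x : N) :
    gamma g u (F ∘ v) x = deriv F (v x) * gamma g u v x := by
  simp only [gamma, chartGamma, Finset.mul_sum]
  refine Finset.sum_congr rfl fun i _ => Finset.sum_congr rfl fun j _ => ?_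
  rw [chartGrad_comp (IsManifold.chart_mem_maximalAtlas x) hv hF j (mem_chartAt_target x),
    chartAt_symm_self]
  ring

theorem gamma_congr_right {x : N} (h : v =ᶠ[nhds x] w) : gamma g u v x = gamma g u w x := by
  simp only [gamma, chartGamma]
  refine Finset.sum_congr rfl fun i _ => Finset.sum_congr rfl fun j _ => ?_
  rw [chartGrad_congr (mem_chart_source _ x) h j]

theorem gamma_zero_right : gamma g u 0 = 0 := by
  ext x
  simp [gamma, chartGamma, chartGrad, pderiv]

theorem gamma_eq_zero_of_notMem_tsupport {x : N} (h : x ∉ tsupport v) : gamma g u v x = 0 := by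
  rw [gamma_congr_right g (notMem_tsupport_iff_eventuallyEq.1 h), gamma_zero_right]
  rfl

theorem gamma_self_nonneg (u : N → ℝ) (x : N) : 0 ≤ gamma g u u x := by
  rw [gamma, chartGamma_eq_dotProduct]
  have := (posDef_metricMatrix g (IsManifold.chart_mem_maximalAtlas x)
    (mem_chartAt_target x)).inv.posSemidef.dotProduct_mulVec_nonneg
    (fun i => chartGrad (chartAt (Coord n) x) u i (chartAt (Coord n) x x))
  simpa [metricInv] using! this

theorem gamma_self_pos {u : N → ℝ} {x : N}
    (h : ∃ i, chartGrad (chartAt (Coord n) x) u i (chartAt (Coord n) x x) ≠ 0) :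
    0 < gamma g u u x := by
  rw [gamma, chartGamma_eq_dotProduct]
  have := (posDef_metricMatrix g (IsManifold.chart_mem_maximalAtlas x)
    (mem_chartAt_target x)).inv.dotProduct_mulVec_pos (x :=
    (fun i => chartGrad (chartAt (Coord n) x) u i (chartAt (Coord n) x x)))
    (fun h0 => by obtain ⟨i, hi⟩ := h; exact hi (congrFun h0 i))
  simpa [metricInv] using! this

end

/-! ### Integration by parts in coordinate space -/

section
variable {n : ℕ}

/-- Near a point outside s the factor f vanishes identically, so the values of F there do not
matter. -/
theorem continuous_mul_of_tsupport_subset {X : Type*} [TopologicalSpace X] {f F : X → ℝ} {s : Set X}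
    (hs : IsOpen s) (hf : Continuous f) (hF : ContinuousOn F s) (h : tsupport f ⊆ s) :
    Continuous fun x => f x * F x := by
  refine continuous_iff_continuousAt.2 fun x => ?_
  by_cases hx : x ∈ s
  · exact hf.continuousAt.mul (hF.continuousAt (hs.mem_nhds hx))
  · have h0 := notMem_tsupport_iff_eventuallyEq.1 fun h' => hx (h h')
    refine (continuousAt_const (y := (0 : ℝ))).congr ?_
    filter_upwards [h0] with z hz
    simp [hz]

theorem integral_mul_pderiv_eq_neg {f F : Coord n → ℝ} {s : Set (Coord n)} (hs : IsOpen s)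
    (hf : ContDiff ℝ ∞ f) (hfc : HasCompactSupport f) (hfs : tsupport f ⊆ s)
    (hF : ContDiffOn ℝ ∞ F s) (i : Fin n) :
    ∫ y, f y * pderiv i F y = -∫ y, pderiv i f y * F y := by
  have hdf : Continuous (pderiv i f) := (hf.continuous_fderiv (by simp)).clm_apply continuous_const
  have hts : tsupport (pderiv i f) ⊆ tsupport f :=
    tsupport_fderiv_apply_subset ℝ (stdVec i)
  refine integral_mul_fderiv_eq_neg_fderiv_mul_of_integrable ?_ ?_ ?_ ?_ ?_
  · exact (continuous_mul_of_tsupport_subset hs hdf hF.continuousOn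
      (hts.trans hfs)).integrable_of_hasCompactSupport
      (HasCompactSupport.mul_right (hfc.of_isClosed_subset (isClosed_tsupport _) hts))
  · exact (continuous_mul_of_tsupport_subset hs hf.continuous (hF.pderiv hs i).continuousOn
      hfs).integrable_of_hasCompactSupport hfc.mul_right
  · exact (continuous_mul_of_tsupport_subset hs hf.continuous hF.continuousOn
      hfs).integrable_of_hasCompactSupport hfc.mul_right
  · exact fun y _ => (hf.differentiable (by simp)) y
  · exact fun y hy => (hF.contDiffAt (hs.mem_nhds (hfs hy))).differentiableAt (by simp)
end

/-! ### Green's formula and chart independence of the Laplacian -/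

section
variable {n : ℕ} {N : Type*} [TopologicalSpace N] [ChartedSpace (Coord n) N]
  [IsManifold (𝓡 n) ∞ N] [T2Space N] [CompactSpace N]
  {e e' : OpenPartialHomeomorph N (Coord n)} {u v w : N → ℝ}

/-- The function `v` in the chart `e`, extended by zero. -/
noncomputable def chartExtend (e : OpenPartialHomeomorph N (Coord n)) (v : N → ℝ) : Coord n → ℝ :=
  e.target.indicator fun y => v (e.symm y)

theorem tsupport_chartExtend_subset (h : tsupport v ⊆ e.source) :
    tsupport (chartExtend e v) ⊆ e '' tsupport v := by
  have hc : IsCompact (e '' tsupport v) :=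
    (isClosed_tsupport v).isCompact.image_of_continuousOn (e.continuousOn.mono h)
  refine closure_minimal (fun y hy => ?_) hc.isClosed
  have hyt : y ∈ e.target := by
    by_contra h0
    exact hy (indicator_of_notMem h0 _)
  refine ⟨e.symm y, subset_tsupport _ ?_, e.right_inv hyt⟩
  simpa [chartExtend, hyt] using hy

theorem tsupport_chartExtend_subset_target (h : tsupport v ⊆ e.source) :
    tsupport (chartExtend e v) ⊆ e.target := by
  refine (tsupport_chartExtend_subset h).trans ?_
  rintro _ ⟨x, hx, rfl⟩
  exact e.map_source (h hx)

theorem hasCompactSupport_chartExtend (h : tsupport v ⊆ e.source) :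
    HasCompactSupport (chartExtend e v) :=
  ((isClosed_tsupport v).isCompact.image_of_continuousOn (e.continuousOn.mono h)).of_isClosed_subset
    (isClosed_tsupport _) (tsupport_chartExtend_subset h)

theorem chartExtend_eventuallyEq {y : Coord n} (hy : y ∈ e.target) :
    chartExtend e v =ᶠ[nhds y] fun z => v (e.symm z) := by
  filter_upwards [e.open_target.mem_nhds hy] with z hz
  simp [chartExtend, hz]

theorem contDiff_chartExtend (he : e ∈ IsManifold.maximalAtlas (𝓡 n) ∞ N)
    (hv : ContMDiff (𝓡 n) 𝓘(ℝ, ℝ) ∞ v) (h : tsupport v ⊆ e.source) :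
    ContDiff ℝ ∞ (chartExtend e v) := by
  refine contDiff_iff_contDiffAt.2 fun y => ?_
  by_cases hy : y ∈ e.target
  · exact ((contDiffOn_comp_symm he hv).contDiffAt (e.open_target.mem_nhds hy)).congr_of_eventuallyEq
      (chartExtend_eventuallyEq hy)
  · have h0 := notMem_tsupport_iff_eventuallyEq.1
      fun h' => hy (tsupport_chartExtend_subset_target h h')
    exact contDiffAt_const.congr_of_eventuallyEq h0

/-- The volume density cancels the prefactor of the Laplacian and leaves the coordinate divergence
of the flux, which is integrated by parts against the extension of v by zero. -/
theorem integral_target_mul_chartLaplacian (g : RiemMetric n N)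
    (he : e ∈ IsManifold.maximalAtlas (𝓡 n) ∞ N) (hu : ContMDiff (𝓡 n) 𝓘(ℝ, ℝ) ∞ u)
    (hv : ContMDiff (𝓡 n) 𝓘(ℝ, ℝ) ∞ v) (h : tsupport v ⊆ e.source) :
    ∫ y in e.target, volDensity g e y * (v (e.symm y) * chartLaplacian g e u y) =
      -∫ y in e.target, volDensity g e y * chartGamma g e u v y := by
  have hf := contDiff_chartExtend he hv h
  have hfc := hasCompactSupport_chartExtend h
  have hfs := tsupport_chartExtend_subset_target h
  have hdf : ∀ i, Continuous (pderiv i (chartExtend e v)) := fun i =>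
    (hf.continuous_fderiv (by simp)).clm_apply continuous_const
  have hts : ∀ i, tsupport (pderiv i (chartExtend e v)) ⊆ tsupport (chartExtend e v) := fun i =>
    tsupport_fderiv_apply_subset ℝ (stdVec i)
  have h1 : ∫ y in e.target, volDensity g e y * (v (e.symm y) * chartLaplacian g e u y) =
      ∫ y, ∑ i, chartExtend e v y * pderiv i (chartFlux g e u i) y := by
    rw [← integral_indicator e.open_target.measurableSet]
    congr 1
    ext y
    by_cases hy : y ∈ e.target
    · have := (volDensity_pos g he hy).ne'
      simp only [hy, indicator_of_mem, chartLaplacian, chartExtend, ← Finset.mul_sum]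
      field_simp
    · simp [hy, chartExtend]
  have h2 : ∫ y in e.target, volDensity g e y * chartGamma g e u v y =
      ∫ y, ∑ i, pderiv i (chartExtend e v) y * chartFlux g e u i y := by
    rw [← integral_indicator e.open_target.measurableSet]
    congr 1
    ext y
    by_cases hy : y ∈ e.target
    · have hp : ∀ i, pderiv i (chartExtend e v) y = chartGrad e v i y := fun i => by
        simp only [pderiv, chartGrad]
        rw [(chartExtend_eventuallyEq hy).fderiv_eq]
      simp only [hy, indicator_of_mem, hp, chartFlux, chartGamma, Finset.mul_sum]
      rw [Finset.sum_comm]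
      refine Finset.sum_congr rfl fun i _ => Finset.sum_congr rfl fun j _ => ?_
      rw [metricInv_symm]
      ring
    · have hp : ∀ i, pderiv i (chartExtend e v) y = 0 := fun i =>
        image_eq_zero_of_notMem_tsupport fun h' => hy (hfs (hts i h'))
      simp [hy, hp]
  rw [h1, h2, integral_finsetSum, integral_finsetSum, ← Finset.sum_neg_distrib]
  · exact Finset.sum_congr rfl fun i _ => integral_mul_pderiv_eq_neg e.open_target hf hfc hfs
      (contDiffOn_chartFlux g he hu i) i
  · exact fun i _ => (continuous_mul_of_tsupport_subset e.open_target (hdf i)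
      (contDiffOn_chartFlux g he hu i).continuousOn
      ((hts i).trans hfs)).integrable_of_hasCompactSupport
      (HasCompactSupport.mul_right (hfc.of_isClosed_subset (isClosed_tsupport _) (hts i)))
  · exact fun i _ => (continuous_mul_of_tsupport_subset e.open_target hf.continuous
      ((contDiffOn_chartFlux g he hu i).pderiv e.open_target i).continuousOn
      hfs).integrable_of_hasCompactSupport hfc.mul_right

variable [MeasurableSpace N] [BorelSpace N] (g : RiemMetric n N)

theorem continuousOn_chartLaplacian_comp (he : e ∈ IsManifold.maximalAtlas (𝓡 n) ∞ N)
    (hu : ContMDiff (𝓡 n) 𝓘(ℝ, ℝ) ∞ u) :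
    ContinuousOn (fun x => chartLaplacian g e u (e x)) e.source :=
  (contDiffOn_chartLaplacian g he hu).continuousOn.comp e.continuousOn fun _ hx => e.map_source hx

theorem integral_mul_chartLaplacian (he : e ∈ IsManifold.maximalAtlas (𝓡 n) ∞ N)
    (hu : ContMDiff (𝓡 n) 𝓘(ℝ, ℝ) ∞ u) (hv : ContMDiff (𝓡 n) 𝓘(ℝ, ℝ) ∞ v)
    (h : tsupport v ⊆ e.source) :
    ∫ x, v x * chartLaplacian g e u (e x) ∂(riemVolume g) = -∫ x, gamma g u v x ∂(riemVolume g) := by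
  have h0 : ∀ x, x ∉ e.source → v x = 0 := fun x hx =>
    image_eq_zero_of_notMem_tsupport fun h' => hx (h h')
  rw [← setIntegral_eq_integral_of_forall_compl_eq_zero (s := e.source)
      (f := fun x => v x * chartLaplacian g e u (e x)) (fun x hx => by rw [h0 x hx, zero_mul]),
    ← setIntegral_eq_integral_of_forall_compl_eq_zero (s := e.source) (f := gamma g u v)
      (fun x hx => gamma_eq_zero_of_notMem_tsupport g fun h' => hx (h h')),
    setIntegral_source g he (f := fun x => v x * chartLaplacian g e u (e x))
      (hv.continuous.continuousOn.mul (continuousOn_chartLaplacian_comp g he hu)),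
    setIntegral_source g he (contMDiff_gamma g hu hv).continuous.continuousOn]
  rw [setIntegral_congr_fun e.open_target.measurableSet (g := fun y =>
      volDensity g e y * (v (e.symm y) * chartLaplacian g e u y))
      (fun y hy => by simp only [e.right_inv hy]),
    integral_target_mul_chartLaplacian g he hu hv h]
  congr 1
  refine setIntegral_congr_fun e.open_target.measurableSet fun y hy => ?_
  simp only [← chartGamma_eq_gamma g he hu hv (e.map_target hy), e.right_inv hy]

/-- Paired with a function supported in the overlap, both expressions give -∫⟨du, dv⟩, which
involves no chart. This avoids transforming second derivatives. -/
theorem chartLaplacian_eq_of_mem (he : e ∈ IsManifold.maximalAtlas (𝓡 n) ∞ N)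
    (he' : e' ∈ IsManifold.maximalAtlas (𝓡 n) ∞ N) (hu : ContMDiff (𝓡 n) 𝓘(ℝ, ℝ) ∞ u) {x : N}
    (hx : x ∈ e.source) (hx' : x ∈ e'.source) :
    chartLaplacian g e u (e x) = chartLaplacian g e' u (e' x) := by
  have hopen : IsOpen (e.source ∩ e'.source) := e.open_source.inter e'.open_source
  have hc := (continuousOn_chartLaplacian_comp g he hu).mono
    (inter_subset_left (s := e.source) (t := e'.source))
  have hc' := (continuousOn_chartLaplacian_comp g he' hu).mono
    (inter_subset_right (s := e.source) (t := e'.source))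
  have hae := hopen.ae_eq_zero_of_integral_contMDiff_smul_eq_zero (𝓡 n) (μ := riemVolume g)
    ((hc.sub hc').locallyIntegrableOn hopen.measurableSet) fun v hv _ hvs => by
      have hi : ∀ {F : N → ℝ}, ContinuousOn F (e.source ∩ e'.source) →
          Integrable (fun x => v x * F x) (riemVolume g) := fun hF =>
        (continuous_mul_of_tsupport_subset hopen hv.continuous hF
          hvs).integrable_of_hasCompactSupport (HasCompactSupport.of_compactSpace _)
      simp only [smul_eq_mul, mul_sub, Pi.sub_apply]
      rw [integral_sub (hi hc) (hi hc'),
        integral_mul_chartLaplacian g he hu hv (hvs.trans inter_subset_left),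
        integral_mul_chartLaplacian g he' hu hv (hvs.trans inter_subset_right), sub_self]
  refine Measure.eqOn_open_of_ae_eq (μ := riemVolume g) ?_ hopen hc hc' ⟨hx, hx'⟩
  rw [Filter.EventuallyEq, ae_restrict_iff' hopen.measurableSet]
  filter_upwards [hae] with z hz hz'
  exact sub_eq_zero.1 (hz hz')

theorem chartLaplacian_eq_realLaplacian (he : e ∈ IsManifold.maximalAtlas (𝓡 n) ∞ N)
    (hu : ContMDiff (𝓡 n) 𝓘(ℝ, ℝ) ∞ u) {x : N} (hx : x ∈ e.source) :
    chartLaplacian g e u (e x) = realLaplacian g u x :=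
  chartLaplacian_eq_of_mem g he (IsManifold.chart_mem_maximalAtlas x) hu hx (mem_chart_source _ x)

theorem contMDiff_realLaplacian (hu : ContMDiff (𝓡 n) 𝓘(ℝ, ℝ) ∞ u) :
    ContMDiff (𝓡 n) 𝓘(ℝ, ℝ) ∞ (realLaplacian g u) :=
  contMDiff_of_forall_chart fun x => ⟨chartLaplacian g (chartAt (Coord n) x) u,
    contDiffOn_chartLaplacian g (IsManifold.chart_mem_maximalAtlas x) hu, fun _ hz =>
      (chartLaplacian_eq_realLaplacian g (IsManifold.chart_mem_maximalAtlas x) hu hz).symm⟩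

theorem Continuous.integrable_riemVolume {E : Type*} [NormedAddCommGroup E] {f : N → E}
    (hf : Continuous f) : Integrable f (riemVolume g) :=
  hf.integrable_of_hasCompactSupport (HasCompactSupport.of_compactSpace _)

/-- A partition of unity splits v into pieces supported in single charts. -/
theorem integral_mul_realLaplacian (hu : ContMDiff (𝓡 n) 𝓘(ℝ, ℝ) ∞ u)
    (hv : ContMDiff (𝓡 n) 𝓘(ℝ, ℝ) ∞ v) :
    ∫ x, v x * realLaplacian g u x ∂(riemVolume g) = -∫ x, gamma g u v x ∂(riemVolume g) := by
  set S := (finite_support_chartPartition (n := n) (N := N)).toFinset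
  set ρ : N → N → ℝ := fun p => chartPartition n N p
  have hρ : ∀ p, ContMDiff (𝓡 n) 𝓘(ℝ, ℝ) ∞ (ρ p) := fun p => (chartPartition n N p).contMDiff
  have hsum : ∀ x, ∑ p ∈ S, ρ p x = 1 := sum_chartPartition
  have hρv : ∀ p, ContMDiff (𝓡 n) 𝓘(ℝ, ℝ) ∞ (ρ p * v) := fun p => (hρ p).mul hv
  have key : ∀ p, ∫ x, (ρ p * v) x * realLaplacian g u x ∂(riemVolume g) =
      -∫ x, gamma g u (ρ p * v) x ∂(riemVolume g) := by
    intro p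
    have hs : tsupport (ρ p * v) ⊆ (chartAt (Coord n) p).source :=
      (tsupport_mul_subset_left).trans (chartPartition_isSubordinate p)
    rw [← integral_mul_chartLaplacian g (IsManifold.chart_mem_maximalAtlas p) hu (hρv p) hs]
    congr 1
    ext x
    by_cases hx : x ∈ (chartAt (Coord n) p).source
    · rw [chartLaplacian_eq_realLaplacian g (IsManifold.chart_mem_maximalAtlas p) hu hx]
    · rw [image_eq_zero_of_notMem_tsupport fun h' => hx (hs h'), zero_mul, zero_mul]
  have hv_eq : v = ∑ p ∈ S, ρ p * v := by
    ext x
    simp [← Finset.sum_mul, hsum]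
  -- Smoothness is carried through the induction because additivity of `gamma` needs differentiable
  -- summands.
  have hgs : ∀ T : Finset N, gamma g u (∑ p ∈ T, ρ p * v) = ∑ p ∈ T, gamma g u (ρ p * v) ∧
      ContMDiff (𝓡 n) 𝓘(ℝ, ℝ) ∞ (∑ p ∈ T, ρ p * v) := by
    classical
    intro T
    induction T using Finset.induction_on with
    | empty => exact ⟨by simp [gamma_zero_right], by simpa using! contMDiff_const⟩
    | insert p T hp ih =>
      rw [Finset.sum_insert hp, Finset.sum_insert hp, gamma_add_right g (hρv p) ih.2, ih.1]
      exact ⟨rfl, (hρv p).add ih.2⟩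
  have hL := contMDiff_realLaplacian g hu
  conv_lhs => rw [hv_eq]
  conv_rhs => rw [hv_eq, (hgs S).1]
  simp only [Finset.sum_apply, Finset.sum_mul]
  rw [integral_finsetSum, integral_finsetSum, ← Finset.sum_neg_distrib]
  · exact Finset.sum_congr rfl fun p _ => key p
  · exact fun p _ => (contMDiff_gamma g hu (hρv p)).continuous.integrable_riemVolume g
  · exact fun p _ => ((hρv p).continuous.mul hL.continuous).integrable_riemVolume g

end

/-! ### Calculus in the algebra of smooth functions -/

/-- The algebra of smooth real functions on `N`. -/
abbrev SmoothFn (n : ℕ) (N : Type*) [TopologicalSpace N] [ChartedSpace (Coord n) N] : Type _ :=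
  C^∞⟮𝓡 n, N; 𝓘(ℝ, ℝ), ℝ⟯

section
variable {n : ℕ} {N : Type*} [TopologicalSpace N] [ChartedSpace (Coord n) N]
  [IsManifold (𝓡 n) ∞ N]

namespace SmoothFn

/-- The inner product `⟨du, dv⟩` as a smooth function. -/
noncomputable def gam (g : RiemMetric n N) (u v : SmoothFn n N) : SmoothFn n N :=
  ⟨gamma g u v, contMDiff_gamma g u.contMDiff v.contMDiff⟩

/-- The exponential of a smooth function. -/
noncomputable def exp (u : SmoothFn n N) : SmoothFn n N :=
  ⟨fun x => Real.exp (u x), Real.contDiff_exp.contMDiff.comp u.contMDiff⟩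

@[simp] theorem exp_apply (u : SmoothFn n N) (x : N) : exp u x = Real.exp (u x) := rfl

variable (g : RiemMetric n N) (u v w : SmoothFn n N)

theorem gam_apply (x : N) : gam g u v x = gamma g u v x := rfl

theorem gam_comm : gam g u v = gam g v u := by
  ext x
  rw [gam_apply, gamma_comm]; rfl

theorem gam_add_right : gam g u (v + w) = gam g u v + gam g u w := by
  ext x
  exact congrFun (gamma_add_right g v.contMDiff w.contMDiff) x

theorem gam_mul_right : gam g u (v * w) = v * gam g u w + w * gam g u v := by
  ext x
  exact congrFun (gamma_mul_right g v.contMDiff w.contMDiff) x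

theorem gam_exp_right : gam g u (exp v) = exp v * gam g u v := by
  ext x
  have := gamma_comp_right g (u := u) v.contMDiff Real.differentiable_exp x
  rw [Real.deriv_exp] at this
  exact this

/-- The Leibniz rule for 1 · 1. -/
theorem gam_one_right : gam g u 1 = 0 := by
  have := gam_mul_right g u 1 1
  simp only [one_mul] at this
  exact left_eq_add.1 this

theorem gam_smul_right (c : ℝ) : gam g u (c • v) = c • gam g u v := by
  ext x
  have := gamma_comp_right g (u := u) v.contMDiff (F := fun t => c * t) (by fun_prop) x
  rw [deriv_const_mul_id] at this
  exact this

theorem gam_zero_right : gam g u 0 = 0 := by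
  simpa using gam_smul_right g u 0 0

theorem gam_add_left : gam g (u + v) w = gam g u w + gam g v w := by
  rw [gam_comm, gam_add_right, gam_comm g w, gam_comm g w]

theorem gam_smul_left (c : ℝ) : gam g (c • u) v = c • gam g u v := by
  rw [gam_comm, gam_smul_right, gam_comm]

theorem gam_mul_left : gam g (u * v) w = u * gam g v w + v * gam g u w := by
  rw [gam_comm, gam_mul_right, gam_comm g w, gam_comm g w]

theorem gam_self_nonneg (x : N) : 0 ≤ gam g u u x := gamma_self_nonneg g u x

/-- Cauchy–Schwarz, from the discriminant of the nonnegative quadratic t ↦ |du + t dv|². -/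
theorem gam_sq_le (x : N) : gam g u v x ^ 2 ≤ gam g u u x * gam g v v x := by
  have key : ∀ t : ℝ, 0 ≤ gam g v v x * (t * t) + (2 * gam g u v x) * t + gam g u u x := by
    intro t
    have := gam_self_nonneg g (u + t • v) x
    rw [gam_add_left, gam_add_right, gam_add_right, gam_smul_left, gam_smul_right, gam_smul_left,
      gam_smul_right, gam_comm g v u] at this
    simp at this
    linarith
  have := discrim_le_zero key
  rw [discrim] at this
  linarith

theorem gam_congr_right {x : N} (h : v =ᶠ[nhds x] w) : gam g u v x = gam g u w x :=
  gamma_congr_right g h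

theorem exp_add : exp (u + v) = exp u * exp v := by
  ext x
  simp [Real.exp_add]

theorem exp_neg_mul_exp : exp (-u) * exp u = 1 := by
  rw [← exp_add, neg_add_cancel]
  ext x
  simp

variable [CompactSpace N] in
theorem exists_bound (X : SmoothFn n N) : ∃ K, ∀ x, |X x| ≤ K := by
  obtain ⟨K, hK⟩ := isCompact_univ.exists_bound_of_continuousOn X.contMDiff.continuous.continuousOn
  exact ⟨K, fun x => hK x (mem_univ x)⟩

variable [CompactSpace N] in
theorem exists_common_bound (l : List (SmoothFn n N)) :
    ∃ K : ℝ, 1 ≤ K ∧ ∀ X ∈ l, ∀ x, |X x| ≤ K := by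
  induction l with
  | nil => exact ⟨1, le_rfl, by simp⟩
  | cons X l ih =>
    obtain ⟨K, hK1, hK⟩ := ih
    obtain ⟨K', hK'⟩ := exists_bound X
    refine ⟨max K K', hK1.trans (le_max_left _ _), ?_⟩
    intro Y hY x
    rcases List.mem_cons.1 hY with rfl | hY
    · exact (hK' x).trans (le_max_right _ _)
    · exact (hK Y hY x).trans (le_max_left _ _)

variable [T2Space N] [CompactSpace N] [MeasurableSpace N] [BorelSpace N]

/-- The integral of smooth functions. -/
noncomputable def integ : SmoothFn n N →ₗ[ℝ] ℝ where
  toFun u := ∫ x, u x ∂(riemVolume g)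
  map_add' u v := integral_add (u.contMDiff.continuous.integrable_riemVolume g)
    (v.contMDiff.continuous.integrable_riemVolume g)
  map_smul' c _ := integral_const_mul c _

theorem integ_apply : integ g u = ∫ x, u x ∂(riemVolume g) := rfl

variable {u v} in
theorem integ_mono (h : ∀ x, u x ≤ v x) : integ g u ≤ integ g v :=
  integral_mono (u.contMDiff.continuous.integrable_riemVolume g)
    (v.contMDiff.continuous.integrable_riemVolume g) h

theorem integ_sq_nonneg : 0 ≤ integ g (u * u) :=
  integral_nonneg fun x => mul_self_nonneg (u x)

-- Test with w = u - v. All later identities for the Laplacian are proved in this weak form, from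
-- Green's formula and the Leibniz rule for `gam`.
variable {u v} in
theorem eq_of_forall_integ (h : ∀ w, integ g (w * u) = integ g (w * v)) : u = v := by
  have h0 : integ g ((u - v) * (u - v)) = 0 := by
    rw [mul_sub, map_sub, h, sub_self]
  rw [integ_apply, integral_eq_zero_iff_of_nonneg
    (show 0 ≤ ⇑((u - v) * (u - v)) from fun x => mul_self_nonneg ((u - v) x))
    (((u - v) * (u - v)).contMDiff.continuous.integrable_riemVolume g)] at h0
  have h1 := (Continuous.ae_eq_iff_eq (riemVolume g)
    ((u - v) * (u - v)).contMDiff.continuous continuous_const).1 h0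
  ext x
  have h2 : (u x - v x) * (u x - v x) = 0 := congrFun h1 x
  exact sub_eq_zero.1 (mul_self_eq_zero.1 h2)

/-- The Laplace–Beltrami operator as a map of smooth functions. -/
noncomputable def lapFun : SmoothFn n N :=
  ⟨realLaplacian g u, contMDiff_realLaplacian g u.contMDiff⟩

theorem integ_mul_lapFun : integ g (w * lapFun g u) = -integ g (gam g u w) :=
  integral_mul_realLaplacian g u.contMDiff w.contMDiff

/-- The Laplace–Beltrami operator on smooth functions. -/
noncomputable def lap : SmoothFn n N →ₗ[ℝ] SmoothFn n N where
  toFun u := lapFun g u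
  map_add' u v := eq_of_forall_integ g fun w => by
    rw [mul_add, map_add, integ_mul_lapFun, integ_mul_lapFun, integ_mul_lapFun,
      gam_add_left, map_add]
    ring
  map_smul' c u := eq_of_forall_integ g fun w => by
    rw [RingHom.id_apply, mul_smul_comm, map_smul, integ_mul_lapFun, integ_mul_lapFun,
      gam_smul_left, map_smul, smul_neg]

theorem integ_mul_lap : integ g (w * lap g u) = -integ g (gam g u w) :=
  integ_mul_lapFun g u w

theorem integ_mul_lap_comm : integ g (v * lap g u) = integ g (u * lap g v) := by
  rw [integ_mul_lap, integ_mul_lap, gam_comm]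

theorem lap_mul : lap g (u * v) = u * lap g v + v * lap g u + (2 : ℝ) • gam g u v := by
  refine eq_of_forall_integ g fun w => ?_
  have h : w * (u * lap g v + v * lap g u + (2 : ℝ) • gam g u v) =
      (w * u) * lap g v + (w * v) * lap g u + (2 : ℝ) • (w * gam g u v) := by
    rw [mul_add, mul_add, mul_smul_comm]; ring
  rw [h]
  simp only [map_add, map_smul, integ_mul_lap, gam_mul_right, gam_mul_left, smul_eq_mul]
  rw [gam_comm g v u, gam_comm g v w, gam_comm g u w]
  ring

theorem lap_exp : lap g (exp u) = exp u * (lap g u + gam g u u) := by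
  refine eq_of_forall_integ g fun w => ?_
  have h : w * (exp u * (lap g u + gam g u u)) =
      (w * exp u) * lap g u + w * (exp u * gam g u u) := by ring
  rw [h, map_add, integ_mul_lap, integ_mul_lap, gam_mul_right, gam_exp_right, gam_comm g (exp u),
    gam_exp_right, map_add, gam_comm g w u]
  ring

/-- The operator `e^{φ/h} (-h²Δ) e^{-φ/h}` on smooth real functions. -/
noncomputable def conj (φ : SmoothFn n N) (h : ℝ) (u : SmoothFn n N) : SmoothFn n N :=
  exp (h⁻¹ • φ) * ((-h ^ 2) • lap g (exp (-(h⁻¹ • φ)) * u))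

/-- The first bracket is the symmetric part of the operator, the second the antisymmetric part. -/
theorem conj_eq (φ : SmoothFn n N) {h : ℝ} (hh : h ≠ 0) (u : SmoothFn n N) :
    conj g φ h u = ((-h ^ 2) • lap g u - gam g φ φ * u) +
      ((2 * h) • gam g φ u + h • (lap g φ * u)) := by
  have h1 : exp (h⁻¹ • φ) * exp (-(h⁻¹ • φ)) = 1 := by
    rw [mul_comm, exp_neg_mul_exp]
  rw [conj, lap_mul, lap_exp, gam_comm g (exp _), gam_exp_right, ← neg_smul, gam_smul_left,
    gam_smul_right, gam_smul_right, map_smul, gam_comm g u φ]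
  rw [← neg_smul] at h1
  ext x
  have h2 : exp (h⁻¹ • φ) x * exp (-h⁻¹ • φ) x = 1 := DFunLike.congr_fun h1 x
  simp only [ContMDiffMap.coe_mul, ContMDiffMap.coe_add, ContMDiffMap.coe_smul,
    ContMDiffMap.coe_sub, Pi.mul_apply, Pi.add_apply, Pi.smul_apply, smul_eq_mul, Pi.sub_apply]
  generalize exp (h⁻¹ • φ) x = a at *
  generalize exp (-h⁻¹ • φ) x = b at *
  -- Here a and b stand for e^{φ/h} and e^{-φ/h}; their product is isolated so that it can be
  -- replaced by 1.
  have : a * (-h ^ 2 * (b * lap g u x + u x * (b * (-h⁻¹ * lap g φ x + -h⁻¹ * (-h⁻¹ * gam g φ φ x))) +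
    2 * (b * (-h⁻¹ * gam g φ u x)))) = (a * b) * (-h ^ 2 * (lap g u x + u x * ((-h⁻¹ * lap g φ x + -h⁻¹ * (-h⁻¹ * gam g φ φ x))) +
    2 * ((-h⁻¹ * gam g φ u x)))) := by ring
  rw [this, h2]
  field_simp
  ring

/-- The Laplacian is symmetric, so transposition only exchanges the two exponential factors. -/
theorem integ_mul_conj (φ : SmoothFn n N) (h : ℝ) :
    integ g (v * conj g φ h u) = integ g (u * conj g (-φ) h v) := by
  have h1 : v * conj g φ h u =
      (-h ^ 2) • ((exp (h⁻¹ • φ) * v) * lap g (exp (-(h⁻¹ • φ)) * u)) := by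
    rw [conj, mul_smul_comm, mul_smul_comm]; congr 1; ring
  have h2 : u * conj g (-φ) h v =
      (-h ^ 2) • ((exp (-(h⁻¹ • φ)) * u) * lap g (exp (h⁻¹ • φ) * v)) := by
    rw [conj, smul_neg, neg_neg, mul_smul_comm, mul_smul_comm]; congr 1; ring
  rw [h1, h2, map_smul, map_smul, integ_mul_lap_comm]

end SmoothFn
end

/-! ### The Carleman estimate for the convexified weight -/

/-- The integrand of `SmoothFn.integ_conj_sq` at one point, with G = |du|² and GV = |dV|².
Completing squares costs A²/4, all of B², twice h²Z², and h²Ku² with coefficient 1 + 1/2 + 1 + 1 =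
7/2; the bound Z² ≤ Kh²G then gives the gradient loss. -/
theorem carleman_pointwise {h δ K A B Z X Y G GV u s V κ μ q Lμ Lq : ℝ} (hh : 0 < h) (hh1 : h ≤ 1)
    (hδ : 0 ≤ δ) (hK : 1 ≤ K) (h5 : κ * V * u = u) (hZ : Z = h * (κ * Y)) (bs : 1 / 4 ≤ s ^ 2)
    (bμ : μ ^ 2 ≤ K) (bLμ : |Lμ| ≤ K) (bq : q ^ 2 ≤ K) (bLq : |Lq| ≤ K) (bκ : κ ^ 2 ≤ K)
    (bκV : κ ^ 2 * GV ≤ K) (hY : Y ^ 2 ≤ G * GV) (hG : 0 ≤ G) :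
    3 / 4 * (A * A) + (h * δ / K - 7 / 2 * h ^ 2 * K) * (u * u) - 2 * K * h ^ 2 * h ^ 2 * G ≤
      A * A + B * B + h * (μ * u * A) + h ^ 3 / 2 * (Lμ * (u * u)) + 2 * h * (B * Z)
        - 2 * h ^ 2 * (q * u * Z) + 4 * δ * h ^ 3 * (X * X) - h ^ 3 * (Lq * (u * u))
        + 4 * h * δ * (s * s * V * V * (u * u)) := by
  have hu2 : 0 ≤ u * u := mul_self_nonneg _
  have hh2 : 0 ≤ h ^ 2 := sq_nonneg h
  have hh3 : 0 ≤ h ^ 3 := by positivity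
  have hh32 : h ^ 3 ≤ h ^ 2 := pow_le_pow_of_le_one hh.le hh1 (by norm_num)
  have t1 : -(1 / 4 * (A * A) + h ^ 2 * K * (u * u)) ≤ h * (μ * u * A) := by
    have := mul_le_mul_of_nonneg_right bμ (mul_nonneg hh2 hu2)
    nlinarith [sq_nonneg (1 / 2 * A + h * μ * u)]
  have t2 : -(1 / 2 * h ^ 2 * K * (u * u)) ≤ h ^ 3 / 2 * (Lμ * (u * u)) := by
    have h1 : -K * (h ^ 3 * (u * u)) ≤ Lμ * (h ^ 3 * (u * u)) :=
      mul_le_mul_of_nonneg_right (neg_le_of_abs_le bLμ) (mul_nonneg hh3 hu2)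
    have h2 := mul_le_mul_of_nonneg_right hh32 (mul_nonneg (zero_le_one.trans hK) hu2)
    linarith
  have t6 : -(h ^ 2 * K * (u * u)) ≤ -(h ^ 3 * (Lq * (u * u))) := by
    have h1 : Lq * (h ^ 3 * (u * u)) ≤ K * (h ^ 3 * (u * u)) :=
      mul_le_mul_of_nonneg_right (le_of_abs_le bLq) (mul_nonneg hh3 hu2)
    have h2 := mul_le_mul_of_nonneg_right hh32 (mul_nonneg (zero_le_one.trans hK) hu2)
    linarith
  have hZ2 : Z ^ 2 ≤ K * h ^ 2 * G := by
    have h2 := mul_le_mul_of_nonneg_left hY (mul_nonneg hh2 (sq_nonneg (κ)))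
    have h3 := mul_le_mul_of_nonneg_right bκV (mul_nonneg hh2 (hG))
    rw [hZ]
    linarith
  have hZ3 := mul_le_mul_of_nonneg_left hZ2 hh2
  have t3 : -(B * B) - h ^ 2 * Z ^ 2 ≤ 2 * h * (B * Z) := by
    nlinarith [sq_nonneg (B + h * Z)]
  have t4 : -(h ^ 2 * K * (u * u)) - h ^ 2 * Z ^ 2 ≤ -(2 * h ^ 2 * (q * u * Z)) := by
    have h1 := mul_le_mul_of_nonneg_right bq (mul_nonneg hh2 hu2)
    nlinarith [mul_nonneg hh2 (sq_nonneg (q * u - Z))]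
  -- The gain. Since κ inverts V where u ≠ 0, u² = κ²V²u² ≤ KV²u², and 4s² ≥ 1.
  have t5 : h * δ / K * (u * u) ≤ 4 * h * δ * (s * s * V * V * (u * u)) := by
    have h6 : u * u ≤ K * (V ^ 2 * u ^ 2) := by
      calc u * u = κ ^ 2 * (V ^ 2 * u ^ 2) := by
            linear_combination (-(κ * V * u) - u) * h5
        _ ≤ _ := mul_le_mul_of_nonneg_right bκ (by positivity)
    have h7 := mul_le_mul_of_nonneg_right bs (show 0 ≤ V ^ 2 * u ^ 2 by positivity)
    have h8 : u * u / K ≤ 4 * (s * s * V * V * (u * u)) := by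
      rw [div_le_iff₀ (zero_lt_one.trans_le hK)]
      nlinarith
    have h9 := mul_le_mul_of_nonneg_left h8 (mul_nonneg hh.le hδ)
    calc h * δ / K * (u * u) = h * δ * (u * u / K) := by ring
      _ ≤ _ := h9
      _ = _ := by ring
  have t7 : 0 ≤ 4 * δ * h ^ 3 * (X * X) :=
    mul_nonneg (by positivity) (mul_self_nonneg _)
  linarith

section
variable {n : ℕ} {N : Type*} [TopologicalSpace N] [ChartedSpace (Coord n) N]
  [IsManifold (𝓡 n) ∞ N] [T2Space N] [CompactSpace N] [MeasurableSpace N] [BorelSpace N]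

namespace SmoothFn
variable (g : RiemMetric n N) (φ ψ u v w W κ μ : SmoothFn n N)

/-- In the first two terms on the right the contributions of Hess u cancel, which leaves 4 Hess
ψ(∇u, ∇u). -/
theorem integ_lap_mul_transport :
    -2 * integ g (lap g u * ((2 : ℝ) • gam g ψ u + lap g ψ * u)) =
      4 * integ g (gam g u (gam g ψ u)) - 2 * integ g (gam g ψ (gam g u u))
        - integ g (lap g (lap g ψ) * (u * u)) := by
  have e1 : lap g u * ((2 : ℝ) • gam g ψ u + lap g ψ * u) =
      (2 : ℝ) • (gam g ψ u * lap g u) + (lap g ψ * u) * lap g u := by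
    rw [mul_add, mul_smul_comm, mul_comm (lap g u), mul_comm (lap g u)]
  have e2 : integ g (gam g ψ (gam g u u)) = -integ g (lap g ψ * gam g u u) := by
    rw [mul_comm, integ_mul_lap, neg_neg]
  have e3 : integ g (lap g (lap g ψ) * (u * u)) = -2 * integ g (u * gam g u (lap g ψ)) := by
    rw [mul_comm, integ_mul_lap, gam_mul_right, map_add, gam_comm g u]
    ring
  rw [e1, e2, e3]
  simp only [map_add, map_smul, integ_mul_lap, gam_mul_right, smul_eq_mul]
  ring

/-- Times u, the transport term is the divergence of u²∇ψ, so one integration by parts puts the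
derivative on W. -/
theorem integ_potential_mul_transport :
    -2 * integ g (W * u * ((2 : ℝ) • gam g ψ u + lap g ψ * u)) =
      2 * integ g (gam g ψ W * (u * u)) := by
  have e1 : W * u * ((2 : ℝ) • gam g ψ u + lap g ψ * u) =
      (2 : ℝ) • (W * (u * gam g ψ u)) + (W * (u * u)) * lap g ψ := by
    rw [mul_add, mul_smul_comm]; ring_nf
  have e2 : W * (u * gam g ψ u + u * gam g ψ u) + (u * u) * gam g ψ W =
    (2 : ℝ) • (W * (u * gam g ψ u)) + gam g ψ W * (u * u) := by
    rw [two_smul]; ring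
  rw [e1, map_add, integ_mul_lap, gam_mul_right, gam_mul_right, e2]
  simp only [map_add, map_smul, smul_eq_mul]
  ring

/-- Trades the gradient term μ|du|² for one containing Δu, hence for A, at the cost of a term of
order zero. -/
theorem integ_mul_mul_lap :
    integ g (μ * u * lap g u) =
      -integ g (μ * gam g u u) + 2⁻¹ * integ g (lap g μ * (u * u)) := by
  rw [integ_mul_lap, mul_comm (lap g μ), integ_mul_lap, gam_mul_right, gam_mul_right, gam_comm g μ]
  simp only [map_add]
  ring

/-- The convexified weight `φ + δφ²/2`. -/
noncomputable def convexify (φ : SmoothFn n N) (δ : ℝ) : SmoothFn n N := φ + (δ / 2) • (φ * φ)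

theorem gam_convexify (δ : ℝ) : gam g (convexify φ δ) w = (1 + δ • φ) * gam g φ w := by
  rw [convexify, gam_add_left, gam_smul_left, gam_mul_left]
  ext x
  simp
  ring

theorem lap_convexify (δ : ℝ) :
    lap g (convexify φ δ) = (1 + δ • φ) * lap g φ + δ • gam g φ φ := by
  rw [convexify, map_add, map_smul, lap_mul]
  ext x
  simp
  ring

theorem gam_convexify_self (δ : ℝ) :
    gam g (convexify φ δ) (convexify φ δ) = (1 + δ • φ) * (1 + δ • φ) * gam g φ φ := by
  rw [gam_convexify, gam_comm, gam_convexify, mul_assoc]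

theorem gam_one_add_smul (δ : ℝ) : gam g w (1 + δ • φ) = δ • gam g w φ := by
  rw [gam_add_right, gam_one_right, zero_add, gam_smul_right]

variable {φ κ u} in
/-- The identity behind the Carleman estimate with the convexified weight. -/
theorem integ_conj_sq {h δ : ℝ} (hh : h ≠ 0)
    (hQ : (4 : ℝ) • gam g u (gam g φ u) - (2 : ℝ) • gam g φ (gam g u u) =
      (-2 : ℝ) • (κ * gam g φ (gam g φ φ)) * gam g u u
        + (4 : ℝ) • (κ * (gam g φ u * gam g u (gam g φ φ))))
    (hκ : κ * gam g φ φ * u = u) (s V A B μ q Z : SmoothFn n N) (hs : s = 1 + δ • φ)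
    (hV : V = gam g φ φ) (hA : A = (-h ^ 2) • lap g u - s * s * V * u)
    (hq : q = s * lap g φ + δ • V) (hB : B = (2 * h) • (s * gam g φ u) + h • (q * u))
    (hμ : μ = s * ((-2 : ℝ) • (κ * gam g φ V))) (hZ : Z = h • (κ * gam g u V)) :
    integ g (conj g (convexify φ δ) h u * conj g (convexify φ δ) h u) =
      integ g (A * A + B * B + h • (μ * u * A) + (h ^ 3 / 2) • (lap g μ * (u * u))
        + (2 * h) • (B * Z) - (2 * h ^ 2) • (q * u * Z) + (4 * δ * h ^ 3) • (gam g φ u * gam g φ u)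
        - h ^ 3 • (lap g q * (u * u)) + (4 * h * δ) • (s * s * V * V * (u * u))) := by
  have hq' : q = lap g (convexify φ δ) := by rw [lap_convexify, hq, hs, hV]
  have hsV : s * s * V = gam g (convexify φ δ) (convexify φ δ) := by
    rw [gam_convexify_self, hs, hV]
  have hsg : ∀ w, s * gam g φ w = gam g (convexify φ δ) w := fun w => by rw [gam_convexify, hs]
  have hP : conj g (convexify φ δ) h u = A + B := by
    rw [conj_eq g _ hh, hA, hB, hsV, ← hq', ← hsg u]
  have hBt : B = h • ((2 : ℝ) • gam g (convexify φ δ) u + lap g (convexify φ δ) * u) := by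
    rw [hB, ← hq', ← hsg u, smul_add, smul_smul, mul_comm h 2]
  -- the cross term
  have hAB : 2 * integ g (A * B) = h ^ 3 * (4 * integ g (gam g u (gam g (convexify φ δ) u))
      - 2 * integ g (gam g (convexify φ δ) (gam g u u)) - integ g (lap g q * (u * u)))
      + h * (2 * integ g (gam g (convexify φ δ) (s * s * V) * (u * u))) := by
    have h1 := integ_lap_mul_transport g (convexify φ δ) u
    have h2 := integ_potential_mul_transport g (convexify φ δ) u (s * s * V)
    rw [hq', ← h1, ← h2, hBt, hA, sub_mul, map_sub, mul_smul_comm, mul_smul_comm, smul_mul_assoc]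
    simp only [map_smul, smul_eq_mul]
    ring
  -- The convexified differential is s dφ with ds = δ dφ. The derivative of s produces the square
  -- term in δ; the rest is s times `hQ`.
  have hT : (4 : ℝ) • gam g u (gam g (convexify φ δ) u) - (2 : ℝ) • gam g (convexify φ δ) (gam g u u)
      = μ * gam g u u + (4 : ℝ) • (s * κ * (gam g φ u * gam g u V))
        + (4 * δ) • (gam g φ u * gam g φ u) := by
    rw [← hsg, ← hsg, gam_mul_right]
    have h3 : gam g u s = δ • gam g φ u := by rw [hs, gam_one_add_smul, gam_comm]
    have h4 : (4 : ℝ) • (s * gam g u (gam g φ u) + gam g φ u * gam g u s)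
        - (2 : ℝ) • (s * gam g φ (gam g u u)) =
        s * ((4 : ℝ) • gam g u (gam g φ u) - (2 : ℝ) • gam g φ (gam g u u)) +
          (4 * δ) • (gam g φ u * gam g φ u) := by
      rw [h3]
      ext x
      simp
      ring
    rw [h4, hQ, hμ, hV]
    ext x
    simp
    ring
  have hT' := congrArg (integ g) hT
  simp only [map_add, map_sub, map_smul, smul_eq_mul] at hT'
  -- Differentiating s² produces the gain 4δs²V²u². The derivative of V, rewritten by κVu = u, is
  -- the potential part of μuA and matches the μ|du|² of `hT`.
  have hW : (2 : ℝ) • (gam g (convexify φ δ) (s * s * V) * (u * u)) =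
      (-1 : ℝ) • (μ * u * (s * s * V * u)) + (4 * δ) • (s * s * V * V * (u * u)) := by
    have h3 : gam g φ s = δ • V := by rw [hs, gam_one_add_smul, hV]
    rw [← hsg, gam_mul_right, gam_mul_right, h3, hμ]
    ext x
    have h5 : κ x * V x * u x = u x := by
      rw [hV]; exact DFunLike.congr_fun hκ x
    simp
    linear_combination (-2 * s x ^ 3 * gam g φ V x * u x) * h5
  have hW' := congrArg (integ g) hW
  simp only [map_add, map_smul, smul_eq_mul] at hW'
  have hμA : μ * u * A = (-h ^ 2) • (μ * u * lap g u) - μ * u * (s * s * V * u) := by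
    rw [hA, mul_sub, mul_smul_comm]
  have hμA' := congrArg (integ g) hμA
  simp only [map_sub, map_smul, smul_eq_mul] at hμA'
  rw [integ_mul_mul_lap] at hμA'
  -- Substitute 2hs⟨dφ, du⟩ = B - hqu: the mixed term of the Hessian formula is a multiple of B up
  -- to lower order.
  have hBZ : (4 * h ^ 3) • (s * κ * (gam g φ u * gam g u V)) =
      (2 * h) • (B * Z) - (2 * h ^ 2) • (q * u * Z) := by
    rw [hB, hZ]
    ext x
    simp
    ring
  have hBZ' := congrArg (integ g) hBZ
  simp only [map_sub, map_smul, smul_eq_mul] at hBZ'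
  have hsq : (A + B) * (A + B) = A * A + B * B + (2 : ℝ) • (A * B) := by
    rw [two_smul]; ring
  rw [hP, hsq]
  simp only [map_add, map_sub, map_smul, smul_eq_mul]
  linear_combination hAB + h ^ 3 * hT' + h * hW' - h * hμA' + hBZ'

-- The pointwise bound loses 2Kh⁴|du|². Pairing u with A controls h²∫|du|² by ½‖A‖² + (½ + K)‖u‖²,
-- and the resulting Kh²‖A‖² is absorbed by the remaining ¾‖A‖².
variable {φ κ u} in
theorem sq_mul_integ_le_integ_conj_sq {h δ K : ℝ} (hh : 0 < h) (hh1 : h ≤ 1) (hδ : 0 ≤ δ)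
    (hK : 1 ≤ K) (hhK : K * h ^ 2 ≤ 3 / 4) (hδK : K * (7 * K ^ 2 + 1) * h ≤ δ)
    (hQ : (4 : ℝ) • gam g u (gam g φ u) - (2 : ℝ) • gam g φ (gam g u u) =
      (-2 : ℝ) • (κ * gam g φ (gam g φ φ)) * gam g u u
        + (4 : ℝ) • (κ * (gam g φ u * gam g u (gam g φ φ))))
    (hκ : κ * gam g φ φ * u = u) (s V μ q : SmoothFn n N) (hs : s = 1 + δ • φ)
    (hV : V = gam g φ φ) (hq : q = s * lap g φ + δ • V)
    (hμ : μ = s * ((-2 : ℝ) • (κ * gam g φ V)))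
    (bs : ∀ x, 1 / 4 ≤ s x ^ 2) (bsV : ∀ x, s x ^ 2 * V x ≤ K) (bμ : ∀ x, μ x ^ 2 ≤ K)
    (bLμ : ∀ x, |lap g μ x| ≤ K) (bq : ∀ x, q x ^ 2 ≤ K) (bLq : ∀ x, |lap g q x| ≤ K)
    (bκ : ∀ x, κ x ^ 2 ≤ K) (bκV : ∀ x, κ x ^ 2 * gam g V V x ≤ K) :
    h ^ 2 * integ g (u * u) ≤
      integ g (conj g (convexify φ δ) h u * conj g (convexify φ δ) h u) := by
  obtain ⟨A, hA⟩ : ∃ A, A = (-h ^ 2) • lap g u - s * s * V * u := ⟨_, rfl⟩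
  obtain ⟨B, hB⟩ : ∃ B, B = (2 * h) • (s * gam g φ u) + h • (q * u) := ⟨_, rfl⟩
  obtain ⟨Z, hZ⟩ : ∃ Z, Z = h • (κ * gam g u V) := ⟨_, rfl⟩
  rw [integ_conj_sq g hh.ne' hQ hκ s V A B μ q Z hs hV hA hq hB hμ hZ]
  -- the gradient is controlled by `A`
  have hD : h ^ 2 * integ g (gam g u u) = integ g (u * A) + integ g (s * s * V * (u * u)) := by
    have h1 : u * A = (-h ^ 2) • (u * lap g u) - s * s * V * (u * u) := by
      rw [hA, mul_sub, mul_smul_comm]; ring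
    rw [h1, map_sub, map_smul, integ_mul_lap, smul_eq_mul]
    ring
  have hD' : integ g (u * A) + integ g (s * s * V * (u * u)) ≤
      2⁻¹ * integ g (A * A) + (2⁻¹ + K) * integ g (u * u) := by
    have h2 : integ g (u * A + s * s * V * (u * u)) ≤
        integ g ((2⁻¹ : ℝ) • (A * A) + (2⁻¹ + K) • (u * u)) := integ_mono g fun x => ?_
    · simpa only [map_add, map_smul, smul_eq_mul] using h2
    simp only [ContMDiffMap.coe_mul, ContMDiffMap.coe_add, ContMDiffMap.coe_smul, Pi.mul_apply,
      Pi.add_apply, Pi.smul_apply, smul_eq_mul]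
    have h1 := mul_le_mul_of_nonneg_right (bsV x) (mul_self_nonneg (u x))
    nlinarith [sq_nonneg (u x - A x)]
  have hlow : integ g ((3 / 4 : ℝ) • (A * A) + (h * δ / K - 7 / 2 * h ^ 2 * K) • (u * u)
      - (2 * K * h ^ 2 * h ^ 2) • gam g u u) ≤
      integ g (A * A + B * B + h • (μ * u * A) + (h ^ 3 / 2) • (lap g μ * (u * u))
        + (2 * h) • (B * Z) - (2 * h ^ 2) • (q * u * Z) + (4 * δ * h ^ 3) • (gam g φ u * gam g φ u)
        - h ^ 3 • (lap g q * (u * u)) + (4 * h * δ) • (s * s * V * V * (u * u))) := by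
    refine integ_mono g fun x => ?_
    simp only [ContMDiffMap.coe_mul, ContMDiffMap.coe_add, ContMDiffMap.coe_sub,
      ContMDiffMap.coe_smul, Pi.mul_apply, Pi.add_apply, Pi.sub_apply, Pi.smul_apply, smul_eq_mul]
    have h5 : κ x * V x * u x = u x := by
      rw [hV]; exact DFunLike.congr_fun hκ x
    exact carleman_pointwise hh hh1 hδ hK h5 (by rw [hZ]; rfl) (bs x) (bμ x) (bLμ x) (bq x) (bLq x)
      (bκ x) (bκV x) (gam_sq_le g u V x) (gam_self_nonneg g u x)
  refine le_trans ?_ hlow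
  simp only [map_add, map_sub, map_smul, smul_eq_mul]
  have hn := integ_sq_nonneg g u
  have ha := integ_sq_nonneg g A
  -- The losses in h²‖u‖² add up to 7K/2 + K + 2K² ≤ 7K²; the extra 1 is the term to be proved.
  have hc : h ^ 2 * (7 * K ^ 2 + 1) ≤ h * δ / K := by
    rw [le_div_iff₀ (zero_lt_one.trans_le hK)]
    nlinarith
  have h1 := mul_le_mul_of_nonneg_right hc hn
  have h2 := mul_le_mul_of_nonneg_left (hD.le.trans hD') (show 0 ≤ 2 * K * h ^ 2 by positivity)
  have h3 := mul_le_mul_of_nonneg_right hhK ha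
  have h4 : K * (h ^ 2 * integ g (u * u)) ≤ K ^ 2 * (h ^ 2 * integ g (u * u)) :=
    mul_le_mul_of_nonneg_right (by nlinarith) (by positivity)
  have h5 : 0 ≤ K ^ 2 * (h ^ 2 * integ g (u * u)) := by positivity
  nlinarith

end SmoothFn
end

/-! ### The Poisson bracket condition as a formula for the Hessian -/

section
variable {n : ℕ} {N : Type*} [TopologicalSpace N] [ChartedSpace (Coord n) N]
  [IsManifold (𝓡 n) ∞ N]

theorem pderiv_eq_of_hasFDerivAt {f : Coord n → ℝ} {f' : Coord n →L[ℝ] ℝ} {y : Coord n}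
    (h : HasFDerivAt f f' y) (i : Fin n) : pderiv i f y = f' (stdVec i) := by
  rw [pderiv, h.fderiv]

theorem pderiv_sum {ι : Type*} (s : Finset ι) {f : ι → Coord n → ℝ} {y : Coord n}
    (h : ∀ k ∈ s, DifferentiableAt ℝ (f k) y) (i : Fin n) :
    pderiv i (fun z => ∑ k ∈ s, f k z) y = ∑ k ∈ s, pderiv i (f k) y := by
  rw [pderiv, fderiv_fun_sum h]
  simp [pderiv]

theorem pderiv_mul {f f' : Coord n → ℝ} {y : Coord n} (h : DifferentiableAt ℝ f y)
    (h' : DifferentiableAt ℝ f' y) (i : Fin n) :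
    pderiv i (fun z => f z * f' z) y = f y * pderiv i f' y + f' y * pderiv i f y := by
  rw [pderiv, fderiv_fun_mul h h']
  rfl

theorem pderiv_sub {f f' : Coord n → ℝ} {y : Coord n} (h : DifferentiableAt ℝ f y)
    (h' : DifferentiableAt ℝ f' y) (i : Fin n) :
    pderiv i (fun z => f z - f' z) y = pderiv i f y - pderiv i f' y := by
  rw [pderiv, fderiv_fun_sub h h']
  rfl

theorem pderiv_neg (f : Coord n → ℝ) (y : Coord n) (i : Fin n) :
    pderiv i (fun z => -f z) y = -pderiv i f y := by
  rw [pderiv, fderiv_fun_neg]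
  rfl

theorem pderiv_const_mul {f : Coord n → ℝ} {y : Coord n} (h : DifferentiableAt ℝ f y) (c : ℝ)
    (i : Fin n) : pderiv i (fun z => c * f z) y = c * pderiv i f y := by
  rw [pderiv, fderiv_const_mul h]
  rfl

theorem pderiv_const (c : ℝ) (y : Coord n) (i : Fin n) : pderiv i (fun _ => c) y = 0 := by
  simp [pderiv]

theorem differentiableAt_coord (j : Fin n) (y : Coord n) :
    DifferentiableAt ℝ (fun z : Coord n => z j) y := by
  fun_prop

theorem pderiv_coord (i j : Fin n) (y : Coord n) :
    pderiv i (fun z : Coord n => z j) y = if j = i then 1 else 0 := by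
  have h : HasFDerivAt (fun z : Coord n => z j) (EuclideanSpace.proj j : Coord n →L[ℝ] ℝ) y :=
    (EuclideanSpace.proj j : Coord n →L[ℝ] ℝ).hasFDerivAt
  rw [pderiv_eq_of_hasFDerivAt h]
  simp

theorem pderiv_comm {f : Coord n → ℝ} {y : Coord n} (h : ContDiffAt ℝ ∞ f y) (i j : Fin n) :
    pderiv i (pderiv j f) y = pderiv j (pderiv i f) y := by
  have h2 : IsSymmSndFDerivAt ℝ f y := h.isSymmSndFDerivAt (by
    rw [minSmoothness_of_isRCLikeNormedField]; exact WithTop.coe_le_coe.2 le_top)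
  have hd : DifferentiableAt ℝ (fderiv ℝ f) y :=
    (h.fderiv_right (m := 1) (by norm_cast)).differentiableAt (by simp)
  have key : ∀ i j : Fin n, pderiv i (pderiv j f) y =
      fderiv ℝ (fderiv ℝ f) y (stdVec i) (stdVec j) := fun i j => by
    have := (hd.hasFDerivAt.clm_apply (hasFDerivAt_const (stdVec j) y)).fderiv
    change fderiv ℝ (fun z => fderiv ℝ f z (stdVec j)) y (stdVec i) = _
    rw [this]
    simp
  rw [key, key]
  exact h2 _ _

variable (g : RiemMetric n N) {e : OpenPartialHomeomorph N (Coord n)} {u v φ : N → ℝ}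

theorem chartGrad_gamma (he : e ∈ IsManifold.maximalAtlas (𝓡 n) ∞ N)
    (hu : ContMDiff (𝓡 n) 𝓘(ℝ, ℝ) ∞ u) (hv : ContMDiff (𝓡 n) 𝓘(ℝ, ℝ) ∞ v)
    {y : Coord n} (hy : y ∈ e.target) (j : Fin n) :
    chartGrad e (gamma g u v) j y = ∑ k, ∑ l,
      (pderiv j (fun z => metricInv g e z k l) y * chartGrad e u k y * chartGrad e v l y
        + metricInv g e y k l * pderiv j (chartGrad e u k) y * chartGrad e v l y
        + metricInv g e y k l * chartGrad e u k y * pderiv j (chartGrad e v l) y) := by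
  have hmem := e.open_target.mem_nhds hy
  have dH : ∀ k l, DifferentiableAt ℝ (fun z => metricInv g e z k l) y := fun k l =>
    ((contDiffOn_metricInv g he k l).contDiffAt hmem).differentiableAt (by simp)
  have du : ∀ k, DifferentiableAt ℝ (chartGrad e u k) y := fun k =>
    ((contDiffOn_chartGrad he hu k).contDiffAt hmem).differentiableAt (by simp)
  have dv : ∀ k, DifferentiableAt ℝ (chartGrad e v k) y := fun k =>
    ((contDiffOn_chartGrad he hv k).contDiffAt hmem).differentiableAt (by simp)
  -- Before differentiating, the pointwise definition is replaced by its expression in the one chart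
  -- e.
  have h1 : (fun z => gamma g u v (e.symm z)) =ᶠ[nhds y] chartGamma g e u v := by
    filter_upwards [hmem] with z hz
    rw [← chartGamma_eq_gamma g he hu hv (e.map_target hz), e.right_inv hz]
  have h2 : chartGrad e (gamma g u v) j y = pderiv j (chartGamma g e u v) y := by
    simp only [chartGrad, pderiv]
    rw [h1.fderiv_eq]
  rw [h2]
  have hd : ∀ k l, DifferentiableAt ℝ
      (fun z => metricInv g e z k l * chartGrad e u k z * chartGrad e v l z) y :=
    fun k l => ((dH k l).mul (du k)).mul (dv l)
  change pderiv j (fun z => ∑ k, ∑ l, metricInv g e z k l * chartGrad e u k z * chartGrad e v l z) y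
    = _
  rw [pderiv_sum _ fun k _ => DifferentiableAt.fun_sum fun l _ => hd k l]
  refine Finset.sum_congr rfl fun k _ => ?_
  rw [pderiv_sum _ fun l _ => hd k l]
  refine Finset.sum_congr rfl fun l _ => ?_
  rw [pderiv_mul (f := fun z => metricInv g e z k l * chartGrad e u k z) ((dH k l).mul (du k)) (dv l), pderiv_mul (dH k l) (du k)]
  ring

theorem gamma_eq_sum (x : N) : gamma g u v x = ∑ j, (∑ i, metricInv g (chartAt (Coord n) x)
    (chartAt (Coord n) x x) i j * chartGrad (chartAt (Coord n) x) u i (chartAt (Coord n) x x)) *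
      chartGrad (chartAt (Coord n) x) v j (chartAt (Coord n) x x) := by
  rw [gamma, chartGamma, Finset.sum_comm]
  simp only [Finset.sum_mul]

/-- The covector `du` at `x` in the coordinates of the chart at `x`. -/
noncomputable def covector (u : N → ℝ) (x : N) : Coord n :=
  WithLp.toLp 2 fun i => chartGrad (chartAt (Coord n) x) u i (chartAt (Coord n) x x)

@[simp] theorem covector_apply (u : N → ℝ) (x : N) (i : Fin n) :
    covector (n := n) u x i = chartGrad (chartAt (Coord n) x) u i (chartAt (Coord n) x x) := rfl

theorem symbolRe_covector (x : N) :
    symbolRe g φ (chartAt (Coord n) x) (chartAt (Coord n) x x) (covector u x) =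
      gamma g u u x - gamma g φ φ x := rfl

theorem symbolIm_covector (x : N) :
    symbolIm g φ (chartAt (Coord n) x) (chartAt (Coord n) x x) (covector u x) =
      2 * gamma g u φ x := rfl

theorem pderiv_symbolRe_covariable (φ : N → ℝ) (y ξ : Coord n) (k : Fin n) :
    pderiv k (fun η => symbolRe g φ e y η) ξ = 2 * ∑ i, metricInv g e y i k * ξ i := by
  unfold symbolRe
  have hd : ∀ i j, DifferentiableAt ℝ (fun η : Coord n => metricInv g e y i j * η i * η j) ξ :=
    fun i j => ((differentiableAt_coord i ξ).const_mul _).mul (differentiableAt_coord j ξ)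
  rw [pderiv_sub (DifferentiableAt.fun_sum fun i _ => DifferentiableAt.fun_sum fun j _ => hd i j)
    (differentiableAt_const _), pderiv_const, sub_zero,
    pderiv_sum _ fun i _ => DifferentiableAt.fun_sum fun j _ => hd i j]
  have h1 : ∀ i, pderiv k (fun η : Coord n => ∑ j, metricInv g e y i j * η i * η j) ξ =
      ∑ j, (metricInv g e y i j * ξ i * (if j = k then 1 else 0)
        + metricInv g e y i j * ξ j * (if i = k then 1 else 0)) := fun i => by
    rw [pderiv_sum _ fun j _ => hd i j]
    refine Finset.sum_congr rfl fun j _ => ?_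
    rw [pderiv_mul ((differentiableAt_coord i ξ).const_mul _) (differentiableAt_coord j ξ),
      pderiv_const_mul (differentiableAt_coord i ξ), pderiv_coord, pderiv_coord]
    ring
  simp only [h1, Finset.sum_add_distrib, mul_ite, mul_one, mul_zero, Finset.sum_ite_eq',
    Finset.mem_univ, if_true]
  rw [Finset.sum_comm (f := fun i j => if i = k then metricInv g e y i j * ξ j else 0)]
  simp only [Finset.sum_ite_eq', Finset.mem_univ, if_true]
  rw [two_mul]
  congr 1
  exact Finset.sum_congr rfl fun i _ => by rw [metricInv_symm]

theorem pderiv_symbolIm_covariable (φ : N → ℝ) (y ξ : Coord n) (k : Fin n) :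
    pderiv k (fun η => symbolIm g φ e y η) ξ = 2 * ∑ i, metricInv g e y i k * chartGrad e φ i y := by
  unfold symbolIm
  have hd : ∀ i j, DifferentiableAt ℝ (fun η : Coord n => metricInv g e y i j * η i *
      pderiv j (fun z => φ (e.symm z)) y) ξ :=
    fun i j => ((differentiableAt_coord i ξ).const_mul _).mul_const _
  rw [pderiv_const_mul
    (DifferentiableAt.fun_sum fun i _ => DifferentiableAt.fun_sum fun j _ => hd i j),
    pderiv_sum _ fun i _ => DifferentiableAt.fun_sum fun j _ => hd i j]
  have h1 : ∀ i, pderiv k (fun η : Coord n => ∑ j, metricInv g e y i j * η i *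
      pderiv j (fun z => φ (e.symm z)) y) ξ =
      ∑ j, metricInv g e y i j * chartGrad e φ j y * (if i = k then 1 else 0) := fun i => by
    rw [pderiv_sum _ fun j _ => hd i j]
    refine Finset.sum_congr rfl fun j _ => ?_
    rw [pderiv_mul ((differentiableAt_coord i ξ).const_mul _) (differentiableAt_const _),
      pderiv_const_mul (differentiableAt_coord i ξ), pderiv_coord, pderiv_const, chartGrad]
    ring
  simp only [h1]
  rw [Finset.sum_comm]
  simp only [mul_ite, mul_one, mul_zero, Finset.sum_ite_eq', Finset.mem_univ, if_true]
  congr 1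
  exact Finset.sum_congr rfl fun i _ => by rw [metricInv_symm]

theorem pderiv_symbolIm_base (he : e ∈ IsManifold.maximalAtlas (𝓡 n) ∞ N)
    (hφ : ContMDiff (𝓡 n) 𝓘(ℝ, ℝ) ∞ φ) {y : Coord n} (hy : y ∈ e.target) (ξ : Coord n) (k : Fin n) :
    pderiv k (fun z => symbolIm g φ e z ξ) y = 2 * ∑ i, ∑ j,
      (pderiv k (fun z => metricInv g e z i j) y * ξ i * chartGrad e φ j y
        + metricInv g e y i j * ξ i * pderiv k (chartGrad e φ j) y) := by
  have hmem := e.open_target.mem_nhds hy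
  have dH : ∀ k l, DifferentiableAt ℝ (fun z => metricInv g e z k l) y := fun k l =>
    ((contDiffOn_metricInv g he k l).contDiffAt hmem).differentiableAt (by simp)
  have dφ : ∀ k, DifferentiableAt ℝ (chartGrad e φ k) y := fun k =>
    ((contDiffOn_chartGrad he hφ k).contDiffAt hmem).differentiableAt (by simp)
  have hd : ∀ i j, DifferentiableAt ℝ (fun z => metricInv g e z i j * ξ i * chartGrad e φ j z) y :=
    fun i j => ((dH i j).mul_const _).mul (dφ j)
  change pderiv k (fun z => 2 * ∑ i, ∑ j, metricInv g e z i j * ξ i * chartGrad e φ j z) y = _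
  rw [pderiv_const_mul
    (DifferentiableAt.fun_sum fun i _ => DifferentiableAt.fun_sum fun j _ => hd i j),
    pderiv_sum _ fun i _ => DifferentiableAt.fun_sum fun j _ => hd i j]
  congr 1
  refine Finset.sum_congr rfl fun i _ => ?_
  rw [pderiv_sum _ fun j _ => hd i j]
  refine Finset.sum_congr rfl fun j _ => ?_
  rw [pderiv_mul ((dH i j).mul_const _) (dφ j), pderiv_mul (dH i j) (differentiableAt_const _),
    pderiv_const]
  ring

theorem pderiv_symbolRe_base (he : e ∈ IsManifold.maximalAtlas (𝓡 n) ∞ N)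
    (hφ : ContMDiff (𝓡 n) 𝓘(ℝ, ℝ) ∞ φ) {y : Coord n} (hy : y ∈ e.target) (ξ : Coord n) (k : Fin n) :
    pderiv k (fun z => symbolRe g φ e z ξ) y =
      (∑ i, ∑ j, pderiv k (fun z => metricInv g e z i j) y * ξ i * ξ j)
        - chartGrad e (gamma g φ φ) k y := by
  have hmem := e.open_target.mem_nhds hy
  have dH : ∀ k l, DifferentiableAt ℝ (fun z => metricInv g e z k l) y := fun k l =>
    ((contDiffOn_metricInv g he k l).contDiffAt hmem).differentiableAt (by simp)
  have hd : ∀ i j, DifferentiableAt ℝ (fun z => metricInv g e z i j * ξ i * ξ j) y :=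
    fun i j => ((dH i j).mul_const _).mul_const _
  have h1 : (fun z => gamma g φ φ (e.symm z)) =ᶠ[nhds y] chartGamma g e φ φ := by
    filter_upwards [hmem] with z hz
    rw [← chartGamma_eq_gamma g he hφ hφ (e.map_target hz), e.right_inv hz]
  have h2 : chartGrad e (gamma g φ φ) k y = pderiv k (chartGamma g e φ φ) y := by
    simp only [chartGrad, pderiv]
    rw [h1.fderiv_eq]
  change pderiv k (fun z => (∑ i, ∑ j, metricInv g e z i j * ξ i * ξ j) - chartGamma g e φ φ z) y = _
  rw [pderiv_sub
    (DifferentiableAt.fun_sum fun i _ => DifferentiableAt.fun_sum fun j _ => hd i j)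
    (((contDiffOn_chartGamma g he hφ hφ).contDiffAt hmem).differentiableAt (by simp)), ← h2,
    pderiv_sum _ fun i _ => DifferentiableAt.fun_sum fun j _ => hd i j]
  congr 1
  refine Finset.sum_congr rfl fun i _ => ?_
  rw [pderiv_sum _ fun j _ => hd i j]
  refine Finset.sum_congr rfl fun j _ => ?_
  rw [pderiv_mul ((dH i j).mul_const _) (differentiableAt_const _),
    pderiv_mul (dH i j) (differentiableAt_const _), pderiv_const, pderiv_const]
  ring

/-- The index computation behind `poissonBracket_covector`: H is the inverse metric, D its
derivatives, p = dφ, ξ = du, and pp, uu are second derivatives of φ and u. The bracket knows nothing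
of uu, whose contributions on the right cancel by symmetry. -/
theorem bracket_sum_identity {ι : Type*} [Fintype ι] (H : ι → ι → ℝ) (D : ι → ι → ι → ℝ)
    (p ξ : ι → ℝ) (pp uu : ι → ι → ℝ) (V : ι → ℝ) (hH : ∀ i j, H i j = H j i)
    (hD : ∀ k i j, D k i j = D k j i) (huu : ∀ i j, uu i j = uu j i) :
    ∑ k, ((2 * ∑ i, H i k * ξ i) * (2 * ∑ i, ∑ j, (D k i j * ξ i * p j + H i j * ξ i * pp k j))
      - ((∑ i, ∑ j, D k i j * ξ i * ξ j) - V k) * (2 * ∑ i, H i k * p i)) =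
    4 * ∑ j, (∑ i, H i j * ξ i) * (∑ k, ∑ l, (D j k l * p k * ξ l + H k l * pp j k * ξ l
        + H k l * p k * uu j l))
      - 2 * ∑ j, (∑ i, H i j * p i) * (∑ k, ∑ l, (D j k l * ξ k * ξ l + H k l * uu j k * ξ l
        + H k l * ξ k * uu j l))
      + 2 * ∑ j, (∑ i, H i j * p i) * V j := by
  have right : ∀ q r : ι → ℝ, ∑ k, ∑ l, H k l * q k * r l = ∑ l, (∑ k, H k l * q k) * r l := by
    intro q r
    rw [Finset.sum_comm]
    simp only [Finset.sum_mul]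
  have left : ∀ q r : ι → ℝ, ∑ k, ∑ l, H k l * q k * r l = ∑ k, (∑ l, H l k * r l) * q k := by
    intro q r
    simp only [Finset.sum_mul]
    refine Finset.sum_congr rfl fun k _ => Finset.sum_congr rfl fun l _ => ?_
    rw [hH l k]
    ring
  have hE : ∀ j, ∑ k, ∑ l, D j k l * p k * ξ l = ∑ k, ∑ l, D j k l * ξ k * p l := by
    intro j
    rw [Finset.sum_comm]
    refine Finset.sum_congr rfl fun k _ => Finset.sum_congr rfl fun l _ => ?_
    rw [hD j l k]
    ring
  have hcomm : ∀ a b : ι → ℝ, ∑ j, a j * ∑ l, b l * uu j l = ∑ j, b j * ∑ l, a l * uu j l := by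
    intro a b
    simp only [Finset.mul_sum]
    rw [Finset.sum_comm]
    refine Finset.sum_congr rfl fun k _ => Finset.sum_congr rfl fun l _ => ?_
    rw [huu l k]
    ring
  simp only [Finset.sum_add_distrib, hE]
  simp only [left (fun k => pp _ k), left (fun k => uu _ k), right ξ, right p]
  have h := hcomm (fun j => ∑ i, H i j * ξ i) (fun j => ∑ i, H i j * p i)
  rw [← sub_eq_zero, Finset.mul_sum, Finset.mul_sum, Finset.mul_sum, ← Finset.sum_sub_distrib,
    ← Finset.sum_add_distrib, ← Finset.sum_sub_distrib]
  rw [← sub_eq_zero, ← Finset.sum_sub_distrib] at h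
  rw [← mul_zero (-4 : ℝ), ← h, Finset.mul_sum]
  exact Finset.sum_congr rfl fun k _ => by ring

/-- Evaluating at ξ = du(x) makes the bracket coordinate free, in the form in which the cross term
appears after integration by parts. -/
theorem poissonBracket_covector (hφ : ContMDiff (𝓡 n) 𝓘(ℝ, ℝ) ∞ φ)
    (hu : ContMDiff (𝓡 n) 𝓘(ℝ, ℝ) ∞ u) (x : N) :
    poissonBracket (symbolRe g φ (chartAt (Coord n) x)) (symbolIm g φ (chartAt (Coord n) x))
      (chartAt (Coord n) x x) (covector u x) =
      4 * gamma g u (gamma g φ u) x - 2 * gamma g φ (gamma g u u) x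
        + 2 * gamma g φ (gamma g φ φ) x := by
  have he := IsManifold.chart_mem_maximalAtlas (I := 𝓡 n) (n := ∞) x
  have hy := mem_chartAt_target (n := n) x
  have hsymm : ∀ i j, pderiv i (chartGrad (chartAt (Coord n) x) u j) (chartAt (Coord n) x x) =
      pderiv j (chartGrad (chartAt (Coord n) x) u i) (chartAt (Coord n) x x) := fun i j =>
    pderiv_comm ((contDiffOn_comp_symm he hu).contDiffAt
      ((chartAt (Coord n) x).open_target.mem_nhds hy)) i j
  rw [gamma_eq_sum, gamma_eq_sum, gamma_eq_sum, poissonBracket]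
  simp only [pderiv_symbolRe_covariable, pderiv_symbolIm_covariable,
    pderiv_symbolIm_base g he hφ hy, pderiv_symbolRe_base g he hφ hy, covector_apply,
    chartGrad_gamma g he hφ hu hy, chartGrad_gamma g he hu hu hy]
  exact bracket_sum_identity _ _ _ _ _ _ _ (fun i j => metricInv_symm g _ _ i j)
    (fun k i j => by simp only [metricInv_symm g _ _ i j]) hsymm

theorem poissonBracket_congr {a a' b b' : Coord n → Coord n → ℝ} {y ξ : Coord n}
    (ha : ∀ᶠ z in nhds y, a z = a' z) (hb : ∀ᶠ z in nhds y, b z = b' z) :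
    poissonBracket a b y ξ = poissonBracket a' b' y ξ := by
  have ha' : (fun z => a z ξ) =ᶠ[nhds y] fun z => a' z ξ := by
    filter_upwards [ha] with z hz using congrFun hz ξ
  have hb' : (fun z => b z ξ) =ᶠ[nhds y] fun z => b' z ξ := by
    filter_upwards [hb] with z hz using congrFun hz ξ
  simp only [poissonBracket, pderiv, ha.self_of_nhds, hb.self_of_nhds, ha'.fderiv_eq, hb'.fderiv_eq]

theorem symbol_congr {φ φ' : N → ℝ} {e : OpenPartialHomeomorph N (Coord n)} {x : N}
    (hx : x ∈ e.source) (h : φ =ᶠ[nhds x] φ') :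
    ∀ᶠ z in nhds (e x), symbolRe g φ e z = symbolRe g φ' e z ∧
      symbolIm g φ e z = symbolIm g φ' e z := by
  have h1 : (fun z => φ (e.symm z)) =ᶠ[nhds (e x)] fun z => φ' (e.symm z) := by
    have := e.continuousAt_symm (e.map_source hx)
    rw [ContinuousAt, e.left_inv hx] at this
    exact this.eventually h
  filter_upwards [h1.eventuallyEq_nhds] with z hz
  have h2 : ∀ i, pderiv i (fun z => φ (e.symm z)) z = pderiv i (fun z => φ' (e.symm z)) z :=
    fun i => by rw [pderiv, pderiv, hz.fderiv_eq]
  constructor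
  · ext ξ
    simp only [symbolRe, h2]
  · ext ξ
    simp only [symbolIm, h2]

/-- All the conditions are local, so a weight may be replaced by a cut-off version that is smooth on
N. -/
theorem GreenOperators.IsLimitingCarlemanWeight.congr {U O : Set N} {φ φ' : N → ℝ}
    (hφ : IsLimitingCarlemanWeight g U φ) (hO : IsOpen O) (hOU : O ⊆ U) (h : EqOn φ φ' O) :
    IsLimitingCarlemanWeight g O φ' := by
  have hev : ∀ x ∈ O, φ =ᶠ[nhds x] φ' := fun x hx => by
    filter_upwards [hO.mem_nhds hx] with z hz using h hz
  refine ⟨(hφ.smooth.mono hOU).congr fun x hx => (h hx).symm, fun x hx => ?_, ?_⟩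
  · rw [← (hev x hx).mfderiv_eq]
    exact hφ.mfderiv_ne_zero x (hOU hx)
  · intro e he x hx ξ hre him
    have hs := symbol_congr g hx.1 (hev x hx.2)
    rw [← hs.self_of_nhds.1] at hre
    rw [← hs.self_of_nhds.2] at him
    rw [← poissonBracket_congr (hs.mono fun _ hz => hz.1) (hs.mono fun _ hz => hz.2)]
    exact hφ.bracket_eq_zero e he x ⟨hx.1, hOU hx.2⟩ ξ hre him

/-- Re p is even and Im p odd in φ, so the zero set of p is unchanged and the bracket changes sign.
-/
theorem GreenOperators.IsLimitingCarlemanWeight.neg {U : Set N} {φ : N → ℝ}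
    (hφ : IsLimitingCarlemanWeight g U φ) : IsLimitingCarlemanWeight g U (-φ) := by
  have hd : ∀ (e : OpenPartialHomeomorph N (Coord n)) i y,
      pderiv i (fun z => (-φ) (e.symm z)) y = -pderiv i (fun z => φ (e.symm z)) y :=
    fun e i y => pderiv_neg _ _ _
  have hre : ∀ e, symbolRe g (-φ) e = symbolRe g φ e := fun e => by
    ext y ξ
    simp only [symbolRe, hd, mul_neg, neg_mul, neg_neg]
  have him : ∀ e, symbolIm g (-φ) e = fun y ξ => -symbolIm g φ e y ξ := fun e => by
    ext y ξ
    simp only [symbolIm, hd, mul_neg, Finset.sum_neg_distrib]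
  refine ⟨hφ.smooth.neg, fun x hx h0 => ?_, fun e he x hx ξ h1 h2 => ?_⟩
  · rw [mfderiv_neg] at h0
    exact hφ.mfderiv_ne_zero x hx (neg_eq_zero.1 h0)
  · rw [hre] at h1
    rw [him] at h2
    have h3 := hφ.bracket_eq_zero e he x hx ξ h1 (neg_eq_zero.1 h2)
    have h4 : poissonBracket (symbolRe g (-φ) e) (symbolIm g (-φ) e) (e x) ξ =
        -poissonBracket (symbolRe g φ e) (symbolIm g φ e) (e x) ξ := by
      rw [hre, him]
      simp only [poissonBracket, pderiv_neg, ← Finset.sum_neg_distrib]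
      exact Finset.sum_congr rfl fun k _ => by ring
    rw [h4, h3, neg_zero]

/-- If all coordinate derivatives vanished at x, the chain rule through the chart would give dφ = 0
there. -/
theorem GreenOperators.IsLimitingCarlemanWeight.gamma_pos {U : Set N} {φ : N → ℝ}
    (hφ : IsLimitingCarlemanWeight g U φ) (hU : IsOpen U) {x : N} (hx : x ∈ U) :
    0 < gamma g φ φ x := by
  refine gamma_self_pos g ?_
  by_contra! h0
  refine hφ.mfderiv_ne_zero x hx ?_
  have he := IsManifold.chart_mem_maximalAtlas (I := 𝓡 n) (n := ∞) x
  have hxs := mem_chart_source (Coord n) x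
  set e := chartAt (Coord n) x
  have h1 : φ =ᶠ[nhds x] (fun z => φ (e.symm z)) ∘ e := by
    filter_upwards [e.open_source.mem_nhds hxs] with z hz
    simp [e.left_inv hz]
  have hsm : ContMDiffAt (𝓡 n) 𝓘(ℝ, ℝ) ∞ (fun z => φ (e.symm z)) (e x) := by
    refine ContMDiffAt.comp (I' := 𝓡 n) (e x) (g := φ) ?_
      ((contMDiffOn_symm_of_mem_maximalAtlas he).contMDiffAt
        (e.open_target.mem_nhds (e.map_source hxs)))
    rw [e.left_inv hxs]
    exact hφ.smooth.contMDiffAt (hU.mem_nhds hx)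
  have h2 : mfderiv (𝓡 n) 𝓘(ℝ, ℝ) ((fun z => φ (e.symm z)) ∘ e) x =
      (mfderiv (𝓡 n) 𝓘(ℝ, ℝ) (fun z => φ (e.symm z)) (e x)).comp (mfderiv (𝓡 n) (𝓡 n) e x) :=
    mfderiv_comp x (hsm.mdifferentiableAt (by simp)) (mdifferentiableAt_chart he hxs)
  have h3 : fderiv ℝ (fun z => φ (e.symm z)) (e x) = 0 := by
    ext v
    rw [← sum_smul_stdVec v, map_sum]
    simp only [map_smul]
    exact Finset.sum_eq_zero fun i _ => by
      have : fderiv ℝ (fun z => φ (e.symm z)) (e x) (stdVec i) = 0 := h0 i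
      rw [this, smul_zero]
  rw [h1.mfderiv_eq, h2, mfderiv_eq_fderiv, h3]
  rfl

namespace SmoothFn

/-- The quadratic form `4 Hess φ (∇u, ∇u)`. -/
noncomputable def hessForm (φ u : SmoothFn n N) : SmoothFn n N :=
  (4 : ℝ) • gam g u (gam g φ u) - (2 : ℝ) • gam g φ (gam g u u)

variable (φ u : SmoothFn n N)

theorem hessForm_apply (x : N) :
    hessForm g φ u x = 4 * gam g u (gam g φ u) x - 2 * gam g φ (gam g u u) x := rfl

theorem poissonBracket_covector (x : N) :
    poissonBracket (symbolRe g φ (chartAt (Coord n) x)) (symbolIm g φ (chartAt (Coord n) x))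
      (chartAt (Coord n) x x) (covector u x) =
      hessForm g φ u x + 2 * gam g φ (gam g φ φ) x :=
  _root_.poissonBracket_covector g φ.contMDiff u.contMDiff x

theorem hessForm_smul (c : ℝ) (x : N) : hessForm g φ (c • u) x = c ^ 2 * hessForm g φ u x := by
  simp only [hessForm, gam_smul_left, gam_smul_right]
  simp
  ring

theorem hessForm_add_smul (t : ℝ) (x : N) : hessForm g φ (u + t • φ) x =
    hessForm g φ u x + 4 * t * gam g u (gam g φ φ) x + 2 * t ^ 2 * gam g φ (gam g φ φ) x := by
  simp only [hessForm, gam_smul_left, gam_smul_right, gam_add_left, gam_add_right, gam_comm g u φ]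
  simp
  ring

/-- By `poissonBracket_covector` the value at x depends on u only through du(x), so u may be
replaced by 0. -/
theorem hessForm_eq_zero {x : N} (h : gam g u u x = 0) : hessForm g φ u x = 0 := by
  have h0 : covector (n := n) u x = covector (0 : SmoothFn n N) x := by
    by_contra hne
    refine (gamma_self_pos g (u := u) (x := x) ?_).ne' h
    by_contra! h1
    refine hne ?_
    ext i
    rw [covector_apply, covector_apply, h1]
    simp [chartGrad, pderiv]
  have h1 := poissonBracket_covector g φ u x
  rw [h0, poissonBracket_covector] at h1
  have h2 : hessForm g φ 0 x = 0 := by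
    have := hessForm_smul g φ 0 0 x
    simpa using this
  linarith

/-- If dv is orthogonal to dφ at x, a multiple of it has length |dφ| and lies in the zero set of p;
homogeneity removes the normalisation. A general u is made orthogonal by subtracting a multiple of
φ. -/
theorem hessForm_of_isLimitingCarlemanWeight {O : Set N} (hO : IsOpen O)
    (hφ : IsLimitingCarlemanWeight g O φ) {x : N} (hx : x ∈ O) :
    gam g φ φ x * hessForm g φ u x = -2 * gam g φ (gam g φ φ) x * gam g u u x
      + 4 * (gam g φ u x * gam g u (gam g φ φ) x) := by
  have hV : 0 < gam g φ φ x := hφ.gamma_pos g hO hx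
  have horth : ∀ v : SmoothFn n N, gam g φ v x = 0 →
      gam g φ φ x * hessForm g φ v x = -2 * gam g φ (gam g φ φ) x * gam g v v x := by
    intro v hv
    -- A vanishing covector cannot be rescaled and is treated separately.
    rcases (gam_self_nonneg g v x).eq_or_lt with h0 | h0
    · rw [← h0, hessForm_eq_zero g φ v h0.symm]
      ring
    · set c := Real.sqrt (gam g φ φ x / gam g v v x)
      have hc : c ^ 2 = gam g φ φ x / gam g v v x := Real.sq_sqrt (div_pos hV h0).le
      have h1 := hφ.bracket_eq_zero (chartAt (Coord n) x) (IsManifold.chart_mem_maximalAtlas x) x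
        ⟨mem_chart_source _ x, hx⟩ (covector (c • v : SmoothFn n N) x) (by
          rw [symbolRe_covector]
          change gam g (c • v) (c • v) x - gam g φ φ x = 0
          rw [gam_smul_left, gam_smul_right]
          simp only [ContMDiffMap.coe_smul, Pi.smul_apply, smul_eq_mul]
          rw [← mul_assoc, ← sq, hc]
          field_simp
          ring) (by
          rw [symbolIm_covector]
          change 2 * gam g (c • v) φ x = 0
          rw [gam_smul_left, gam_comm]
          simp [hv])
      rw [poissonBracket_covector, hessForm_smul, hc] at h1
      field_simp at h1
      linarith
  obtain ⟨t, ht⟩ : ∃ t, t * gam g φ φ x = gam g φ u x :=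
    ⟨gam g φ u x / gam g φ φ x, div_mul_cancel₀ _ hV.ne'⟩
  have h1 := horth (u + (-t) • φ) (by
    rw [gam_add_right, gam_smul_right]
    simp only [ContMDiffMap.coe_add, ContMDiffMap.coe_smul, Pi.add_apply, Pi.smul_apply,
      smul_eq_mul]
    linarith)
  rw [hessForm_add_smul] at h1
  simp only [gam_smul_left, gam_smul_right, gam_add_left, gam_add_right, gam_comm g u φ,
    ContMDiffMap.coe_add, ContMDiffMap.coe_smul, Pi.add_apply, Pi.smul_apply, smul_eq_mul] at h1
  linear_combination h1 + (4 * gam g u (gam g φ φ) x - 4 * t * gam g φ (gam g φ φ) x) * ht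

end SmoothFn
end

/-! ### Cut-off functions and the Carleman estimate for the weight itself -/

section
variable {n : ℕ} {N : Type*} [TopologicalSpace N] [ChartedSpace (Coord n) N]
  [IsManifold (𝓡 n) ∞ N] [T2Space N] [CompactSpace N]

theorem ContMDiff.mul_of_tsupport_subset {χ f : N → ℝ} {U : Set N} (hU : IsOpen U)
    (hχ : ContMDiff (𝓡 n) 𝓘(ℝ, ℝ) ∞ χ) (hs : tsupport χ ⊆ U)
    (hf : ContMDiffOn (𝓡 n) 𝓘(ℝ, ℝ) ∞ f U) :
    ContMDiff (𝓡 n) 𝓘(ℝ, ℝ) ∞ fun x => χ x * f x := by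
  refine contMDiff_of_tsupport fun x hx => ?_
  have hxU : x ∈ U := hs (tsupport_mul_subset_left (f := χ) (g := f) hx)
  exact hχ.contMDiffAt.mul (hf.contMDiffAt (hU.mem_nhds hxU))

/-- The cut-off is 1 on a neighbourhood of M, so that products with it keep all their derivatives at
points of M. -/
theorem exists_smooth_cutoff {M U : Set N} (hM : IsClosed M) (hU : IsOpen U) (hMU : M ⊆ U) :
    ∃ χ : SmoothFn n N, ∃ O : Set N, IsOpen O ∧ M ⊆ O ∧ O ⊆ U ∧ (∀ x ∈ O, χ x = 1) ∧
      tsupport χ ⊆ U := by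
  obtain ⟨O', hO', hMO', hO'U⟩ := normal_exists_closure_subset hM hU hMU
  obtain ⟨O, hO, hMO, hOO'⟩ := normal_exists_closure_subset hM hO' hMO'
  obtain ⟨χ, h0, h1, -⟩ := exists_contMDiffMap_zero_one_of_isClosed (𝓡 n) (n := (⊤ : ℕ∞))
    hO'.isClosed_compl (isClosed_closure (s := O))
    (disjoint_left.2 fun x hx hx' => hx (hOO' hx'))
  refine ⟨χ, O, hO, hMO, (subset_closure.trans hOO').trans (subset_closure.trans hO'U),
    fun x hx => h1 (subset_closure hx), (closure_mono fun x hx => ?_).trans hO'U⟩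
  by_contra hx'
  exact hx (h0 hx')

namespace SmoothFn

theorem exists_inverse_on (V : SmoothFn n N) {M O : Set N} (hM : IsClosed M) (hO : IsOpen O)
    (hMO : M ⊆ O) (hV : ∀ x ∈ O, 0 < V x) : ∃ κ : SmoothFn n N, ∀ x ∈ M, κ x * V x = 1 := by
  obtain ⟨χ, O', -, hMO', -, h1, hs⟩ := exists_smooth_cutoff (n := n) hM hO hMO
  refine ⟨⟨fun x => χ x * (V x)⁻¹, χ.contMDiff.mul_of_tsupport_subset hO hs fun x hx => ?_⟩,
    fun x hx => ?_⟩
  · exact (V.contMDiff.contMDiffAt.inv₀ (hV x hx).ne').contMDiffWithinAt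
  · change χ x * (V x)⁻¹ * V x = 1
    rw [h1 x (hMO' hx), one_mul, inv_mul_cancel₀ (hV x (hMO hx)).ne']

variable [MeasurableSpace N] [BorelSpace N] (g : RiemMetric n N)

/-- The exponential of the convexified weight is e^{φ/h} e^{δφ²/2h}, and the second factor cancels
inside the Laplacian. -/
theorem conj_convexify (φ w : SmoothFn n N) (h δ : ℝ) :
    conj g (convexify φ δ) h (exp ((h⁻¹ * (δ / 2)) • (φ * φ)) * w) =
      exp ((h⁻¹ * (δ / 2)) • (φ * φ)) * conj g φ h w := by
  have h1 : h⁻¹ • convexify φ δ = h⁻¹ • φ + (h⁻¹ * (δ / 2)) • (φ * φ) := by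
    rw [convexify, smul_add, smul_smul]
  have h2 := exp_neg_mul_exp ((h⁻¹ * (δ / 2)) • (φ * φ))
  rw [conj, conj, h1, neg_add, exp_add, exp_add]
  have h3 : exp (-(h⁻¹ • φ)) * exp (-((h⁻¹ * (δ / 2)) • (φ * φ))) *
      (exp ((h⁻¹ * (δ / 2)) • (φ * φ)) * w) = exp (-(h⁻¹ • φ)) * w := by
    linear_combination (exp (-(h⁻¹ • φ)) * w) * h2
  rw [h3]
  ring

theorem gam_eq_zero_of_notMem_tsupport (u v : SmoothFn n N) {x : N} (h : x ∉ tsupport v) :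
    gam g u v x = 0 :=
  gamma_eq_zero_of_notMem_tsupport g h

theorem gam_gam_eq_zero_of_notMem_tsupport (u v w : SmoothFn n N) {x : N} (h : x ∉ tsupport v) :
    gam g w (gam g u v) x = 0 := by
  have h1 : (gam g u v : N → ℝ) =ᶠ[nhds x] (0 : SmoothFn n N) := by
    filter_upwards [(isClosed_tsupport v).isOpen_compl.mem_nhds h] with z hz
    exact gam_eq_zero_of_notMem_tsupport g u v hz
  rw [gam_congr_right g w (gam g u v) 0 h1, gam_zero_right]
  rfl

/-- The estimate for the convexified weight is applied to ηw with η = e^{Tφ²/2}. As 1 ≤ η is bounded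
independently of h, removing η costs only a constant. -/
theorem carleman_estimate {M O : Set N} (hM : IsClosed M) (hO : IsOpen O) (hMO : M ⊆ O)
    (φ : SmoothFn n N) (hφ : IsLimitingCarlemanWeight g O φ) :
    ∃ C > 0, ∃ h₀ > 0, ∀ h : ℝ, 0 < h → h < h₀ → ∀ w : SmoothFn n N, tsupport w ⊆ M →
      h ^ 2 * integ g (w * w) ≤ C ^ 2 * integ g (conj g φ h w * conj g φ h w) := by
  obtain ⟨κ, hκ⟩ := exists_inverse_on (gam g φ φ) hM hO hMO fun x hx => hφ.gamma_pos g hO hx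
  obtain ⟨V, hV⟩ : ∃ V, V = gam g φ φ := ⟨_, rfl⟩
  obtain ⟨ν, hν⟩ : ∃ ν, ν = (-2 : ℝ) • (κ * gam g φ V) := ⟨_, rfl⟩
  -- The coefficients have the form X + δY: μ = ν + δφν and q = Δφ + δ(φΔφ + V). Bounding X, Y and
  -- their Laplacians gives bounds uniform in δ ≤ 1.
  obtain ⟨K₀, hK₀, hb⟩ := exists_common_bound [ν, φ * ν, lap g ν, lap g (φ * ν), lap g φ,
    φ * lap g φ + V, lap g (lap g φ), lap g (φ * lap g φ + V), V, φ, κ * κ * gam g V V, κ * κ]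
  simp only [List.forall_mem_cons, List.not_mem_nil, false_imp_iff, implies_true, and_true] at hb
  obtain ⟨bν, bφν, bLν, bLφν, bLφ, bφLφ, bLLφ, bLφLφ, bV, bφ, bκV, bκ⟩ := hb
  -- The square of the bound 2K₀ for X + δY.
  obtain ⟨K, hKdef⟩ : ∃ K, K = 4 * K₀ ^ 2 := ⟨_, rfl⟩
  have hK : 1 ≤ K := by nlinarith
  have hK₀K : 2 * K₀ ≤ K := by nlinarith
  obtain ⟨T, hT⟩ : ∃ T, T = K * (7 * K ^ 2 + 1) := ⟨_, rfl⟩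
  have hTK : K ≤ T := by rw [hT]; nlinarith [sq_nonneg K]
  obtain ⟨E, hE⟩ := exists_bound (exp ((T / 2) • (φ * φ)))
  have hT0 : 0 < 2 * T * K₀ := by
    have : 0 < T := by linarith
    positivity
  -- E bounds η. The bound on h gives δK₀ < 1/2 for δ = Th, which keeps s = 1 + δφ at least 1/2.
  refine ⟨max E 1, by positivity, 1 / (2 * T * K₀), by positivity, fun h hh hhh w hw => ?_⟩
  have hhT : h * (2 * T * K₀) < 1 := by rwa [lt_div_iff₀ hT0] at hhh
  obtain ⟨δ, hδ⟩ : ∃ δ, δ = T * h := ⟨_, rfl⟩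
  have hδ0 : 0 ≤ δ := by rw [hδ]; exact mul_nonneg (by linarith) hh.le
  have hδK₀ : δ * K₀ ≤ 1 / 2 := by rw [hδ]; linarith
  have hδ1 : δ ≤ 1 := by nlinarith
  have hTh : T * h ≤ 1 / 2 := by rw [← hδ]; nlinarith
  have hKh : K * h ≤ 1 / 2 := (mul_le_mul_of_nonneg_right hTK hh.le).trans hTh
  have hh1 : h ≤ 1 := by nlinarith
  -- bounds for `X + δ Y`
  have hXY : ∀ {a b : ℝ}, |a| ≤ K₀ → |b| ≤ K₀ → |a + δ * b| ≤ 2 * K₀ := by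
    intro a b ha hb
    have : |δ * b| ≤ K₀ := by
      rw [abs_mul, abs_of_nonneg hδ0]
      exact (mul_le_of_le_one_left (abs_nonneg b) hδ1).trans hb
    exact (abs_add_le a (δ * b)).trans (by linarith)
  have hXY2 : ∀ {a b : ℝ}, |a| ≤ K₀ → |b| ≤ K₀ → (a + δ * b) ^ 2 ≤ K := by
    intro a b ha hb
    rw [← sq_abs, hKdef]
    nlinarith [hXY ha hb, abs_nonneg (a + δ * b)]
  have hc : h⁻¹ * (δ / 2) = T / 2 := by
    rw [hδ]; field_simp
  set η := exp ((T / 2) • (φ * φ)) with hη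
  have hη1 : ∀ x, 1 ≤ η x := fun x => Real.one_le_exp (by
    change 0 ≤ T / 2 * (φ x * φ x)
    exact mul_nonneg (by linarith) (mul_self_nonneg _))
  have hsupp : tsupport (η * w : SmoothFn n N) ⊆ M :=
    (tsupport_mul_subset_right (f := η) (g := w)).trans hw
  have hmain : h ^ 2 * integ g ((η * w) * (η * w)) ≤
      integ g (conj g (convexify φ δ) h (η * w) * conj g (convexify φ δ) h (η * w)) := by
    obtain ⟨u, hu⟩ : ∃ u, u = η * w := ⟨_, rfl⟩
    rw [← hu] at hsupp ⊢
    have hu0 : ∀ x, x ∉ M → u x = 0 := fun x hx =>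
      image_eq_zero_of_notMem_tsupport fun h' => hx (hsupp h')
    have hμ : (1 + δ • φ) * ((-2 : ℝ) • (κ * gam g φ V)) = ν + δ • (φ * ν) := by
      rw [← hν, add_mul, one_mul, smul_mul_assoc]
    have hq : (1 + δ • φ) * lap g φ + δ • V = lap g φ + δ • (φ * lap g φ + V) := by
      rw [add_mul, one_mul, smul_mul_assoc, smul_add, add_assoc]
    refine sq_mul_integ_le_integ_conj_sq g (κ := κ) hh hh1 hδ0 hK (by nlinarith)
      (by rw [hδ, hT]) ?_ ?_ (1 + δ • φ) V (ν + δ • (φ * ν)) (lap g φ + δ • (φ * lap g φ + V))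
      rfl hV hq.symm hμ.symm (fun x => ?_) (fun x => ?_) (fun x => hXY2 (bν x) (bφν x)) (fun x => ?_)
      (fun x => hXY2 (bLφ x) (bφLφ x)) (fun x => ?_) (fun x => ?_) (fun x => ?_)
    · ext x
      change hessForm g φ u x = -2 * (κ x * gam g φ (gam g φ φ) x) * gam g u u x +
        4 * (κ x * (gam g φ u x * gam g u (gam g φ φ) x))
      -- On the support of u the Hessian formula is divided by V, that is, multiplied by κ;
      -- elsewhere both sides vanish.
      by_cases hx : x ∈ tsupport u
      · have h1 := hessForm_of_isLimitingCarlemanWeight g φ u hO hφ (hMO (hsupp hx))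
        linear_combination κ x * h1 - hessForm g φ u x * hκ x (hsupp hx)
      · rw [hessForm_apply, gam_gam_eq_zero_of_notMem_tsupport g φ u u hx,
          gam_gam_eq_zero_of_notMem_tsupport g u u φ hx, gam_eq_zero_of_notMem_tsupport g φ u hx,
          gam_eq_zero_of_notMem_tsupport g u u hx]
        ring
    · ext x
      change κ x * gam g φ φ x * u x = u x
      by_cases hx : x ∈ M
      · rw [hκ x hx, one_mul]
      · rw [hu0 x hx, mul_zero]
    · have h1 : |δ * φ x| ≤ 1 / 2 := by
        rw [abs_mul, abs_of_nonneg hδ0]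
        exact (mul_le_mul_of_nonneg_left (bφ x) hδ0).trans hδK₀
      change 1 / 4 ≤ (1 + δ * φ x) ^ 2
      nlinarith [neg_le_of_abs_le h1]
    · have h1 : |δ * φ x| ≤ 1 / 2 := by
        rw [abs_mul, abs_of_nonneg hδ0]
        exact (mul_le_mul_of_nonneg_left (bφ x) hδ0).trans hδK₀
      have h2 : (1 + δ * φ x) ^ 2 ≤ 4 := by
        nlinarith [neg_le_of_abs_le h1, le_of_abs_le h1]
      have h3 : 0 ≤ V x := by rw [hV]; exact gam_self_nonneg g φ x
      change (1 + δ * φ x) ^ 2 * V x ≤ K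
      calc _ ≤ 4 * K₀ := mul_le_mul h2 (le_of_abs_le (bV x)) h3 (by norm_num)
        _ ≤ K := by rw [hKdef]; nlinarith
    · rw [map_add, map_smul]
      exact (hXY (bLν x) (bLφν x)).trans hK₀K
    · rw [map_add, map_smul]
      exact (hXY (bLLφ x) (bLφLφ x)).trans hK₀K
    · have := le_of_abs_le (bκ x)
      rw [sq]
      exact this.trans (by linarith)
    · have := le_of_abs_le (bκV x)
      rw [sq]
      exact this.trans (by linarith)
  have hcv := conj_convexify g φ w h δ
  rw [hc, ← hη] at hcv
  rw [hcv] at hmain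
  have h1 : integ g (w * w) ≤ integ g ((η * w) * (η * w)) := integ_mono g fun x => by
    change w x * w x ≤ (η x * w x) * (η x * w x)
    nlinarith [mul_self_nonneg (w x), mul_le_mul (hη1 x) (hη1 x) zero_le_one (by linarith [hη1 x])]
  have h2 : integ g ((η * conj g φ h w) * (η * conj g φ h w)) ≤
      (max E 1) ^ 2 * integ g (conj g φ h w * conj g φ h w) := by
    rw [← smul_eq_mul (max E 1 ^ 2), ← map_smul]
    refine integ_mono g fun x => ?_
    change (η x * conj g φ h w x) * (η x * conj g φ h w x) ≤
      (max E 1) ^ 2 * (conj g φ h w x * conj g φ h w x)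
    have h3 : η x ≤ max E 1 := (le_of_abs_le (hE x)).trans (le_max_left _ _)
    have h4 : η x ^ 2 ≤ (max E 1) ^ 2 := pow_le_pow_left₀ (by linarith [hη1 x]) h3 2
    nlinarith [mul_le_mul_of_nonneg_right h4 (mul_self_nonneg (conj g φ h w x))]
  exact (mul_le_mul_of_nonneg_left h1 (sq_nonneg h)).trans (hmain.trans h2)

end SmoothFn
end

/-! ### Two-sided inverses in Hilbert space from a priori estimates -/

section
variable {D E : Type*} [AddCommGroup D] [Module ℂ D] [NormedAddCommGroup E] [InnerProductSpace ℂ E]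
  [CompleteSpace E]

/-- The operator that inverts `P` on the closure of its range, relative to the embedding `j`, and
vanishes on the orthogonal complement of the range. -/
noncomputable def rangeInverse (j P : D →ₗ[ℂ] E) : E →L[ℂ] E :=
  (j.extendOfNorm (P.codRestrict P.range.topologicalClosure
      fun x => P.range.le_topologicalClosure ⟨x, rfl⟩)).comp
    P.range.topologicalClosure.orthogonalProjectionOnto

/-- The orthogonal projection to the closure of the range. -/
noncomputable def rangeProj (P : D →ₗ[ℂ] E) : E →L[ℂ] E :=
  P.range.topologicalClosure.starProjection

/-- The two-sided inverse of `P` built from the inverses on the ranges of `P` and of its formal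
adjoint `P'`. -/
noncomputable def greenOperator (j P P' : D →ₗ[ℂ] E) : E →L[ℂ] E :=
  rangeInverse j P + (ContinuousLinearMap.adjoint (rangeInverse j P')).comp
    (ContinuousLinearMap.id ℂ E - rangeProj P)

variable {j P P' : D →ₗ[ℂ] E} {c : ℝ}

theorem denseRange_codRestrict_range (P : D →ₗ[ℂ] E) :
    DenseRange (P.codRestrict P.range.topologicalClosure
      fun x => P.range.le_topologicalClosure ⟨x, rfl⟩) := by
  intro z
  rw [closure_subtype]
  refine closure_mono ?_ z.2
  rintro _ ⟨x, rfl⟩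
  exact ⟨_, ⟨x, rfl⟩, rfl⟩

/-- The estimate makes Px ↦ jx well defined and bounded on the range, hence extendable to its
closure. -/
theorem rangeInverse_apply_apply (h : ∀ x, ‖j x‖ ≤ c * ‖P x‖) (x : D) :
    rangeInverse j P (P x) = j x := by
  have hx : P x ∈ P.range.topologicalClosure := P.range.le_topologicalClosure ⟨x, rfl⟩
  have h1 := Submodule.orthogonalProjectionOnto_mem_subspace_eq_self
    (K := P.range.topologicalClosure) ⟨P x, hx⟩
  rw [rangeInverse, ContinuousLinearMap.comp_apply]
  have h2 : P.range.topologicalClosure.orthogonalProjectionOnto (P x) =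
      (P.codRestrict P.range.topologicalClosure
        fun x => P.range.le_topologicalClosure ⟨x, rfl⟩) x := h1
  rw [h2]
  exact LinearMap.extendOfNorm_eq (denseRange_codRestrict_range P) ⟨c, h⟩ x

theorem norm_rangeInverse_le (hc : 0 ≤ c) (h : ∀ x, ‖j x‖ ≤ c * ‖P x‖) :
    ‖rangeInverse j P‖ ≤ c := by
  refine (ContinuousLinearMap.opNorm_comp_le _ _).trans ?_
  have h1 := LinearMap.opNorm_extendOfNorm_le (denseRange_codRestrict_range P) hc h
  calc _ ≤ c * 1 := mul_le_mul h1 (Submodule.orthogonalProjectionOnto_norm_le _)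
        (ContinuousLinearMap.opNorm_nonneg _) hc
    _ = c := mul_one c

theorem rangeInverse_rangeProj (j P : D →ₗ[ℂ] E) (z : E) :
    rangeInverse j P (rangeProj P z) = rangeInverse j P z := by
  rw [rangeInverse, ContinuousLinearMap.comp_apply, ContinuousLinearMap.comp_apply, rangeProj,
    Submodule.starProjection_apply, Submodule.orthogonalProjectionOnto_mem_subspace_eq_self]

theorem rangeProj_apply_apply (P : D →ₗ[ℂ] E) (x : D) : rangeProj P (P x) = P x :=
  Submodule.starProjection_eq_self_iff.2 (P.range.le_topologicalClosure ⟨x, rfl⟩)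

theorem adjoint_rangeProj (P : D →ₗ[ℂ] E) :
    ContinuousLinearMap.adjoint (rangeProj P) = rangeProj P :=
  (isSelfAdjoint_starProjection _).adjoint_eq

theorem greenOperator_apply_apply (h : ∀ x, ‖j x‖ ≤ c * ‖P x‖) (x : D) :
    greenOperator j P P' (P x) = j x := by
  simp [greenOperator, rangeInverse_apply_apply h, rangeProj_apply_apply]

theorem norm_greenOperator_le (hc : 0 ≤ c) (h : ∀ x, ‖j x‖ ≤ c * ‖P x‖)
    (h' : ∀ x, ‖j x‖ ≤ c * ‖P' x‖) : ‖greenOperator j P P'‖ ≤ 2 * c := by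
  have h1 : ‖ContinuousLinearMap.id ℂ E - rangeProj P‖ ≤ 1 := by
    have : ContinuousLinearMap.id ℂ E - rangeProj P =
        (P.range.topologicalClosure)ᗮ.starProjection := by
      rw [Submodule.starProjection_orthogonal]; rfl
    rw [this]
    exact Submodule.starProjection_norm_le _
  refine (norm_add_le _ _).trans ?_
  have h2 := (ContinuousLinearMap.opNorm_comp_le (ContinuousLinearMap.adjoint (rangeInverse j P'))
    (ContinuousLinearMap.id ℂ E - rangeProj P)).trans
      (mul_le_mul ((LinearIsometryEquiv.norm_map _ _).le.trans (norm_rangeInverse_le hc h')) h1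
        (norm_nonneg _) hc)
  linarith [norm_rangeInverse_le hc h]

/-- On a = Px and b = P'y the two forms are ⟨Px, jy⟩ and ⟨jx, P'y⟩, equal by formal adjointness;
continuity extends this to the closures of the ranges. -/
theorem rangeProj_rangeInverse (h : ∀ x, ‖j x‖ ≤ c * ‖P x‖) (h' : ∀ x, ‖j x‖ ≤ c * ‖P' x‖)
    (hadj : ∀ x y, inner ℂ (P x) (j y) = inner ℂ (j x) (P' y)) :
    (rangeProj P).comp (rangeInverse j P') =
      (ContinuousLinearMap.adjoint (rangeInverse j P)).comp (rangeProj P') := by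
  -- it suffices to compare both sides as sesquilinear forms on the two ranges
  have key : ∀ a ∈ P.range.topologicalClosure, ∀ b ∈ P'.range.topologicalClosure,
      inner ℂ a (rangeInverse j P' b) = inner ℂ (rangeInverse j P a) b := by
    intro a ha b hb
    have hcl : IsClosed {q : E × E | inner ℂ q.1 (rangeInverse j P' q.2) =
        inner ℂ (rangeInverse j P q.1) q.2} := isClosed_eq (by fun_prop) (by fun_prop)
    have hsub : (P.range : Set E) ×ˢ (P'.range : Set E) ⊆ {q : E × E |
        inner ℂ q.1 (rangeInverse j P' q.2) = inner ℂ (rangeInverse j P q.1) q.2} := by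
      rintro ⟨_, _⟩ ⟨⟨x, rfl⟩, ⟨y, rfl⟩⟩
      change inner ℂ (P x) (rangeInverse j P' (P' y)) = inner ℂ (rangeInverse j P (P x)) (P' y)
      rw [rangeInverse_apply_apply h, rangeInverse_apply_apply h', hadj]
    have hmem : (a, b) ∈ closure ((P.range : Set E) ×ˢ (P'.range : Set E)) := by
      rw [closure_prod_eq]
      exact ⟨ha, hb⟩
    exact closure_minimal hsub hcl hmem
  refine ContinuousLinearMap.ext fun z => ext_inner_left ℂ fun a => ?_
  rw [ContinuousLinearMap.comp_apply, ContinuousLinearMap.comp_apply,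
    ContinuousLinearMap.adjoint_inner_right, ← rangeInverse_rangeProj j P' z,
    ← rangeInverse_rangeProj j P a, ← key (rangeProj P a) (Submodule.starProjection_apply_mem _ _)
      (rangeProj P' z) (Submodule.starProjection_apply_mem _ _)]
  conv_rhs => rw [← adjoint_rangeProj P, ContinuousLinearMap.adjoint_inner_left]

/-- With R, R' the range inverses and π, π' the projections, the adjoint is R* + (1 - π)R'. It
equals R' + R*(1 - π') because πR' = R*π'. -/
theorem adjoint_greenOperator (h : ∀ x, ‖j x‖ ≤ c * ‖P x‖) (h' : ∀ x, ‖j x‖ ≤ c * ‖P' x‖)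
    (hadj : ∀ x y, inner ℂ (P x) (j y) = inner ℂ (j x) (P' y)) :
    ContinuousLinearMap.adjoint (greenOperator j P P') = greenOperator j P' P := by
  have key := rangeProj_rangeInverse h h' hadj
  rw [greenOperator, greenOperator, map_add, ContinuousLinearMap.adjoint_comp,
    ContinuousLinearMap.adjoint_adjoint, map_sub, adjoint_rangeProj, ContinuousLinearMap.sub_comp,
    ContinuousLinearMap.comp_sub, ← key]
  have : ContinuousLinearMap.adjoint (ContinuousLinearMap.id ℂ E) = ContinuousLinearMap.id ℂ E :=
    ContinuousLinearMap.adjoint_id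
  rw [this, ContinuousLinearMap.id_comp, ContinuousLinearMap.comp_id]
  abel

/-- The weak right inverse property, dual to the left inverse property of the adjoint. -/
theorem inner_greenOperator (h' : ∀ x, ‖j x‖ ≤ c * ‖P' x‖) (h : ∀ x, ‖j x‖ ≤ c * ‖P x‖)
    (hadj : ∀ x y, inner ℂ (P x) (j y) = inner ℂ (j x) (P' y)) (x : D) (v : E) :
    inner ℂ (P' x) (greenOperator j P P' v) = inner ℂ (j x) v := by
  rw [← ContinuousLinearMap.adjoint_inner_left, adjoint_greenOperator h h' hadj,
    greenOperator_apply_apply h']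

end

/-! ### Complex functions and their classes in L² -/

section
variable {n : ℕ} {N : Type*} [TopologicalSpace N] [ChartedSpace (Coord n) N]

/-- The composition of a smooth complex function with a real linear form. -/
noncomputable def SmoothFn.ofComplex (ℓ : ℂ →L[ℝ] ℝ) (w : N → ℂ)
    (hw : ContMDiff (𝓡 n) 𝓘(ℝ, ℂ) ∞ w) : SmoothFn n N :=
  ⟨fun x => ℓ (w x), ℓ.contDiff.contMDiff.comp hw⟩

theorem tsupport_ofComplex_subset (ℓ : ℂ →L[ℝ] ℝ) (w : N → ℂ)
    (hw : ContMDiff (𝓡 n) 𝓘(ℝ, ℂ) ∞ w) : tsupport (SmoothFn.ofComplex ℓ w hw) ⊆ tsupport w :=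
  closure_mono (Function.support_comp_subset (map_zero ℓ) w)

theorem map_pderiv (ℓ : ℂ →L[ℝ] ℝ) {f : Coord n → ℂ} {y : Coord n} (hf : DifferentiableAt ℝ f y)
    (i : Fin n) : ℓ (pderiv i f y) = pderiv i (fun z => ℓ (f z)) y := by
  have := (ℓ.hasFDerivAt.comp y hf.hasFDerivAt).fderiv
  change _ = fderiv ℝ (ℓ ∘ f) y (stdVec i)
  rw [this]
  rfl

theorem map_ofReal_mul (ℓ : ℂ →L[ℝ] ℝ) (a : ℝ) (z : ℂ) : ℓ ((a : ℂ) * z) = a * ℓ z := by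
  rw [← Complex.real_smul, map_smul, smul_eq_mul]

variable [IsManifold (𝓡 n) ∞ N] (g : RiemMetric n N)

/-- The coefficients are real, so the operator commutes with real linear forms. With real and
imaginary parts this reduces the complex case to the real calculus. -/
theorem map_laplacian (ℓ : ℂ →L[ℝ] ℝ) {w : N → ℂ} (hw : ContMDiff (𝓡 n) 𝓘(ℝ, ℂ) ∞ w) (x : N) :
    ℓ (laplacian g w x) = realLaplacian g (fun z => ℓ (w z)) x := by
  have he := IsManifold.chart_mem_maximalAtlas (I := 𝓡 n) (n := ∞) x
  have hy := mem_chartAt_target (n := n) x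
  rw [realLaplacian, chartLaplacian, laplacian]
  set e := chartAt (Coord n) x
  have hf : ContDiffOn ℝ ∞ (fun z => w (e.symm z)) e.target := by
    rw [← contMDiffOn_iff_contDiffOn]
    exact hw.comp_contMDiffOn (contMDiffOn_symm_of_mem_maximalAtlas he)
  have hdf : ∀ j, ContDiffOn ℝ ∞ (pderiv j fun z => w (e.symm z)) e.target := fun j =>
    (hf.fderiv_of_isOpen e.open_target (m := ∞) (by simp)).clm_apply contDiffOn_const
  have hF : ∀ i, ContDiffOn ℝ ∞ (fun y => ((volDensity g e y : ℝ) : ℂ) *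
      ∑ j, ((metricInv g e y i j : ℝ) : ℂ) * pderiv j (fun z => w (e.symm z)) y) e.target := fun i =>
    (Complex.ofRealCLM.contDiff.comp_contDiffOn (contDiffOn_volDensity g he)).mul
      (ContDiffOn.sum fun j _ =>
        (Complex.ofRealCLM.contDiff.comp_contDiffOn (contDiffOn_metricInv g he i j)).mul (hdf j))
  rw [map_ofReal_mul, map_sum]
  congr 1
  refine Finset.sum_congr rfl fun i _ => ?_
  rw [map_pderiv ℓ (((hF i).contDiffAt (e.open_target.mem_nhds hy)).differentiableAt (by simp))]
  have hev : (fun y => ℓ (((volDensity g e y : ℝ) : ℂ) *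
      ∑ j, ((metricInv g e y i j : ℝ) : ℂ) * pderiv j (fun z => w (e.symm z)) y)) =ᶠ[nhds (e x)]
      chartFlux g e (fun z => ℓ (w z)) i := by
    filter_upwards [e.open_target.mem_nhds hy] with y hy'
    rw [map_ofReal_mul, map_sum, chartFlux]
    congr 1
    refine Finset.sum_congr rfl fun j _ => ?_
    rw [map_ofReal_mul, map_pderiv ℓ
      ((hf.contDiffAt (e.open_target.mem_nhds hy')).differentiableAt (by simp))]
    rfl
  rw [pderiv, pderiv, hev.fderiv_eq]

theorem realLaplacian_eq_zero_of_notMem_tsupport {u : N → ℝ} {x : N} (h : x ∉ tsupport u) :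
    realLaplacian g u x = 0 := by
  have hy := mem_chartAt_target (n := n) x
  rw [realLaplacian, chartLaplacian]
  set e := chartAt (Coord n) x
  have h1 : ∀ᶠ z in nhds (e x), e.symm z ∉ tsupport u := by
    have := e.continuousAt_symm hy
    rw [ContinuousAt, chartAt_symm_self] at this
    exact this.eventually ((isClosed_tsupport u).isOpen_compl.mem_nhds h)
  have h2 : (fun z => u (e.symm z)) =ᶠ[nhds (e x)] fun _ => 0 := by
    filter_upwards [h1] with z hz using image_eq_zero_of_notMem_tsupport hz
  have h3 : ∀ i, chartFlux g e u i =ᶠ[nhds (e x)] fun _ => 0 := fun i => by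
    filter_upwards [h2.eventuallyEq_nhds] with z hz
    simp [chartFlux, chartGrad, pderiv, hz.fderiv_eq]
  simp [pderiv, (h3 _).fderiv_eq]

theorem ContMDiff.ofReal_mul {a : N → ℝ} {w : N → ℂ} (ha : ContMDiff (𝓡 n) 𝓘(ℝ, ℝ) ∞ a)
    (hw : ContMDiff (𝓡 n) 𝓘(ℝ, ℂ) ∞ w) :
    ContMDiff (𝓡 n) 𝓘(ℝ, ℂ) ∞ fun x => (a x : ℂ) * w x := by
  simp only [← Complex.real_smul]
  exact ha.smul hw

variable [T2Space N] [CompactSpace N] [MeasurableSpace N] [BorelSpace N]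

-- Both sides vanish off the support of w, so the values of φ away from M are irrelevant.
open SmoothFn in
theorem map_conjOp (ℓ : ℂ →L[ℝ] ℝ) {M O : Set N} {φ : N → ℝ} {ψ : SmoothFn n N}
    (hMO : M ⊆ O) (hφ : EqOn φ ψ O) (h : ℝ) {w : N → ℂ} (hw : ContMDiff (𝓡 n) 𝓘(ℝ, ℂ) ∞ w)
    (hs : tsupport w ⊆ M) (x : N) :
    ℓ (conjOp g φ h w x) = conj g ψ h (ofComplex ℓ w hw) x := by
  have h1 : (fun z => (Real.exp (-(φ z) / h) : ℂ) * w z) =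
      fun z => ((exp (-(h⁻¹ • ψ)) z : ℝ) : ℂ) * w z := by
    ext z
    by_cases hz : z ∈ tsupport w
    · rw [hφ (hMO (hs hz)), exp_apply]
      congr 3
      change _ = -(h⁻¹ * ψ z)
      rw [neg_div, div_eq_inv_mul]
    · rw [image_eq_zero_of_notMem_tsupport hz, mul_zero, mul_zero]
  have h2 : (fun z => ℓ (((exp (-(h⁻¹ • ψ)) z : ℝ) : ℂ) * w z)) =
      ⇑(exp (-(h⁻¹ • ψ)) * ofComplex ℓ w hw) := by
    ext z
    rw [map_ofReal_mul]
    rfl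
  have h3 : ℓ (-((h : ℂ) ^ 2) * laplacian g (fun z => (Real.exp (-(φ z) / h) : ℂ) * w z) x) =
      -h ^ 2 * lap g (exp (-(h⁻¹ • ψ)) * ofComplex ℓ w hw) x := by
    have : -((h : ℂ) ^ 2) = ((-h ^ 2 : ℝ) : ℂ) := by push_cast; ring
    rw [this, map_ofReal_mul, h1, map_laplacian g ℓ ((exp (-(h⁻¹ • ψ))).contMDiff.ofReal_mul hw), h2]
    rfl
  rw [conjOp, map_ofReal_mul, h3]
  change _ = Real.exp (h⁻¹ * ψ x) * (-h ^ 2 * lap g (exp (-(h⁻¹ • ψ)) * ofComplex ℓ w hw) x)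
  by_cases hx : x ∈ tsupport w
  · rw [hφ (hMO (hs hx)), div_eq_inv_mul]
  · have h4 : lap g (exp (-(h⁻¹ • ψ)) * ofComplex ℓ w hw) x = 0 := by
      refine realLaplacian_eq_zero_of_notMem_tsupport g fun h' => hx ?_
      exact tsupport_ofComplex_subset ℓ w hw
        (tsupport_mul_subset_right (f := exp (-(h⁻¹ • ψ))) (g := ofComplex ℓ w hw) h')
    rw [h4, mul_zero, mul_zero, mul_zero]

namespace SmoothFn

theorem conj_eq_zero_of_notMem_tsupport (ψ u : SmoothFn n N) (h : ℝ) {x : N} (hx : x ∉ tsupport u) :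
    conj g ψ h u x = 0 := by
  have h4 : lap g (exp (-(h⁻¹ • ψ)) * u) x = 0 :=
    realLaplacian_eq_zero_of_notMem_tsupport g fun h' =>
      hx (tsupport_mul_subset_right (f := exp (-(h⁻¹ • ψ))) (g := u) h')
  change exp (h⁻¹ • ψ) x * (-h ^ 2 * lap g (exp (-(h⁻¹ • ψ)) * u) x) = 0
  rw [h4, mul_zero, mul_zero]

theorem conj_add (ψ u v : SmoothFn n N) (h : ℝ) :
    conj g ψ h (u + v) = conj g ψ h u + conj g ψ h v := by
  rw [conj, mul_add, map_add, smul_add, mul_add]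
  rfl

theorem conj_smul (ψ u : SmoothFn n N) (h c : ℝ) : conj g ψ h (c • u) = c • conj g ψ h u := by
  rw [conj, conj, mul_smul_comm (_) (exp (-(h⁻¹ • ψ))), map_smul, smul_comm, mul_smul_comm]

/-- The complex function with given real and imaginary parts. -/
noncomputable def cplx (a b : SmoothFn n N) (x : N) : ℂ := ⟨a x, b x⟩

theorem continuous_cplx (a b : SmoothFn n N) : Continuous (cplx a b) := by
  have : cplx a b = fun x => (a x : ℂ) + (b x : ℂ) * Complex.I := by
    ext x
    rw [← Complex.mk_eq_add_mul_I]
    rfl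
  rw [this]
  have ha := a.contMDiff.continuous
  have hb := b.contMDiff.continuous
  fun_prop

theorem memLp_cplx (M : Set N) (a b : SmoothFn n N) :
    MemLp (cplx a b) 2 ((riemVolume g).restrict M) :=
  (continuous_cplx a b).memLp_of_hasCompactSupport (HasCompactSupport.of_compactSpace _)

/-- The element of `L²(M)` with given real and imaginary parts. -/
noncomputable def toL2 (M : Set N) (a b : SmoothFn n N) : L2 g M := (memLp_cplx g M a b).toLp

theorem coeFn_toL2 (M : Set N) (a b : SmoothFn n N) :
    toL2 g M a b =ᵐ[(riemVolume g).restrict M] cplx a b := MemLp.coeFn_toLp _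

/-- Vanishing of one factor off M turns the integral over M into one over N, where Green's formula
has no boundary terms. -/
theorem inner_toL2 {M : Set N} (a b a' b' : SmoothFn n N) (ha : ∀ x ∉ M, a x = 0)
    (hb : ∀ x ∉ M, b x = 0) : inner ℂ (toL2 g M a b) (toL2 g M a' b') =
      (⟨integ g (a * a' + b * b'), integ g (a * b' - b * a')⟩ : ℂ) := by
  rw [MeasureTheory.L2.inner_def]
  have h1 : (fun x => inner ℂ (toL2 g M a b x) (toL2 g M a' b' x))
      =ᵐ[(riemVolume g).restrict M] cplx (a * a' + b * b') (a * b' - b * a') := by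
    filter_upwards [coeFn_toL2 g M a b, coeFn_toL2 g M a' b'] with x hx hx'
    rw [hx, hx']
    apply Complex.ext
    · change (inner ℂ (cplx a b x) (cplx a' b' x) : ℂ).re = a x * a' x + b x * b' x
      simp [cplx]
      ring
    · change (inner ℂ (cplx a b x) (cplx a' b' x) : ℂ).im = a x * b' x - b x * a' x
      simp [cplx]
      ring
  rw [integral_congr_ae h1, setIntegral_eq_integral_of_forall_compl_eq_zero]
  · have hi := (continuous_cplx (a * a' + b * b') (a * b' - b * a')).integrable_riemVolume g
    apply Complex.ext
    · exact (Complex.reCLM.integral_comp_comm hi).symm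
    · exact (Complex.imCLM.integral_comp_comm hi).symm
  · intro x hx
    apply Complex.ext
    · change a x * a' x + b x * b' x = 0
      rw [ha x hx, hb x hx]; ring
    · change a x * b' x - b x * a' x = 0
      rw [ha x hx, hb x hx]; ring

theorem norm_toL2_sq {M : Set N} (a b : SmoothFn n N) (ha : ∀ x ∉ M, a x = 0)
    (hb : ∀ x ∉ M, b x = 0) : ‖toL2 g M a b‖ ^ 2 = integ g (a * a) + integ g (b * b) := by
  have h1 := inner_self_eq_norm_sq (𝕜 := ℂ) (toL2 g M a b)
  rw [inner_toL2 g a b a b ha hb] at h1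
  rw [← h1, ← map_add]
  rfl

theorem toL2_add (M : Set N) (a b a' b' : SmoothFn n N) :
    toL2 g M (a + a') (b + b') = toL2 g M a b + toL2 g M a' b' := by
  rw [toL2, toL2, toL2, ← MemLp.toLp_add]
  rfl

theorem toL2_smul (M : Set N) (a b : SmoothFn n N) (c : ℂ) :
    toL2 g M (c.re • a + (-c.im) • b) (c.re • b + c.im • a) = c • toL2 g M a b := by
  rw [toL2, toL2, ← MemLp.toLp_const_smul]
  congr 1
  ext x
  apply Complex.ext
  · change c.re * a x + -c.im * b x = (c * cplx a b x).re
    simp [cplx]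
    ring
  · change c.re * b x + c.im * a x = (c * cplx a b x).im
    simp [cplx]

end SmoothFn
end

/-! ### Test functions and the conjugated operator in L²(M) -/

section
variable {n : ℕ} {N : Type*} [TopologicalSpace N] [ChartedSpace (Coord n) N]

/-- The space of complex test functions on the interior of `M`. -/
def testSpace (n : ℕ) {N : Type*} [TopologicalSpace N] [ChartedSpace (Coord n) N] (M : Set N) :
    Submodule ℂ (N → ℂ) where
  carrier := testFunctions n M
  zero_mem' := ⟨contMDiff_const, HasCompactSupport.zero, by simp⟩
  add_mem' := fun {u v} hu hv => ⟨hu.1.add hv.1, hu.2.1.add hv.2.1,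
    (tsupport_add u v).trans (union_subset hu.2.2 hv.2.2)⟩
  smul_mem' := fun c u hu => ⟨(ContinuousLinearMap.mul ℝ ℂ c).contDiff.contMDiff.comp hu.1, hu.2.1.mul_left,
    (tsupport_mul_subset_right (f := fun _ => c) (g := u)).trans hu.2.2⟩

namespace testSpace
variable {M : Set N} (w : testSpace n M)

theorem contMDiff : ContMDiff (𝓡 n) 𝓘(ℝ, ℂ) ∞ (w : N → ℂ) := w.2.1

theorem tsupport_subset : tsupport (w : N → ℂ) ⊆ M := w.2.2.2.trans interior_subset

/-- The real part of a test function. -/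
noncomputable def re : SmoothFn n N := SmoothFn.ofComplex Complex.reCLM w (testSpace.contMDiff w)

/-- The imaginary part of a test function. -/
noncomputable def im : SmoothFn n N := SmoothFn.ofComplex Complex.imCLM w (testSpace.contMDiff w)

theorem tsupport_re_subset : tsupport (testSpace.re w) ⊆ M :=
  (tsupport_ofComplex_subset _ _ _).trans (testSpace.tsupport_subset w)

theorem tsupport_im_subset : tsupport (testSpace.im w) ⊆ M :=
  (tsupport_ofComplex_subset _ _ _).trans (testSpace.tsupport_subset w)

theorem re_apply_eq_zero (x : N) (hx : x ∉ M) : (testSpace.re w) x = 0 :=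
  image_eq_zero_of_notMem_tsupport fun h => hx ((testSpace.tsupport_re_subset w) h)

theorem im_apply_eq_zero (x : N) (hx : x ∉ M) : (testSpace.im w) x = 0 :=
  image_eq_zero_of_notMem_tsupport fun h => hx ((testSpace.tsupport_im_subset w) h)

theorem re_add (w' : testSpace n M) : testSpace.re (w + w') = (testSpace.re w) + (testSpace.re w') := rfl

theorem im_add (w' : testSpace n M) : testSpace.im (w + w') = (testSpace.im w) + (testSpace.im w') := rfl

theorem re_smul (c : ℂ) : testSpace.re (c • w) = c.re • (testSpace.re w) + (-c.im) • (testSpace.im w) := by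
  ext x
  change (c * (w : N → ℂ) x).re = c.re * ((w : N → ℂ) x).re + -c.im * ((w : N → ℂ) x).im
  simp
  ring

theorem im_smul (c : ℂ) : testSpace.im (c • w) = c.re • (testSpace.im w) + c.im • (testSpace.re w) := by
  ext x
  change (c * (w : N → ℂ) x).im = c.re * ((w : N → ℂ) x).im + c.im * ((w : N → ℂ) x).re
  simp

end testSpace

variable [IsManifold (𝓡 n) ∞ N] [T2Space N] [CompactSpace N] [MeasurableSpace N] [BorelSpace N]
  (g : RiemMetric n N) (M : Set N)

open SmoothFn

/-- The embedding of the test functions into `L²(M)`. -/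
noncomputable def testToL2 : testSpace n M →ₗ[ℂ] L2 g M where
  toFun w := toL2 g M (testSpace.re w) (testSpace.im w)
  map_add' w w' := by rw [testSpace.re_add, testSpace.im_add, toL2_add]
  map_smul' c w := by rw [testSpace.re_smul, testSpace.im_smul, toL2_smul, RingHom.id_apply]

/-- The conjugated operator with a globally smooth weight on test functions. -/
noncomputable def smoothConjOp (ψ : SmoothFn n N) (h : ℝ) : testSpace n M →ₗ[ℂ] L2 g M where
  toFun w := toL2 g M (conj g ψ h (testSpace.re w)) (conj g ψ h (testSpace.im w))
  map_add' w w' := by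
    rw [testSpace.re_add, testSpace.im_add, conj_add, conj_add, toL2_add]
  map_smul' c w := by
    rw [testSpace.re_smul, testSpace.im_smul, conj_add, conj_add, conj_smul, conj_smul, conj_smul,
      conj_smul, toL2_smul, RingHom.id_apply]

/-- `ψ` is a globally smooth function that agrees with `φ` near `M`. -/
def ExtendsNear (φ : N → ℝ) (ψ : SmoothFn n N) : Prop :=
  ∃ O : Set N, IsOpen O ∧ M ⊆ O ∧ EqOn φ ψ O

open Classical in
/-- The conjugated operator with a weight that is smooth near `M`, on test functions. -/
noncomputable def weightConjOp (φ : N → ℝ) (h : ℝ) : testSpace n M →ₗ[ℂ] L2 g M :=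
  -- The zero branch only makes the operator total in φ; the choice of extension is immaterial by
  -- `ExtendsNear.weightConjOp_eq`.
  if H : ∃ ψ, ExtendsNear (n := n) M φ ψ then smoothConjOp g M H.choose h else 0

variable {M} {φ : N → ℝ} {ψ : SmoothFn n N}

theorem ExtendsNear.neg (hψ : ExtendsNear M φ ψ) : ExtendsNear M (-φ) (-ψ) := by
  obtain ⟨O, hO, hMO, hE⟩ := hψ
  refine ⟨O, hO, hMO, fun x hx => ?_⟩
  change -φ x = -ψ x
  rw [hE hx]

theorem ExtendsNear.conjOp_eq (hψ : ExtendsNear M φ ψ) (h : ℝ) (w : testSpace n M) :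
    conjOp g φ h w = cplx (conj g ψ h (testSpace.re w)) (conj g ψ h (testSpace.im w)) := by
  obtain ⟨O, hO, hMO, hE⟩ := hψ
  ext x
  apply Complex.ext
  · exact map_conjOp g Complex.reCLM hMO hE h (testSpace.contMDiff w) (testSpace.tsupport_subset w) x
  · exact map_conjOp g Complex.imCLM hMO hE h (testSpace.contMDiff w) (testSpace.tsupport_subset w) x

theorem coeFn_smoothConjOp (ψ : SmoothFn n N) (h : ℝ) (w : testSpace n M) :
    smoothConjOp g M ψ h w =ᵐ[(riemVolume g).restrict M]
      cplx (conj g ψ h (testSpace.re w)) (conj g ψ h (testSpace.im w)) :=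
  coeFn_toL2 g M _ _

/-- Every extension gives the function `conjOp g φ h w`, which depends on φ alone. -/
theorem ExtendsNear.weightConjOp_eq (hψ : ExtendsNear M φ ψ) (h : ℝ) :
    weightConjOp g M φ h = smoothConjOp g M ψ h := by
  have H : ∃ ψ, ExtendsNear (n := n) M φ ψ := ⟨ψ, hψ⟩
  refine LinearMap.ext fun w => ?_
  rw [weightConjOp, dif_pos H]
  refine Lp.ext ((coeFn_smoothConjOp g _ h w).trans ?_)
  rw [← H.choose_spec.conjOp_eq g h w, hψ.conjOp_eq g h w]
  exact (coeFn_smoothConjOp g ψ h w).symm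

theorem coeFn_testToL2 (w : testSpace n M) :
    testToL2 g M w =ᵐ[(riemVolume g).restrict M] w :=
  coeFn_toL2 g M _ _

/-- With real coefficients the formal adjoint is the transpose, given by `integ_mul_conj`. -/
theorem inner_smoothConjOp (ψ : SmoothFn n N) (h : ℝ) (w w' : testSpace n M) :
    inner ℂ (smoothConjOp g M ψ h w) (testToL2 g M w') =
      inner ℂ (testToL2 g M w) (smoothConjOp g M (-ψ) h w') := by
  have hz : ∀ u : SmoothFn n N, tsupport u ⊆ M → ∀ x ∉ M, conj g ψ h u x = 0 := fun u hu x hx =>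
    conj_eq_zero_of_notMem_tsupport g ψ u h fun h' => hx (hu h')
  change inner ℂ (toL2 g M _ _) (toL2 g M _ _) = inner ℂ (toL2 g M _ _) (toL2 g M _ _)
  rw [inner_toL2 g _ _ _ _ (hz _ (testSpace.tsupport_re_subset w)) (hz _ (testSpace.tsupport_im_subset w)),
    inner_toL2 g _ _ _ _ (testSpace.re_apply_eq_zero w) (testSpace.im_apply_eq_zero w)]
  have key : ∀ u v : SmoothFn n N, integ g (conj g ψ h u * v) = integ g (u * conj g (-ψ) h v) :=
    fun u v => by rw [mul_comm, integ_mul_conj]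
  simp only [map_add, map_sub, key]

theorem norm_testToL2_le {C h : ℝ} (hC : 0 < C) (hh : 0 < h) (ψ : SmoothFn n N)
    (hest : ∀ w : SmoothFn n N, tsupport w ⊆ M →
      h ^ 2 * integ g (w * w) ≤ C ^ 2 * integ g (conj g ψ h w * conj g ψ h w))
    (w : testSpace n M) : ‖testToL2 g M w‖ ≤ C / h * ‖smoothConjOp g M ψ h w‖ := by
  have hz : ∀ u : SmoothFn n N, tsupport u ⊆ M → ∀ x ∉ M, conj g ψ h u x = 0 := fun u hu x hx =>
    conj_eq_zero_of_notMem_tsupport g ψ u h fun h' => hx (hu h')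
  have h1 : ‖testToL2 g M w‖ ^ 2 = _ := norm_toL2_sq g _ _ (testSpace.re_apply_eq_zero w) (testSpace.im_apply_eq_zero w)
  have h2 : ‖smoothConjOp g M ψ h w‖ ^ 2 = _ :=
    norm_toL2_sq g _ _ (hz _ (testSpace.tsupport_re_subset w)) (hz _ (testSpace.tsupport_im_subset w))
  have h3 : (h * ‖testToL2 g M w‖) ^ 2 ≤ (C * ‖smoothConjOp g M ψ h w‖) ^ 2 := by
    rw [mul_pow, mul_pow, h1, h2, mul_add, mul_add]
    exact add_le_add (hest _ (testSpace.tsupport_re_subset w)) (hest _ (testSpace.tsupport_im_subset w))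
  have h4 := (sq_le_sq₀ (by positivity) (by positivity)).1 h3
  rw [div_mul_eq_mul_div, le_div_iff₀ hh]
  linarith

theorem GreenOperators.IsLimitingCarlemanWeight.exists_extension {U : Set N} {φ : N → ℝ}
    (hφ : IsLimitingCarlemanWeight g U φ) (hM : IsClosed M) (hU : IsOpen U) (hMU : M ⊆ U) :
    ∃ ψ : SmoothFn n N, ExtendsNear M φ ψ ∧
      ∃ O : Set N, IsOpen O ∧ M ⊆ O ∧ IsLimitingCarlemanWeight g O ψ := by
  obtain ⟨χ, O, hO, hMO, hOU, h1, hs⟩ := exists_smooth_cutoff (n := n) hM hU hMU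
  have hE : EqOn φ (fun x => χ x * φ x) O := fun x hx => by
    simp only [h1 x hx, one_mul]
  exact ⟨⟨fun x => χ x * φ x, χ.contMDiff.mul_of_tsupport_subset hU hs hφ.smooth⟩,
    ⟨O, hO, hMO, hE⟩, O, hO, hMO, hφ.congr g hO hOU hE⟩

/-- The complex conjugate of a test function. -/
noncomputable def testSpace.star (w : testSpace n M) : testSpace n M :=
  ⟨fun x => starRingEnd ℂ ((w : N → ℂ) x), Complex.conjCLE.contDiff.contMDiff.comp (testSpace.contMDiff w),
    w.2.2.1.comp_left (map_zero _),
    (closure_mono (Function.support_comp_subset (map_zero _) _)).trans w.2.2.2⟩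

theorem testSpace.re_star (w : testSpace n M) : testSpace.re (testSpace.star w) = (testSpace.re w) := rfl

theorem testSpace.im_star (w : testSpace n M) : testSpace.im (testSpace.star w) = (-1 : ℝ) • (testSpace.im w) := by
  ext x
  change -((w : N → ℂ) x).im = -1 * ((w : N → ℂ) x).im
  ring

/-- The weak equation is bilinear and the inner product conjugate linear in its first slot, so one
tests with the conjugate of w. -/
theorem isWeakConj_of_inner (hψ : ExtendsNear M φ ψ) (h : ℝ) {u v : L2 g M}
    (H : ∀ w : testSpace n M, inner ℂ (smoothConjOp g M (-ψ) h w) u = inner ℂ (testToL2 g M w) v) :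
    IsWeakConj g M φ h u v := by
  intro w hw
  have h1 := H (testSpace.star ⟨w, hw⟩)
  rw [MeasureTheory.L2.inner_def, MeasureTheory.L2.inner_def] at h1
  have h2 : ∫ x, inner ℂ (smoothConjOp g M (-ψ) h (testSpace.star ⟨w, hw⟩) x) (u x)
      ∂((riemVolume g).restrict M) = ∫ x in M, u x * conjOp g (-φ) h w x ∂(riemVolume g) := by
    refine integral_congr_ae ?_
    filter_upwards [coeFn_smoothConjOp g (-ψ) h (testSpace.star ⟨w, hw⟩)] with x hx
    rw [hx, hψ.neg.conjOp_eq g h ⟨w, hw⟩, testSpace.re_star, testSpace.im_star, conj_smul,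
      RCLike.inner_apply]
    congr 1
    apply Complex.ext
    · simp [cplx]
    · simp [cplx]
  have h3 : ∫ x, inner ℂ (testToL2 g M (testSpace.star ⟨w, hw⟩) x) (v x)
      ∂((riemVolume g).restrict M) = ∫ x in M, v x * w x ∂(riemVolume g) := by
    refine integral_congr_ae ?_
    filter_upwards [coeFn_testToL2 g (testSpace.star ⟨w, hw⟩)] with x hx
    rw [hx, RCLike.inner_apply]
    congr 1
    exact Complex.conj_conj _
  rw [← h2, ← h3, h1]

/-- Multiplication by a smooth real function on `L²(M)`. -/
theorem exists_smul_L2 (a : SmoothFn n N) {K : ℝ} (hK : ∀ x, |a x| ≤ K) (u : L2 g M) :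
    ∃ f : L2 g M, (f =ᵐ[(riemVolume g).restrict M] fun x => (a x : ℂ) * u x) ∧ ‖f‖ ≤ K * ‖u‖ := by
  have hm : MemLp (fun x => (a x : ℂ) * u x) 2 ((riemVolume g).restrict M) := by
    refine (Lp.memLp u).of_le_mul (c := K) ?_ (Filter.Eventually.of_forall fun x => ?_)
    · have := a.contMDiff.continuous
      exact (Complex.continuous_ofReal.comp this).aestronglyMeasurable.mul
        (Lp.aestronglyMeasurable u)
    · rw [norm_mul, Complex.norm_real]
      exact mul_le_mul_of_nonneg_right (hK x) (norm_nonneg _)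
  refine ⟨hm.toLp, hm.coeFn_toLp, Lp.norm_le_mul_norm_of_ae_le_mul ?_⟩
  filter_upwards [hm.coeFn_toLp] with x hx
  rw [hx, norm_mul, Complex.norm_real]
  exact mul_le_mul_of_nonneg_right (hK x) (norm_nonneg _)

theorem laplacian_eq_cplx {w : N → ℂ} (hw : w ∈ testFunctions n M) :
    laplacian g w = cplx (lap g (testSpace.re ⟨w, hw⟩ : SmoothFn n N))
      (lap g (testSpace.im ⟨w, hw⟩ : SmoothFn n N)) := by
  ext x
  apply Complex.ext
  · exact map_laplacian g Complex.reCLM hw.1 x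
  · exact map_laplacian g Complex.imCLM hw.1 x

theorem conj_neg_exp_mul (ψ u : SmoothFn n N) (h : ℝ) :
    conj g (-ψ) h (exp (-(h⁻¹ • ψ)) * u) = (-h ^ 2) • (exp (-(h⁻¹ • ψ)) * lap g u) := by
  have h1 := exp_neg_mul_exp (h⁻¹ • ψ)
  rw [conj, smul_neg, neg_neg, ← mul_assoc, mul_comm (exp (h⁻¹ • ψ)), h1, one_mul, mul_smul_comm]

/-- Test the weak equation with e^{-ψ/h}w: by `conj_neg_exp_mul` the transposed operator turns it
into -h²e^{-ψ/h}Δw. -/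
theorem isWeakLaplacian_of_isWeakConj (hψ : ExtendsNear M φ ψ) {h : ℝ} (hh : h ≠ 0)
    {u v f k : L2 g M} (huv : IsWeakConj g M φ h u v)
    (hf : f =ᵐ[(riemVolume g).restrict M] fun x => ((exp (-(h⁻¹ • ψ)) x : ℝ) : ℂ) * u x)
    (hk : k =ᵐ[(riemVolume g).restrict M]
      fun x => (((-(h ^ 2)⁻¹ : ℝ) • exp (-(h⁻¹ • ψ)) : SmoothFn n N) x : ℂ) * v x) :
    IsWeakLaplacian g M f k := by
  intro w hw
  set η := exp (-(h⁻¹ • ψ)) with hη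
  have hw' : (fun x => ((η x : ℝ) : ℂ) * w x) ∈ testFunctions n M :=
    ⟨η.contMDiff.ofReal_mul hw.1, hw.2.1.mul_left,
      (tsupport_mul_subset_right (f := fun x => ((η x : ℝ) : ℂ)) (g := w)).trans hw.2.2⟩
  have h1 := huv _ hw'
  have hre : testSpace.re ⟨_, hw'⟩ = η * testSpace.re (⟨w, hw⟩ : testSpace n M) := by
    ext x
    exact map_ofReal_mul Complex.reCLM (η x) (w x)
  have him : testSpace.im ⟨_, hw'⟩ = η * testSpace.im (⟨w, hw⟩ : testSpace n M) := by
    ext x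
    exact map_ofReal_mul Complex.imCLM (η x) (w x)
  have h2 : conjOp g (-φ) h (fun x => ((η x : ℝ) : ℂ) * w x) =
      fun x => (-h ^ 2 : ℂ) * (((η x : ℝ) : ℂ) * laplacian g w x) := by
    rw [hψ.neg.conjOp_eq g h ⟨_, hw'⟩, hre, him, hη, conj_neg_exp_mul, conj_neg_exp_mul,
      laplacian_eq_cplx g hw]
    ext x
    have : (-h ^ 2 : ℂ) = ((-h ^ 2 : ℝ) : ℂ) := by push_cast; ring
    rw [this, ← mul_assoc, ← Complex.ofReal_mul]
    apply Complex.ext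
    · rw [Complex.re_ofReal_mul, mul_assoc]; rfl
    · rw [Complex.im_ofReal_mul, mul_assoc]; rfl
  rw [h2] at h1
  have hhc : (h : ℂ) ≠ 0 := Complex.ofReal_ne_zero.2 hh
  have h3 : ∫ x in M, f x * laplacian g w x ∂(riemVolume g) = -((h : ℂ) ^ 2)⁻¹ *
      ∫ x in M, u x * ((-h ^ 2 : ℂ) * (((η x : ℝ) : ℂ) * laplacian g w x)) ∂(riemVolume g) := by
    rw [← integral_const_mul]
    refine integral_congr_ae ?_
    filter_upwards [hf] with x hx
    rw [hx]
    field_simp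
  rw [h3, h1, ← integral_const_mul]
  refine integral_congr_ae ?_
  filter_upwards [hk] with x hx
  rw [hx]
  change _ = (((-(h ^ 2)⁻¹ * η x : ℝ)) : ℂ) * v x * w x
  push_cast
  ring

end

/-! ### Assembling the Green operators -/

section
variable {n : ℕ} {N : Type*} [TopologicalSpace N] [ChartedSpace (Coord n) N]
  [IsManifold (𝓡 n) ∞ N] [T2Space N] [CompactSpace N] [MeasurableSpace N] [BorelSpace N]
  (g : RiemMetric n N) {M : Set N}

open SmoothFn

/-- The Carleman estimate on test functions, for a limiting Carleman weight and its negative. -/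
theorem GreenOperators.IsLimitingCarlemanWeight.exists_norm_testToL2_le {U : Set N} {φ : N → ℝ}
    (hφ : IsLimitingCarlemanWeight g U φ) (hM : IsClosed M) (hU : IsOpen U) (hMU : M ⊆ U) :
    ∃ ψ : SmoothFn n N, ExtendsNear M φ ψ ∧ ∃ C > 0, ∃ h₀ > 0, ∀ h : ℝ, 0 < h → h < h₀ →
      (∀ w, ‖testToL2 g M w‖ ≤ C / h * ‖smoothConjOp g M ψ h w‖) ∧
      ∀ w, ‖testToL2 g M w‖ ≤ C / h * ‖smoothConjOp g M (-ψ) h w‖ := by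
  obtain ⟨ψ, hψ, O, hO, hMO, hL⟩ := hφ.exists_extension g hM hU hMU
  have hL' : IsLimitingCarlemanWeight g O ⇑(-ψ) := hL.neg g
  obtain ⟨C₁, hC₁, h₁, hh₁, H₁⟩ := carleman_estimate g hM hO hMO ψ hL
  obtain ⟨C₂, hC₂, h₂, hh₂, H₂⟩ := carleman_estimate g hM hO hMO (-ψ) hL'
  refine ⟨ψ, hψ, max C₁ C₂, lt_max_of_lt_left hC₁, min h₁ h₂, lt_min hh₁ hh₂,
    fun h hh hlt => ⟨fun w => ?_, fun w => ?_⟩⟩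
  · refine (norm_testToL2_le g hC₁ hh ψ (H₁ h hh (hlt.trans_le (min_le_left _ _))) w).trans ?_
    gcongr
    exact le_max_left _ _
  · refine (norm_testToL2_le g hC₂ hh (-ψ) (H₂ h hh (hlt.trans_le (min_le_right _ _))) w).trans ?_
    gcongr
    exact le_max_right _ _

/-- A weak solution of the conjugated equation lies in `e^{φ/h} H_Δ(M)`, with an estimate. -/
theorem exists_isWeakLaplacian {φ : N → ℝ} {ψ : SmoothFn n N} (hM : IsClosed M)
    (hψ : ExtendsNear M φ ψ) {h : ℝ} (hh : h ≠ 0) :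
    ∃ K ≥ 0, ∀ u v : L2 g M, IsWeakConj g M φ h u v → ∃ f k : L2 g M, IsWeakLaplacian g M f k ∧
      (u =ᵐ[(riemVolume g).restrict M] fun x => (Real.exp (φ x / h) : ℂ) * f x) ∧
      Real.sqrt (‖f‖ ^ 2 + ‖k‖ ^ 2) ≤ K * (‖u‖ + ‖v‖) := by
  obtain ⟨K₁, hK₁⟩ := exists_bound (exp (-(h⁻¹ • ψ)))
  obtain ⟨K₂, hK₂⟩ := exists_bound ((-(h ^ 2)⁻¹ : ℝ) • exp (-(h⁻¹ • ψ)))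
  refine ⟨max 0 (max K₁ K₂), le_max_left _ _, fun u v huv => ?_⟩
  obtain ⟨f, hf, hfn⟩ := exists_smul_L2 g (M := M) _ hK₁ u
  obtain ⟨k, hk, hkn⟩ := exists_smul_L2 g (M := M) _ hK₂ v
  refine ⟨f, k, isWeakLaplacian_of_isWeakConj g hψ hh huv hf hk, ?_, ?_⟩
  · obtain ⟨O, -, hMO, hE⟩ := hψ
    filter_upwards [hf, ae_restrict_mem hM.measurableSet] with x hx hxM
    rw [hx, hE (hMO hxM), ← mul_assoc, ← Complex.ofReal_mul, exp_apply, ← Real.exp_add]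
    have : ψ x / h + (-(h⁻¹ • ψ)) x = 0 := by
      change ψ x / h + -(h⁻¹ * ψ x) = 0
      rw [div_eq_inv_mul, add_neg_cancel]
    rw [this, Real.exp_zero, Complex.ofReal_one, one_mul]
  · have h1 : ‖f‖ ≤ max 0 (max K₁ K₂) * ‖u‖ := hfn.trans (by gcongr; simp)
    have h2 : ‖k‖ ≤ max 0 (max K₁ K₂) * ‖v‖ := hkn.trans (by gcongr; simp)
    refine Real.sqrt_le_iff.2 ⟨by positivity, ?_⟩
    have h3 : ‖f‖ + ‖k‖ ≤ max 0 (max K₁ K₂) * (‖u‖ + ‖v‖) := by rw [mul_add]; exact add_le_add h1 h2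
    refine le_trans ?_ (pow_le_pow_left₀ (by positivity) h3 2)
    nlinarith [mul_nonneg (norm_nonneg f) (norm_nonneg k)]

end

theorem theorem2p3 {n : ℕ} (hn : 3 ≤ n)
    {N : Type*} [TopologicalSpace N] [T2Space N] [CompactSpace N]
    [ChartedSpace (Coord n) N] [IsManifold (𝓡 n) ∞ N]
    [MeasurableSpace N] [BorelSpace N]
    (g : RiemMetric n N) (M U : Set N) (hM : IsCompactSmoothDomain n M) (hU : IsOpen U)
    (hMU : M ⊆ U) :
    ∃ G : (N → ℝ) → ℝ → (L2 g M →L[ℂ] L2 g M),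
      ∀ φ : N → ℝ, IsLimitingCarlemanWeight g U φ →
        ∃ C > 0, ∃ h₀ > 0, ∀ h : ℝ, 0 < h → h < h₀ →
          -- `P_φ G_φ = I` on `L²(M)`
          (∀ v : L2 g M, IsWeakConj g M φ h (G φ h v) v) ∧
          -- `‖G_φ‖ = O(1/h)`
          ‖G φ h‖ ≤ C / h ∧
          -- `G_φ` maps `L²(M)` continuously to `e^{φ/h} H_Δ(M)`, where `H_Δ(M)` consists of the
          -- `f ∈ L²(M)` with `k = Δf ∈ L²(M)` and has the norm `(‖f‖² + ‖Δf‖²)^{1/2}`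
          (∃ K : ℝ, ∀ v : L2 g M, ∃ f k : L2 g M, IsWeakLaplacian g M f k ∧
            (G φ h v =ᵐ[(riemVolume g).restrict M]
              fun x => (Real.exp (φ x / h) : ℂ) * f x) ∧
            Real.sqrt (‖f‖ ^ 2 + ‖k‖ ^ 2) ≤ K * ‖v‖) ∧
          -- `G_φ^* = G_{-φ}`
          ContinuousLinearMap.adjoint (G φ h) = G (-φ) h ∧
          -- `G_φ P_φ = I` on `C₀^∞(M^int)`
          (∀ w ∈ testFunctions n M,
            ∃ hw : MemLp (conjOp g φ h w) 2 ((riemVolume g).restrict M),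
              G φ h (hw.toLp (conjOp g φ h w)) =ᵐ[(riemVolume g).restrict M] w) := by
  have hMc := hM.isCompact.isClosed
  refine ⟨fun φ h => greenOperator (testToL2 g M) (weightConjOp g M φ h) (weightConjOp g M (-φ) h),
    fun φ hφ => ?_⟩
  obtain ⟨ψ, hψ, C, hC, h₀, hh₀, H⟩ := hφ.exists_norm_testToL2_le g hMc hU hMU
  refine ⟨2 * C, by positivity, h₀, hh₀, fun h hh hlt => ?_⟩
  obtain ⟨H₁, H₂⟩ := H h hh hlt
  have hadj := inner_smoothConjOp g (M := M) ψ h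
  -- Both operators are now expressed by one extension ψ and its negative, so that the operator for
  -- -φ is the one for φ with the two roles exchanged.
  simp only [neg_neg, hψ.weightConjOp_eq g h, hψ.neg.weightConjOp_eq g h]
  have hweak : ∀ v : L2 g M, IsWeakConj g M φ h
      (greenOperator (testToL2 g M) (smoothConjOp g M ψ h) (smoothConjOp g M (-ψ) h) v) v :=
    fun v => isWeakConj_of_inner g hψ h fun w => inner_greenOperator H₂ H₁ hadj w v
  have hnorm := norm_greenOperator_le (div_pos hC hh).le H₁ H₂
  refine ⟨hweak, by rwa [mul_div_assoc], ?_, adjoint_greenOperator H₁ H₂ hadj, fun w hw => ?_⟩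
  · obtain ⟨K, hK, hreg⟩ := exists_isWeakLaplacian g hMc hψ hh.ne'
    -- The regularity bound involves ‖G_φ v‖ + ‖v‖, and ‖G_φ‖ ≤ 2C/h.
    refine ⟨K * (2 * (C / h) + 1), fun v => ?_⟩
    obtain ⟨f, k, hfk, hf, hle⟩ := hreg _ v (hweak v)
    refine ⟨f, k, hfk, hf, hle.trans ?_⟩
    rw [mul_assoc, add_mul, one_mul]
    gcongr
    exact ContinuousLinearMap.le_of_opNorm_le _ hnorm v
  · have heq := hψ.conjOp_eq g h (⟨w, hw⟩ : testSpace n M)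
    have hmem : MemLp (conjOp g φ h w) 2 ((riemVolume g).restrict M) :=
      heq ▸ SmoothFn.memLp_cplx g M _ _
    have hLp : hmem.toLp (conjOp g φ h w) = smoothConjOp g M ψ h ⟨w, hw⟩ := by
      refine Lp.ext (hmem.coeFn_toLp.trans ?_)
      rw [show conjOp g φ h w = _ from heq]
      exact (coeFn_smoothConjOp g ψ h ⟨w, hw⟩).symm
    refine ⟨hmem, ?_⟩
    rw [hLp, greenOperator_apply_apply H₁]
    exact coeFn_testToL2 g ⟨w, hw⟩
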